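/- **Setting.** Let $\Bbbk$ be an algebraically closed field. Let $A=\bigoplus_{i,j\in \mathbf I}1_iA1_j$ be a locally unital $\mathbb Z$-graded associative $\Bbbk$-algebra, where the $1_i$ are mutually orthogonal homogeneous idempotents. Assume that every $1_iA_d1_j$ is finite-dimensional and that for all $i,j$ one has $1_iA_d1_j=0$ for $d\ll 0$. Let $A\text{-gmod}$ be the abelian category of graded left modules $V=\bigoplus_i 1_iV$ with degree-preserving homomorphisms, let $(q^dV)_n:=V_{n+d}$, and let $\operatorname{Ext}^n_A(V,W):=\bigoplus_{d\in\mathbb Z}\operatorname{Ext}^n_{A\text{-gmod}}(V,q^dW)$. A graded module $V$ is locally finite-dimensional if all $1_iV_d$ are finite-dimensional, and bounded below (above) if for each $i$ one has $1_iV_d=0$ for $d\ll0$ ($d\gg 0$). A *graded triangular basis* of $A$ consists of a subset $\mathbf S\subseteq \mathbf I$, a poset $\Lambda$ in which all sets $\{\mu\le\lambda\}$ are finite, a map $\mathbf S\to\Lambda$, $s\mapsto\dot s$, with finite fibers $\mathbf S_\lambda$, and sets of homogeneous elements $X(i,s)\subset 1_iA1_s$, $H(s,t)\subset 1_sA1_t$,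 $Y(t,j)\subset 1_tA1_j$ ($i,j\in\mathbf I$, $s,t\in\mathbf S$) such that: the products $xhy$ with $x\in X(i,s)$, $h\in H(s,t)$, $y\in Y(t,j)$ for some $i,s,t,j$ form a basis of $A$; $X(s,s)=Y(s,s)=\{1_s\}$; for $s\ne t$ in $\mathbf S$, $X(s,t)\neq\varnothing\Rightarrow\dot s>\dot t$, $H(s,t)\ne\varnothing\Rightarrow\dot s=\dot t$, $Y(s,t)\neq\varnothing\Rightarrow\dot s<\dot t$; and for each $i\in\mathbf I\setminus\mathbf S$ there are only finitely many $s$ with $X(i,s)\cup Y(s,i)\neq\varnothing$. Put $e_\lambda:=\sum_{s\in\mathbf S_\lambda}1_s$, let $A_{\ge\lambda}$ be the quotient of $A$ by the two-sided ideal generated by all $e_\mu$ with $\mu\not\ge\lambda$, let $\bar e_\lambda$ and $\bar 1_i$ be the images of $e_\lambda$ and $1_i$ in $A_{\ge\lambda}$, and let $A_\lambda:=\bar e_\lambda A_{\ge\lambda}\bar e_\lambda$, a unital graded algebra. For a graded $A_\lambda$-module $\bar V$ put $$j^\lambda_!\bar V:=A_{\ge\lambda}\bar e_\lambda\otimes_{A_\lambda}\bar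 V,\qquad j^\lambda_*\bar V:=\bigoplus_{i\in\mathbf I}\operatorname{Hom}_{A_\lambda}(\bar e_\lambda A_{\ge\lambda}\bar 1_i,\bar V),$$ viewed as graded $A$-modules, where $\operatorname{Hom}$ is the direct sum over $d\in\mathbb Z$ of the spaces of homomorphisms of degree $d$. A $\Delta$-layer (resp. $\bar\Delta$-layer) of type $\lambda$ is a graded $A$-module isomorphic to $j_!^\lambda\bar V$ for a projective (resp. arbitrary) graded $A_\lambda$-module $\bar V$ that is locally finite-dimensional and bounded below. A $\nabla$-layer (resp. $\bar\nabla$-layer) of type $\lambda$ is one isomorphic to $j_*^\lambda\bar V$ for an injective (resp. arbitrary) graded $A_\lambda$-module $\bar V$ that is locally finite-dimensional and bounded above. A unital graded algebra $R$ is a *based affine quasi-hereditary algebra* with weight poset $P$ if, for some system of idempotents making it a locally finite-dimensional, bounded below, locally unital graded algebra, it is equipped with a graded triangular basis with weight poset $P$ such that $s\mapsto\dot s$ is a bijection $\mathbf S\to P$ (so that $\mathbf S$ is identified with $P$) and, for every $p\in P$, the quotient of $R_p$ by its graded Jacobson radical is $\Bbbk$. **Refinement.** Let $A$ be equipped with a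 graded triangular basis, and suppose that for each $\lambda\in\Lambda$ the algebra $A_\lambda$ is given the structure of a based affine quasi-hereditary algebra with weight poset $(\mathbf B_\lambda,\le_\lambda)$. The layers for this structure on $A_\lambda$ are called $\Delta_\lambda$-, $\bar\Delta_\lambda$-, $\nabla_\lambda$- and $\bar\nabla_\lambda$-layers of type $b\in\mathbf B_\lambda$. Let $\mathbf B:=\coprod_\lambda\mathbf B_\lambda$. For $b\in\mathbf B_\lambda$, a *pure-$\Delta$-layer* (resp. *pure-$\bar\Delta$-layer*) of type $b$ is a graded $A$-module isomorphic to $j_!^\lambda\bar V$ for a $\Delta_\lambda$-layer (resp. $\bar\Delta_\lambda$-layer) $\bar V$ of type $b$, and a *pure-$\nabla$-layer* (resp. *pure-$\bar\nabla$-layer*) of type $b$ is one isomorphic to $j_*^\lambda\bar V$ for a $\nabla_\lambda$-layer (resp. $\bar\nabla_\lambda$-layer) $\bar V$ of type $b$. A graded $A$-module $V$ has a pure-$\Delta$-flag (resp. pure-$\bar\Delta$-flag) if for some $n\ge0$ there are a graded filtration $0=V_0\subseteq V_1\subseteq\dots\subseteq V_n=V$ and distinct $b_1,\dots,b_n\in\mathbf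 B$ such that each $V_r/V_{r-1}$ is a pure-$\Delta$-layer (resp. pure-$\bar\Delta$-layer) of type $b_r$. It has a pure-$\nabla$-flag (resp. pure-$\bar\nabla$-flag) if for some $n\ge 0$ there are a graded filtration $V=V_0\supseteq V_1\supseteq\dots\supseteq V_n=0$ and distinct $b_1,\dots,b_n\in\mathbf B$ such that each $V_{r-1}/V_r$ is a pure-$\nabla$-layer (resp. pure-$\bar\nabla$-layer) of type $b_r$. **Theorem.** Let $V,W$ be graded left $A$-modules. In either of the following situations, $\operatorname{Ext}^n_A(V,W)=0$ for all $n\ge1$: 1. $V$ has a pure-$\Delta$-flag and $W$ has a pure-$\bar\nabla$-flag; 2. $V$ has a pure-$\bar\Delta$-flag and $W$ has a pure-$\nabla$-flag. -/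

import Mathlib

open CategoryTheory CategoryTheory.Limits

namespace GradedTriangular

universe u v w w'

noncomputable section

/-! ### Gradings -/

section Grading

variable {k : Type u} [Field k] {M : Type u} [AddCommGroup M] [Module k M]

/-- The linear projection of a `ℤ`-graded vector space onto its degree `n` component. -/
def homComp {U : ℤ → Submodule k M} (h : DirectSum.IsInternal U) (n : ℤ) : M →ₗ[k] M :=
  (U n).subtype ∘ₗ DirectSum.component k ℤ (fun i => U i) n ∘ₗ
    (LinearEquiv.ofBijective (DirectSum.coeLinearMap U) h).symm.toLinearMap

variable {U : ℤ → Submodule k M} (h : DirectSum.IsInternal U)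

theorem homComp_mem (n : ℤ) (x : M) : homComp h n x ∈ U n := by
  simp [homComp]

theorem homComp_same {n : ℤ} {x : M} (hx : x ∈ U n) : homComp h n x = x := by
  have := h.ofBijective_coeLinearMap_of_mem hx
  exact congrArg Subtype.val this

theorem homComp_ne {m n : ℤ} (hmn : m ≠ n) {x : M} (hx : x ∈ U m) : homComp h n x = 0 := by
  have := h.ofBijective_coeLinearMap_of_mem_ne hmn hx
  exact congrArg Subtype.val this

theorem iSup_deg {U : ℤ → Submodule k M} (h : DirectSum.IsInternal U) : ⨆ n, U n = ⊤ :=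
  h.submodule_iSup_eq_top

/-- Every vector is the sum of its homogeneous components. -/
theorem exists_sum_homComp (x : M) : ∃ s : Finset ℤ, x = ∑ n ∈ s, homComp h n x := by
  classical
  have hs : ∀ x : M, ∃ s : Finset ℤ, ∀ t, s ⊆ t → x = ∑ n ∈ t, homComp h n x := by
    intro x
    have hx : x ∈ ⨆ n, U n := by rw [iSup_deg h]; trivial
    induction hx using Submodule.iSup_induction' with
    | mem m x hx =>
      refine ⟨{m}, fun t ht => ?_⟩
      rw [Finset.sum_eq_single m (fun n _ hn => homComp_ne h hn.symm hx)
        (fun hm => absurd (ht (by simp)) hm), homComp_same h hx]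
    | zero => exact ⟨∅, fun t _ => by simp⟩
    | add x y _ _ hx hy =>
      obtain ⟨s, hs⟩ := hx
      obtain ⟨t, ht⟩ := hy
      refine ⟨s ∪ t, fun r hr => ?_⟩
      simp only [map_add, Finset.sum_add_distrib]
      rw [← hs r (Finset.union_subset_left hr), ← ht r (Finset.union_subset_right hr)]
  obtain ⟨s, hs⟩ := hs x
  exact ⟨s, hs s le_rfl⟩

/-- A family of subspaces with suitable projections is a direct sum decomposition. -/
theorem isInternal_of_proj {ι : Type w} [DecidableEq ι] {M : Type w'} [AddCommGroup M]
    [Module k M] {U : ι → Submodule k M}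
    (c : ι → M →ₗ[k] M) (h1 : ∀ n, ∀ x ∈ U n, c n x = x)
    (h2 : ∀ m n, m ≠ n → ∀ x ∈ U m, c n x = 0) (h3 : ⨆ n, U n = ⊤) :
    DirectSum.IsInternal U := by
  refine DirectSum.isInternal_submodule_of_iSupIndep_of_iSup_eq_top ?_ h3
  intro n
  rw [Submodule.disjoint_def]
  intro x hx hx'
  rw [← h1 n x hx]
  have : (⨆ j, ⨆ (_ : j ≠ n), U j) ≤ LinearMap.ker (c n) :=
    iSup_le fun j => iSup_le fun hj => fun y hy => h2 j n hj y hy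
  exact this hx'

/-- The grading of a subspace that contains the homogeneous components of its elements. -/
theorem isInternal_sub (K : Submodule k M) (hK : ∀ n, ∀ x ∈ K, homComp h n x ∈ K) :
    DirectSum.IsInternal (fun n => (U n).comap K.subtype) := by
  refine isInternal_of_proj (fun n => (homComp h n).restrict (hK n)) ?_ ?_ ?_
  · intro n x hx
    exact Subtype.ext (homComp_same h hx)
  · intro m n hmn x hx
    exact Subtype.ext (homComp_ne h hmn hx)
  · rw [eq_top_iff]
    rintro x -
    obtain ⟨s, hs⟩ := exists_sum_homComp h x.1
    have : x = ∑ n ∈ s, (⟨homComp h n x.1, hK n _ x.2⟩ : K) := by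
      apply Subtype.ext
      simpa using hs
    rw [this]
    exact Submodule.sum_mem _ fun n _ =>
      Submodule.mem_iSup_of_mem n (homComp_mem h n x.1)

/-- The grading of a quotient by such a subspace. -/
theorem isInternal_quot (K : Submodule k M) (hK : ∀ n, ∀ x ∈ K, homComp h n x ∈ K) :
    DirectSum.IsInternal (fun n => (U n).map K.mkQ) := by
  refine isInternal_of_proj (fun n => K.mapQ K (homComp h n) (hK n)) ?_ ?_ ?_
  · rintro n _ ⟨x, hx, rfl⟩
    simp [homComp_same h hx]
  · rintro m n hmn _ ⟨x, hx, rfl⟩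
    simp [homComp_ne h hmn hx]
  · rw [← Submodule.map_iSup, iSup_deg h, Submodule.map_top, Submodule.range_mkQ]

theorem homComp_sub (K : Submodule k M) (hK : ∀ n, ∀ x ∈ K, homComp h n x ∈ K) (n : ℤ) (x : K) :
    (homComp (isInternal_sub h K hK) n x : M) = homComp h n x := by
  have hx : x ∈ ⨆ n, (U n).comap K.subtype := by
    rw [iSup_deg (isInternal_sub h K hK)]; trivial
  induction hx using Submodule.iSup_induction' with
  | mem m x hx =>
    by_cases hmn : m = n
    · subst hmn
      rw [homComp_same (isInternal_sub h K hK) hx, homComp_same h (show x.1 ∈ U m from hx)]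
    · rw [homComp_ne (isInternal_sub h K hK) hmn hx, homComp_ne h hmn (show x.1 ∈ U m from hx)]
      rfl
  | zero => simp
  | add x y _ _ hx hy => simp [hx, hy]

theorem map_homComp {N : Type u} [AddCommGroup N] [Module k N] {U' : ℤ → Submodule k N}
    (h' : DirectSum.IsInternal U') (f : M →ₗ[k] N) (d : ℤ)
    (hf : ∀ n, ∀ x ∈ U n, f x ∈ U' (n + d)) (n : ℤ) (x : M) :
    homComp h' (n + d) (f x) = f (homComp h n x) := by
  have hx : x ∈ ⨆ n, U n := by rw [iSup_deg h]; trivial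
  induction hx using Submodule.iSup_induction' with
  | mem m x hx =>
    by_cases hmn : m = n
    · subst hmn
      rw [homComp_same h hx, homComp_same h' (hf _ _ hx)]
    · rw [homComp_ne h hmn hx, homComp_ne h' (m := m + d) (by omega) (hf _ _ hx), map_zero]
  | zero => simp
  | add x y _ _ hx hy => simp [hx, hy]

end Grading

/-! ### Locally unital graded algebras -/

/-- The subspace `1_i R 1_j`, for a family `ε` of idempotents `1_i` of `R`. -/
def peirce (k : Type u) [Field k] {R : Type u} [NonUnitalRing R] [Module k R]
    [IsScalarTower k R R] [SMulCommClass k R R] {I : Type v} (ε : I → R) (i j : I) :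
    Submodule k R where
  carrier := {x | ε i * x = x ∧ x * ε j = x}
  add_mem' := by
    rintro a b ⟨h1, h2⟩ ⟨h3, h4⟩
    exact ⟨by rw [mul_add, h1, h3], by rw [add_mul, h2, h4]⟩
  zero_mem' := by simp
  smul_mem' := by
    rintro c a ⟨h1, h2⟩
    exact ⟨by rw [mul_smul_comm, h1], by rw [smul_mul_assoc, h2]⟩

/-- A locally unital graded `k`-algebra `A = ⨁_{i,j} 1_i A 1_j`, with a distinguished system
`1_i` of mutually orthogonal homogeneous idempotents; a homogeneous idempotent has degree `0`,
and the sum of the `1_i A 1_j` is automatically direct, see `GrAlgebra.isInternal_peirce`. -/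
structure GrAlgebra (k : Type u) [Field k] (I : Type v) where
  carrier : Type u
  [ring : NonUnitalRing carrier]
  [module : Module k carrier]
  [tower : IsScalarTower k carrier carrier]
  [comm : SMulCommClass k carrier carrier]
  deg : ℤ → Submodule k carrier
  internal : DirectSum.IsInternal deg
  mul_mem : ∀ {m n : ℤ} {a b : carrier}, a ∈ deg m → b ∈ deg n → a * b ∈ deg (m + n)
  one : I → carrier
  one_mem : ∀ i, one i ∈ deg 0
  one_mul_one : ∀ i, one i * one i = one i
  one_orth : ∀ i j, i ≠ j → one i * one j = 0
  iSup_peirce : ⨆ i, ⨆ j, peirce k one i j = ⊤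

attribute [instance] GrAlgebra.ring GrAlgebra.module GrAlgebra.tower GrAlgebra.comm

namespace GrAlgebra

variable {k : Type u} [Field k] {I : Type v} (A : GrAlgebra k I)

theorem isInternal_peirce [DecidableEq I] :
    DirectSum.IsInternal (fun p : I × I => peirce k A.one p.1 p.2) := by
  refine isInternal_of_proj
    (fun p => LinearMap.mulLeft k (A.one p.1) ∘ₗ LinearMap.mulRight k (A.one p.2)) ?_ ?_ ?_
  · rintro p x ⟨h1, h2⟩
    simp [h1, h2]
  · rintro p q hpq x ⟨h1, h2⟩
    by_cases h : p.1 = q.1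
    · have h' : p.2 ≠ q.2 := fun h' => hpq (Prod.ext h h')
      have : x * A.one q.2 = 0 := by rw [← h2, mul_assoc, A.one_orth _ _ h', mul_zero]
      simp [this]
    · have : A.one q.1 * x = 0 := by
        rw [← h1, ← mul_assoc, A.one_orth _ _ (Ne.symm h), zero_mul]
      simp [← mul_assoc, this]
  · rw [iSup_prod]
    exact A.iSup_peirce

theorem sum_one_mul_one [DecidableEq I] (s : Finset I) (i : I) (hi : i ∈ s) :
    (∑ j ∈ s, A.one j) * A.one i = A.one i := by
  rw [Finset.sum_mul, Finset.sum_eq_single i (fun j _ hj => A.one_orth _ _ hj)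
    (fun h => absurd hi h), A.one_mul_one]

theorem one_mul_sum_one [DecidableEq I] (s : Finset I) (i : I) (hi : i ∈ s) :
    A.one i * (∑ j ∈ s, A.one j) = A.one i := by
  rw [Finset.mul_sum, Finset.sum_eq_single i (fun j _ hj => A.one_orth _ _ hj.symm)
    (fun h => absurd hi h), A.one_mul_one]

theorem exists_local_unit (a : A.carrier) : ∃ s : Finset I, ∀ t, s ⊆ t →
    (∑ i ∈ t, A.one i) * a = a ∧ a * (∑ i ∈ t, A.one i) = a := by
  classical
  have ha : a ∈ ⨆ p : I × I, peirce k A.one p.1 p.2 := by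
    rw [iSup_prod, A.iSup_peirce]; trivial
  induction ha using Submodule.iSup_induction' with
  | mem p x hx =>
    refine ⟨{p.1, p.2}, fun t ht => ⟨?_, ?_⟩⟩
    · rw [← hx.1, ← mul_assoc, A.sum_one_mul_one t _ (ht (by simp))]
    · rw [← hx.2, mul_assoc, A.one_mul_sum_one t _ (ht (by simp))]
  | zero => exact ⟨∅, by simp⟩
  | add x y _ _ hx hy =>
    obtain ⟨s, hs⟩ := hx
    obtain ⟨t, ht⟩ := hy
    refine ⟨s ∪ t, fun r hr => ?_⟩
    have h1 := hs r (Finset.union_subset_left hr)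
    have h2 := ht r (Finset.union_subset_right hr)
    exact ⟨by rw [mul_add, h1.1, h2.1], by rw [add_mul, h1.2, h2.2]⟩

/-- `A` is locally finite-dimensional: each `1_i A_d 1_j` is finite-dimensional. -/
def IsLocallyFiniteDimensional : Prop :=
  ∀ i j d, FiniteDimensional k ↥(peirce k A.one i j ⊓ A.deg d)

/-- `A` is bounded below: `1_i A_d 1_j = 0` for `d < N_{i,j}`. -/
def IsBoundedBelow : Prop :=
  ∀ i j, ∃ N : ℤ, ∀ d < N, peirce k A.one i j ⊓ A.deg d = ⊥

/-- Another system of homogeneous idempotents making the graded algebra `A` locally unital. -/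
structure IdemSystem (J : Type w) where
  one : J → A.carrier
  one_mem : ∀ i, one i ∈ A.deg 0
  one_mul_one : ∀ i, one i * one i = one i
  one_orth : ∀ i j, i ≠ j → one i * one j = 0
  iSup_peirce : ⨆ i, ⨆ j, peirce k one i j = ⊤

/-- The same graded algebra with another distinguished system of idempotents. -/
def reindex {J : Type w} (S : A.IdemSystem J) : GrAlgebra k J where
  carrier := A.carrier
  deg := A.deg
  internal := A.internal
  mul_mem := A.mul_mem
  one := S.one
  one_mem := S.one_mem
  one_mul_one := S.one_mul_one
  one_orth := S.one_orth
  iSup_peirce := S.iSup_peirce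

theorem mul_homComp_left {p : ℤ} {a : A.carrier} (ha : a ∈ A.deg p) (n : ℤ) (x : A.carrier) :
    homComp A.internal n (a * x) = a * homComp A.internal (n - p) x := by
  have := map_homComp A.internal A.internal (LinearMap.mulLeft k a) p
    (fun m x hx => by rw [add_comm]; exact A.mul_mem ha hx) (n - p) x
  simpa using this

theorem mul_homComp_right {p : ℤ} {a : A.carrier} (ha : a ∈ A.deg p) (n : ℤ) (x : A.carrier) :
    homComp A.internal n (x * a) = homComp A.internal (n - p) x * a := by
  have := map_homComp A.internal A.internal (LinearMap.mulRight k a) p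
    (fun m x hx => A.mul_mem hx ha) (n - p) x
  simpa using this

/-! #### Quotients by ideals generated in degree zero -/

/-- The two-sided ideal generated by a set. -/
def ideal (E : Set A.carrier) : Submodule k A.carrier :=
  sInf {J | E ⊆ J ∧ ∀ a, ∀ x ∈ J, a * x ∈ J ∧ x * a ∈ J}

theorem subset_ideal (E : Set A.carrier) : E ⊆ A.ideal E := fun x hx => by
  simp only [ideal, SetLike.mem_coe, Submodule.mem_sInf]
  exact fun J hJ => hJ.1 hx

theorem mul_mem_ideal (E : Set A.carrier) (a : A.carrier) {x : A.carrier} (hx : x ∈ A.ideal E) :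
    a * x ∈ A.ideal E ∧ x * a ∈ A.ideal E := by
  simp only [ideal, Submodule.mem_sInf] at hx ⊢
  exact ⟨fun J hJ => (hJ.2 a x (hx J hJ)).1, fun J hJ => (hJ.2 a x (hx J hJ)).2⟩

theorem homComp_mem_ideal {E : Set A.carrier} (hE : ∀ x ∈ E, x ∈ A.deg 0) (n : ℤ)
    (x : A.carrier) (hx : x ∈ A.ideal E) : homComp A.internal n x ∈ A.ideal E := by
  let J : Submodule k A.carrier := ⨅ n, (A.ideal E).comap (homComp A.internal n)
  suffices h : A.ideal E ≤ J by
    have := h hx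
    simp only [J, Submodule.mem_iInf] at this
    exact this n
  refine sInf_le ⟨fun y hy => ?_, fun a y hy => ?_⟩
  · simp only [J, SetLike.mem_coe, Submodule.mem_iInf, Submodule.mem_comap]
    intro m
    by_cases hm : 0 = m
    · subst hm
      rw [homComp_same A.internal (hE y hy)]
      exact A.subset_ideal E hy
    · rw [homComp_ne A.internal hm (hE y hy)]
      exact zero_mem _
  · simp only [J, Submodule.mem_iInf, Submodule.mem_comap] at hy ⊢
    have ha : a ∈ ⨆ n, A.deg n := by rw [iSup_deg A.internal]; trivial
    induction ha using Submodule.iSup_induction' with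
    | mem p a ha =>
      refine ⟨fun m => ?_, fun m => ?_⟩
      · rw [A.mul_homComp_left ha]
        exact (A.mul_mem_ideal E _ (hy _)).1
      · rw [A.mul_homComp_right ha]
        exact (A.mul_mem_ideal E _ (hy _)).2
    | zero => simp
    | add a b _ _ ha hb =>
      refine ⟨fun m => ?_, fun m => ?_⟩
      · rw [add_mul, map_add]
        exact add_mem (ha.1 m) (hb.1 m)
      · rw [mul_add, map_add]
        exact add_mem (ha.2 m) (hb.2 m)

/-- The multiplication induced on the quotient by a two-sided ideal. -/
def quotMul (E : Set A.carrier) :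
    (A.carrier ⧸ A.ideal E) →ₗ[k] (A.carrier ⧸ A.ideal E) →ₗ[k] (A.carrier ⧸ A.ideal E) :=
  (A.ideal E).liftQ
    { toFun := fun a => (A.ideal E).mapQ (A.ideal E) (LinearMap.mulLeft k a)
        (fun x hx => (A.mul_mem_ideal E a hx).1)
      map_add' := fun a b => by
        apply Submodule.linearMap_qext
        ext x
        change (A.ideal E).mkQ ((a + b) * x) = (A.ideal E).mkQ (a * x) + (A.ideal E).mkQ (b * x)
        rw [add_mul, map_add]
      map_smul' := fun c a => by
        apply Submodule.linearMap_qext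
        ext x
        change (A.ideal E).mkQ ((c • a) * x) = c • (A.ideal E).mkQ (a * x)
        rw [smul_mul_assoc, map_smul] }
    (fun a ha => by
      rw [LinearMap.mem_ker]
      apply Submodule.linearMap_qext
      ext x
      change (A.ideal E).mkQ (a * x) = 0
      simpa using (A.mul_mem_ideal E x ha).2)

theorem quotMul_mk (E : Set A.carrier) (a b : A.carrier) :
    A.quotMul E ((A.ideal E).mkQ a) ((A.ideal E).mkQ b) = (A.ideal E).mkQ (a * b) :=
  rfl

/-- The ring structure on the quotient by a two-sided ideal. -/
abbrev quotRing (E : Set A.carrier) : NonUnitalRing (A.carrier ⧸ A.ideal E) where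
  __ := (inferInstance : AddCommGroup (A.carrier ⧸ A.ideal E))
  mul a b := A.quotMul E a b
  left_distrib a b c := map_add (A.quotMul E a) b c
  right_distrib a b c := by
    change A.quotMul E (a + b) c = A.quotMul E a c + A.quotMul E b c
    rw [map_add, LinearMap.add_apply]
  zero_mul a := by
    change A.quotMul E 0 a = 0
    simp
  mul_zero a := map_zero (A.quotMul E a)
  mul_assoc a b c := by
    obtain ⟨a, rfl⟩ := (A.ideal E).mkQ_surjective a
    obtain ⟨b, rfl⟩ := (A.ideal E).mkQ_surjective b
    obtain ⟨c, rfl⟩ := (A.ideal E).mkQ_surjective c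
    change A.quotMul E (A.quotMul E _ _) _ = A.quotMul E _ (A.quotMul E _ _)
    simp only [quotMul_mk, mul_assoc]

/-- The quotient of `A` by the two-sided ideal generated by a set `E` of elements of degree `0`,
with the images of the distinguished idempotents. -/
def quot (E : Set A.carrier) (hE : ∀ x ∈ E, x ∈ A.deg 0) : GrAlgebra k I :=
  letI := A.quotRing E
  { carrier := A.carrier ⧸ A.ideal E
    ring := A.quotRing E
    module := (inferInstance : Module k (A.carrier ⧸ A.ideal E))
    tower := ⟨fun c a b => by
      change A.quotMul E (c • a) b = c • A.quotMul E a b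
      rw [map_smul, LinearMap.smul_apply]⟩
    comm := ⟨fun c a b => by
      change c • A.quotMul E a b = A.quotMul E a (c • b)
      rw [map_smul]⟩
    deg := fun n => (A.deg n).map (A.ideal E).mkQ
    internal := isInternal_quot A.internal _ (A.homComp_mem_ideal hE)
    mul_mem := by
      rintro m n _ _ ⟨a, ha, rfl⟩ ⟨b, hb, rfl⟩
      exact ⟨a * b, A.mul_mem ha hb, (A.quotMul_mk E a b).symm⟩
    one := fun i => (A.ideal E).mkQ (A.one i)
    one_mem := fun i => ⟨_, A.one_mem i, rfl⟩
    one_mul_one := fun i => by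
      change A.quotMul E _ _ = _
      rw [quotMul_mk, A.one_mul_one]
    one_orth := fun i j hij => by
      change A.quotMul E _ _ = _
      rw [quotMul_mk, A.one_orth i j hij, map_zero]
    iSup_peirce := by
      rw [eq_top_iff, ← Submodule.range_mkQ (A.ideal E), ← Submodule.map_top, ← A.iSup_peirce]
      simp only [Submodule.map_iSup]
      refine iSup_mono fun i => iSup_mono fun j => ?_
      rintro _ ⟨x, hx, rfl⟩
      refine ⟨?_, ?_⟩
      · change A.quotMul E _ _ = _
        rw [quotMul_mk, hx.1]
      · change A.quotMul E _ _ = _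
        rw [quotMul_mk, hx.2] }

/-- The canonical quotient map. -/
def quotMk (E : Set A.carrier) (hE : ∀ x ∈ E, x ∈ A.deg 0) :
    A.carrier →ₗ[k] (A.quot E hE).carrier :=
  (A.ideal E).mkQ

theorem quotMk_mul (E : Set A.carrier) (hE : ∀ x ∈ E, x ∈ A.deg 0) (a b : A.carrier) :
    A.quotMk E hE (a * b) = A.quotMk E hE a * A.quotMk E hE b :=
  (A.quotMul_mk E a b).symm

theorem quotMk_surjective (E : Set A.carrier) (hE : ∀ x ∈ E, x ∈ A.deg 0) :
    Function.Surjective (A.quotMk E hE) :=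
  (A.ideal E).mkQ_surjective

theorem quotMk_mem (E : Set A.carrier) (hE : ∀ x ∈ E, x ∈ A.deg 0) {n : ℤ} {a : A.carrier}
    (ha : a ∈ A.deg n) : A.quotMk E hE a ∈ (A.quot E hE).deg n :=
  ⟨a, ha, rfl⟩

/-! #### Idempotent truncation -/

/-- A homogeneous idempotent (of degree `0`). -/
structure Idem where
  val : A.carrier
  mem : val ∈ A.deg 0
  idem : val * val = val

variable {A}

/-- The subalgebra `eAe`. -/
def Idem.cornerSub (e : A.Idem) : NonUnitalSubalgebra k A.carrier where
  carrier := {x | e.val * x = x ∧ x * e.val = x}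
  add_mem' := by
    rintro a b ⟨h1, h2⟩ ⟨h3, h4⟩
    exact ⟨by rw [mul_add, h1, h3], by rw [add_mul, h2, h4]⟩
  zero_mem' := by simp
  smul_mem' := by
    rintro c a ⟨h1, h2⟩
    exact ⟨by rw [mul_smul_comm, h1], by rw [smul_mul_assoc, h2]⟩
  mul_mem' := by
    rintro a b ⟨h1, h2⟩ ⟨h3, h4⟩
    exact ⟨by rw [← mul_assoc, h1], by rw [mul_assoc, h4]⟩

/-- The subspace `Ae`. -/
def Idem.leftIdeal (e : A.Idem) : Submodule k A.carrier where
  carrier := {x | x * e.val = x}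
  add_mem' := by
    intro a b h1 h2
    simp only [Set.mem_ofPred_eq] at *
    rw [add_mul, h1, h2]
  zero_mem' := by simp
  smul_mem' := by
    intro c a h1
    simp only [Set.mem_ofPred_eq] at *
    rw [smul_mul_assoc, h1]

/-- The subspace `eA`. -/
def Idem.rightIdeal (e : A.Idem) : Submodule k A.carrier where
  carrier := {x | e.val * x = x}
  add_mem' := by
    intro a b h1 h2
    simp only [Set.mem_ofPred_eq] at *
    rw [mul_add, h1, h2]
  zero_mem' := by simp
  smul_mem' := by
    intro c a h1
    simp only [Set.mem_ofPred_eq] at *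
    rw [mul_smul_comm, h1]

theorem Idem.homComp_mul_right (e : A.Idem) (n : ℤ) (x : A.carrier) :
    homComp A.internal n x * e.val = homComp A.internal n (x * e.val) := by
  rw [A.mul_homComp_right e.mem, sub_zero]

theorem Idem.homComp_mul_left (e : A.Idem) (n : ℤ) (x : A.carrier) :
    e.val * homComp A.internal n x = homComp A.internal n (e.val * x) := by
  rw [A.mul_homComp_left e.mem, sub_zero]

theorem Idem.homComp_mem_leftIdeal (e : A.Idem) (n : ℤ) (x : A.carrier) (hx : x ∈ e.leftIdeal) :
    homComp A.internal n x ∈ e.leftIdeal := by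
  change _ * _ = _
  rw [e.homComp_mul_right, show x * e.val = x from hx]

theorem Idem.homComp_mem_rightIdeal (e : A.Idem) (n : ℤ) (x : A.carrier)
    (hx : x ∈ e.rightIdeal) : homComp A.internal n x ∈ e.rightIdeal := by
  change _ * _ = _
  rw [e.homComp_mul_left, show e.val * x = x from hx]

/-- The unital graded algebra `eAe`, with the identity element `e` as its only distinguished
idempotent. -/
def corner (e : A.Idem) : GrAlgebra k Unit where
  carrier := e.cornerSub
  deg n := (A.deg n).comap e.cornerSub.toSubmodule.subtype
  internal := isInternal_sub A.internal e.cornerSub.toSubmodule (fun n x hx =>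
    ⟨e.homComp_mem_rightIdeal n x hx.1, e.homComp_mem_leftIdeal n x hx.2⟩)
  mul_mem ha hb := A.mul_mem ha hb
  one _ := ⟨e.val, e.idem, e.idem⟩
  one_mem _ := e.mem
  one_mul_one _ := Subtype.ext e.idem
  one_orth i j hij := absurd rfl hij
  iSup_peirce := by
    rw [eq_top_iff]
    rintro x -
    exact Submodule.mem_iSup_of_mem () (Submodule.mem_iSup_of_mem ()
      ⟨Subtype.ext x.2.1, Subtype.ext x.2.2⟩)

end GrAlgebra

/-! ### Graded modules -/

/-- A (locally unital) graded left `A`-module `V = ⨁_i 1_i V`; the sum of the `1_i V` is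
automatically direct, see `GrModule.isInternal_weight`. -/
structure GrModule {k : Type u} [Field k] {I : Type v} (A : GrAlgebra k I) where
  carrier : Type u
  [grp : AddCommGroup carrier]
  [module : Module k carrier]
  act : A.carrier →ₗ[k] carrier →ₗ[k] carrier
  act_mul : ∀ a b v, act (a * b) v = act a (act b v)
  deg : ℤ → Submodule k carrier
  internal : DirectSum.IsInternal deg
  act_mem : ∀ {m n : ℤ} {a : A.carrier} {v : carrier},
    a ∈ A.deg m → v ∈ deg n → act a v ∈ deg (m + n)
  iSup_one : ⨆ i, LinearMap.range (act (A.one i)) = ⊤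

attribute [instance] GrModule.grp GrModule.module

namespace GrModule

variable {k : Type u} [Field k] {I : Type v} {A : GrAlgebra k I}

theorem isInternal_weight [DecidableEq I] (V : GrModule A) :
    DirectSum.IsInternal (fun i => LinearMap.range (V.act (A.one i))) := by
  refine isInternal_of_proj (fun i => V.act (A.one i)) ?_ ?_ V.iSup_one
  · rintro i _ ⟨v, rfl⟩
    rw [← V.act_mul, A.one_mul_one]
  · rintro i j hij _ ⟨v, rfl⟩
    rw [← V.act_mul, A.one_orth _ _ hij.symm, map_zero, LinearMap.zero_apply]

theorem exists_local_unit (V : GrModule A) (v : V.carrier) :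
    ∃ s : Finset I, v = ∑ i ∈ s, V.act (A.one i) v := by
  classical
  have hs : ∃ s : Finset I, ∀ t, s ⊆ t → v = ∑ i ∈ t, V.act (A.one i) v := by
    have hx : v ∈ ⨆ i, LinearMap.range (V.act (A.one i)) := by rw [V.iSup_one]; trivial
    induction hx using Submodule.iSup_induction' with
    | mem i x hx =>
      obtain ⟨x, rfl⟩ := hx
      refine ⟨{i}, fun t ht => ?_⟩
      rw [Finset.sum_eq_single i, ← V.act_mul, A.one_mul_one]
      · intro j _ hj
        rw [← V.act_mul, A.one_orth _ _ hj, map_zero, LinearMap.zero_apply]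
      · exact fun h => absurd (ht (by simp)) h
    | zero => exact ⟨∅, by simp⟩
    | add x y _ _ hx hy =>
      obtain ⟨s, hs⟩ := hx
      obtain ⟨t, ht⟩ := hy
      refine ⟨s ∪ t, fun r hr => ?_⟩
      simp only [map_add, Finset.sum_add_distrib]
      rw [← hs r (Finset.union_subset_left hr), ← ht r (Finset.union_subset_right hr)]
  obtain ⟨s, hs⟩ := hs
  exact ⟨s, hs s le_rfl⟩

/-- Morphisms of graded modules: degree-preserving `A`-module homomorphisms. -/
@[ext]
structure Hom (V W : GrModule A) where
  toLin : V.carrier →ₗ[k] W.carrier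
  map_act : ∀ a v, toLin (V.act a v) = W.act a (toLin v)
  map_deg : ∀ n, ∀ v ∈ V.deg n, toLin v ∈ W.deg n

/-- The category `A-gmod`. -/
instance : Category.{u} (GrModule A) where
  Hom V W := Hom V W
  id V := ⟨LinearMap.id, fun _ _ => rfl, fun _ _ h => h⟩
  comp f g := ⟨g.toLin ∘ₗ f.toLin,
    fun a v => by simp [f.map_act, g.map_act],
    fun n v h => g.map_deg n _ (f.map_deg n v h)⟩

variable {V W T : GrModule A}

/-- The linear map underlying a morphism. -/
def lin (f : V ⟶ W) : V.carrier →ₗ[k] W.carrier := Hom.toLin f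

theorem lin_act (f : V ⟶ W) (a : A.carrier) (v : V.carrier) :
    lin f (V.act a v) = W.act a (lin f v) := Hom.map_act f a v

theorem lin_deg (f : V ⟶ W) {n : ℤ} {v : V.carrier} (hv : v ∈ V.deg n) : lin f v ∈ W.deg n :=
  Hom.map_deg f n v hv

theorem lin_injective : Function.Injective (lin : (V ⟶ W) → _) := fun _ _ h => Hom.ext h

@[ext]
theorem hom_ext {f g : V ⟶ W} (h : ∀ v, lin f v = lin g v) : f = g :=
  lin_injective (LinearMap.ext h)

@[simp] theorem lin_id : lin (𝟙 V) = LinearMap.id := rfl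

@[simp] theorem lin_comp (f : V ⟶ W) (g : W ⟶ T) : lin (f ≫ g) = lin g ∘ₗ lin f := rfl

theorem lin_homComp (f : V ⟶ W) (n : ℤ) (v : V.carrier) :
    homComp W.internal n (lin f v) = lin f (homComp V.internal n v) := by
  have := map_homComp V.internal W.internal (lin f) 0
    (fun m x hx => by rw [add_zero]; exact lin_deg f hx) n v
  simpa using this

instance : Zero (V ⟶ W) := ⟨(⟨0, by simp, by simp⟩ : Hom V W)⟩
instance : Add (V ⟶ W) := ⟨fun f g => (⟨lin f + lin g, by simp [lin_act],
  fun n v h => add_mem (lin_deg f h) (lin_deg g h)⟩ : Hom V W)⟩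
instance : Neg (V ⟶ W) := ⟨fun f => (⟨-lin f, by simp [lin_act],
  fun n v h => neg_mem (lin_deg f h)⟩ : Hom V W)⟩
instance : Sub (V ⟶ W) := ⟨fun f g => (⟨lin f - lin g, by simp [lin_act],
  fun n v h => sub_mem (lin_deg f h) (lin_deg g h)⟩ : Hom V W)⟩
instance : SMul ℕ (V ⟶ W) := ⟨fun c f => (⟨c • lin f, by simp [lin_act],
  fun n v h => nsmul_mem (lin_deg f h) c⟩ : Hom V W)⟩
instance : SMul ℤ (V ⟶ W) := ⟨fun c f => (⟨c • lin f, by simp [lin_act],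
  fun n v h => zsmul_mem (lin_deg f h) c⟩ : Hom V W)⟩

instance : AddCommGroup (V ⟶ W) :=
  lin_injective.addCommGroup lin rfl (fun _ _ => rfl) (fun _ => rfl) (fun _ _ => rfl)
    (fun _ _ => rfl) (fun _ _ => rfl)

@[simp] theorem lin_zero : lin (0 : V ⟶ W) = 0 := rfl
@[simp] theorem lin_add (f g : V ⟶ W) : lin (f + g) = lin f + lin g := rfl

instance : Preadditive (GrModule A) where
  add_comp _ _ _ f f' g := by ext v; simp
  comp_add _ _ _ f g g' := by ext v; simp

/-! #### Submodules, quotients and products -/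

/-- A graded submodule, as a graded module. -/
def sub (V : GrModule A) (K : Submodule k V.carrier) (h : ∀ a, ∀ v ∈ K, V.act a v ∈ K)
    (hK : ∀ n, ∀ v ∈ K, homComp V.internal n v ∈ K) : GrModule A where
  carrier := K
  act :=
    { toFun := fun a => (V.act a).restrict (h a)
      map_add' := fun a b => by ext; simp
      map_smul' := fun c a => by ext; simp }
  act_mul a b v := Subtype.ext (V.act_mul a b v)
  deg n := (V.deg n).comap K.subtype
  internal := isInternal_sub V.internal K hK
  act_mem ha hv := V.act_mem ha hv
  iSup_one := by
    rw [eq_top_iff]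
    rintro x -
    obtain ⟨s, hs⟩ := V.exists_local_unit x.1
    have : x = ∑ i ∈ s, (V.act (A.one i)).restrict (h (A.one i)) x := by
      apply Subtype.ext
      simpa using hs
    rw [this]
    exact Submodule.sum_mem _ fun i _ => Submodule.mem_iSup_of_mem i ⟨x, rfl⟩

/-- The quotient by a graded submodule. -/
def quot (V : GrModule A) (K : Submodule k V.carrier) (h : ∀ a, ∀ v ∈ K, V.act a v ∈ K)
    (hK : ∀ n, ∀ v ∈ K, homComp V.internal n v ∈ K) : GrModule A where
  carrier := V.carrier ⧸ K
  act :=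
    { toFun := fun a => K.mapQ K (V.act a) (h a)
      map_add' := fun a b => by
        apply Submodule.linearMap_qext
        ext x
        simp
      map_smul' := fun c a => by
        apply Submodule.linearMap_qext
        ext x
        simp }
  act_mul a b v := by
    obtain ⟨v, rfl⟩ := K.mkQ_surjective v
    simp [V.act_mul]
  deg n := (V.deg n).map K.mkQ
  internal := isInternal_quot V.internal K hK
  act_mem := by
    rintro m n a _ ha ⟨v, hv, rfl⟩
    exact ⟨_, V.act_mem ha hv, rfl⟩
  iSup_one := by
    rw [eq_top_iff, ← Submodule.range_mkQ K, ← Submodule.map_top, ← V.iSup_one,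
      Submodule.map_iSup]
    refine iSup_mono fun i => ?_
    rintro _ ⟨_, ⟨v, rfl⟩, rfl⟩
    exact ⟨K.mkQ v, rfl⟩

/-- The product of two graded modules. -/
def prod (V W : GrModule A) : GrModule A where
  carrier := V.carrier × W.carrier
  act :=
    { toFun := fun a => (V.act a).prodMap (W.act a)
      map_add' := fun a b => by ext <;> simp
      map_smul' := fun c a => by ext <;> simp }
  act_mul a b v := by simp [V.act_mul, W.act_mul]
  deg n := (V.deg n).prod (W.deg n)
  internal := by
    refine isInternal_of_proj
      (fun n => (homComp V.internal n).prodMap (homComp W.internal n)) ?_ ?_ ?_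
    · rintro n x ⟨h1, h2⟩
      exact Prod.ext (homComp_same V.internal h1) (homComp_same W.internal h2)
    · rintro m n hmn x ⟨h1, h2⟩
      exact Prod.ext (homComp_ne V.internal hmn h1) (homComp_ne W.internal hmn h2)
    · rw [eq_top_iff]
      rintro ⟨x, y⟩ -
      have h1 : (⊤ : Submodule k V.carrier).map (LinearMap.inl k V.carrier W.carrier) ≤
          ⨆ n, (V.deg n).prod (W.deg n) := by
        rw [← iSup_deg V.internal, Submodule.map_iSup]
        refine iSup_mono fun n => ?_
        rintro _ ⟨v, hv, rfl⟩
        exact ⟨hv, zero_mem _⟩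
      have h2 : (⊤ : Submodule k W.carrier).map (LinearMap.inr k V.carrier W.carrier) ≤
          ⨆ n, (V.deg n).prod (W.deg n) := by
        rw [← iSup_deg W.internal, Submodule.map_iSup]
        refine iSup_mono fun n => ?_
        rintro _ ⟨v, hv, rfl⟩
        exact ⟨zero_mem _, hv⟩
      have : (x, y) = LinearMap.inl k V.carrier W.carrier x +
          LinearMap.inr k V.carrier W.carrier y := by simp
      rw [this]
      exact add_mem (h1 ⟨x, trivial, rfl⟩) (h2 ⟨y, trivial, rfl⟩)
  act_mem ha hv := ⟨V.act_mem ha hv.1, W.act_mem ha hv.2⟩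
  iSup_one := by
    rw [eq_top_iff]
    rintro ⟨x, y⟩ -
    obtain ⟨s, hs⟩ := V.exists_local_unit x
    obtain ⟨t, ht⟩ := W.exists_local_unit y
    have : (x, y) = ∑ i ∈ s, (V.act (A.one i)).prodMap (W.act (A.one i)) (x, 0) +
        ∑ i ∈ t, (V.act (A.one i)).prodMap (W.act (A.one i)) (0, y) := by
      ext
      · simpa [Prod.fst_sum] using hs
      · simpa [Prod.snd_sum] using ht
    rw [this]
    refine add_mem ?_ ?_ <;>
      exact Submodule.sum_mem _ fun i _ => Submodule.mem_iSup_of_mem i ⟨_, rfl⟩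

/-- The zero graded module. -/
def zeroObj (A : GrAlgebra k I) : GrModule A where
  carrier := PUnit
  act := 0
  act_mul _ _ _ := rfl
  deg _ := ⊤
  internal := isInternal_of_proj (fun _ => 0) (fun _ _ _ => rfl) (fun _ _ _ _ _ => rfl) (by simp)
  act_mem _ _ := trivial
  iSup_one := Subsingleton.elim _ _

/-! #### The category of graded modules is abelian -/

instance : HasTerminal (GrModule A) :=
  IsTerminal.hasTerminal (X := zeroObj A)
    (IsTerminal.ofUniqueHom (fun _ => 0) (fun _ f => by ext v; exact Subsingleton.elim (α := PUnit) _ _))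

instance : HasBinaryProducts (GrModule A) := by
  have : ∀ V W : GrModule A, HasLimit (pair V W) := fun V W => by
    let p1 : V.prod W ⟶ V := 
      (⟨LinearMap.fst k _ _, fun _ _ => rfl, fun _ _ h => h.1⟩ : Hom (V.prod W) V)
    let p2 : V.prod W ⟶ W := 
      (⟨LinearMap.snd k _ _, fun _ _ => rfl, fun _ _ h => h.2⟩ : Hom (V.prod W) W)
    refine ⟨⟨⟨BinaryFan.mk p1 p2, BinaryFan.isLimitMk
      (fun s => (⟨(lin s.fst).prod (lin s.snd),
        fun a v => Prod.ext (lin_act s.fst a v) (lin_act s.snd a v),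
        fun n v h => ⟨lin_deg s.fst h, lin_deg s.snd h⟩⟩ : Hom _ (V.prod W)))
      (fun s => ?_) (fun s => ?_) (fun s m h1 h2 => ?_)⟩⟩⟩
    · rfl
    · rfl
    · ext v
      exact Prod.ext (LinearMap.congr_fun (congrArg lin h1) v)
        (LinearMap.congr_fun (congrArg lin h2) v)
  exact hasBinaryProducts_of_hasLimit_pair _

instance : HasFiniteProducts (GrModule A) := hasFiniteProducts_of_has_binary_and_terminal

/-- The kernel of a morphism. -/
def ker (f : V ⟶ W) : GrModule A :=
  V.sub (LinearMap.ker (lin f))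
    (fun a v hv => by rw [LinearMap.mem_ker] at *; rw [lin_act, hv, map_zero])
    (fun n v hv => by rw [LinearMap.mem_ker] at *; rw [← lin_homComp, hv, map_zero])

/-- The inclusion of the kernel. -/
def kerι (f : V ⟶ W) : ker f ⟶ V :=
  (⟨(LinearMap.ker (lin f)).subtype, fun _ _ => rfl, fun _ _ h => h⟩ : Hom (ker f) V)

theorem kerι_comp (f : V ⟶ W) : kerι f ≫ f = 0 := by
  ext v
  exact v.2

/-- The cokernel of a morphism. -/
def coker (f : V ⟶ W) : GrModule A :=
  W.quot (LinearMap.range (lin f))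
    (by rintro a _ ⟨v, rfl⟩; exact ⟨V.act a v, lin_act f a v⟩)
    (by rintro n _ ⟨v, rfl⟩; exact ⟨homComp V.internal n v, (lin_homComp f n v).symm⟩)

/-- The projection to the cokernel. -/
def cokerπ (f : V ⟶ W) : W ⟶ coker f :=
  (⟨(LinearMap.range (lin f)).mkQ, fun _ _ => rfl, fun _ _ h => ⟨_, h, rfl⟩⟩ : Hom W (coker f))

theorem comp_cokerπ (f : V ⟶ W) : f ≫ cokerπ f = 0 := by
  ext v
  exact (Submodule.Quotient.mk_eq_zero _).2 ⟨v, rfl⟩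

instance : HasKernels (GrModule A) where
  has_limit {V W} f := by
    refine ⟨⟨⟨KernelFork.ofι (kerι f) (kerι_comp f), KernelFork.IsLimit.ofι _ _
      (fun {T} g hg => (⟨(lin g).codRestrict _ (fun t => LinearMap.congr_fun (congrArg lin hg) t),
        fun a v => Subtype.ext (lin_act g a v), fun n v h => lin_deg g h⟩ : Hom T (ker f)))
      (fun g hg => rfl) (fun g hg m hm => ?_)⟩⟩⟩
    ext v
    exact Subtype.ext (LinearMap.congr_fun (congrArg lin hm) v)

instance : HasCokernels (GrModule A) where
  has_colimit {V W} f := by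
    refine ⟨⟨⟨CokernelCofork.ofπ (cokerπ f) (comp_cokerπ f), CokernelCofork.IsColimit.ofπ _ _
      (fun {T} g hg => (⟨(LinearMap.range (lin f)).liftQ (lin g) (by
          rintro _ ⟨v, rfl⟩
          exact LinearMap.congr_fun (congrArg lin hg) v),
        fun a v => ?_, ?_⟩ : Hom (coker f) T))
      (fun g hg => rfl) (fun g hg m hm => ?_)⟩⟩⟩
    · obtain ⟨v, rfl⟩ := (LinearMap.range (lin f)).mkQ_surjective v
      exact lin_act g a v
    · rintro n _ ⟨v, hv, rfl⟩
      exact lin_deg g hv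
    · ext v
      obtain ⟨v, rfl⟩ := (LinearMap.range (lin f)).mkQ_surjective v
      exact LinearMap.congr_fun (congrArg lin hm) v

theorem injective_of_mono (f : V ⟶ W) [Mono f] : Function.Injective (lin f) := by
  have h : kerι f = 0 := by
    rw [← cancel_mono f, kerι_comp, zero_comp]
  rw [← LinearMap.ker_eq_bot, eq_bot_iff]
  intro v hv
  exact LinearMap.congr_fun (congrArg lin h) ⟨v, hv⟩

theorem surjective_of_epi (f : V ⟶ W) [Epi f] : Function.Surjective (lin f) := by
  have h : cokerπ f = 0 := by
    rw [← cancel_epi f, comp_cokerπ, comp_zero]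
  rw [← LinearMap.range_eq_top, eq_top_iff]
  intro v _
  exact (Submodule.Quotient.mk_eq_zero _).1 (LinearMap.congr_fun (congrArg lin h) v)

theorem mem_deg_of_injective {f : V ⟶ W} (hf : Function.Injective (lin f)) {n : ℤ}
    {v : V.carrier} (hv : lin f v ∈ W.deg n) : v ∈ V.deg n := by
  have : homComp V.internal n v = v := hf (by
    rw [← lin_homComp, homComp_same W.internal hv])
  rw [← this]
  exact homComp_mem _ _ _

theorem exists_deg_of_surjective {f : V ⟶ W} (hf : Function.Surjective (lin f)) {n : ℤ}
    {w : W.carrier} (hw : w ∈ W.deg n) : ∃ v ∈ V.deg n, lin f v = w := by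
  obtain ⟨v, rfl⟩ := hf w
  exact ⟨homComp V.internal n v, homComp_mem _ _ _, by
    rw [← lin_homComp, homComp_same W.internal hw]⟩

instance : Abelian (GrModule A) where
  normalMonoOfMono {V W} f hf := by
    have hinj := injective_of_mono f
    have key : ∀ {T : GrModule A} (g : T ⟶ W), g ≫ cokerπ f = 0 →
        ∀ t, lin g t ∈ LinearMap.range (lin f) := fun g hg t =>
      (Submodule.Quotient.mk_eq_zero _).1 (LinearMap.congr_fun (congrArg lin hg) t)
    have spec : ∀ {T : GrModule A} (g : T ⟶ W) (hg : g ≫ cokerπ f = 0) (t : T.carrier),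
        lin f ((LinearEquiv.ofInjective (lin f) hinj).symm ⟨lin g t, key g hg t⟩) = lin g t :=
      fun g hg t => congrArg Subtype.val
        ((LinearEquiv.ofInjective (lin f) hinj).apply_symm_apply ⟨lin g t, key g hg t⟩)
    refine ⟨⟨coker f, cokerπ f, comp_cokerπ f, KernelFork.IsLimit.ofι _ _
      (fun {T} g hg => (⟨(LinearEquiv.ofInjective (lin f) hinj).symm.toLinearMap ∘ₗ
          (lin g).codRestrict _ (key g hg), fun a t => ?_, fun n t ht => ?_⟩ : Hom T V))
      (fun g hg => ?_) (fun g hg m hm => ?_)⟩⟩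
    · apply hinj
      exact (spec g hg _).trans ((lin_act g a t).trans
        ((congrArg (W.act a) (spec g hg t)).symm.trans (lin_act f a _).symm))
    · exact mem_deg_of_injective hinj (by
        have := lin_deg g ht
        rw [← spec g hg t] at this
        exact this)
    · ext t
      exact spec g hg t
    · rw [← cancel_mono f, hm]
      ext t
      exact (spec g hg t).symm
  normalEpiOfEpi {V W} f hf := by
    have hsurj := surjective_of_epi f
    have key : ∀ {T : GrModule A} (g : V ⟶ T), kerι f ≫ g = 0 →
        LinearMap.ker (lin f) ≤ LinearMap.ker (lin g) := fun g hg v hv =>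
      LinearMap.congr_fun (congrArg lin hg) ⟨v, hv⟩
    have spec : ∀ {T : GrModule A} (g : V ⟶ T) (hg : kerι f ≫ g = 0) (v : V.carrier),
        (LinearMap.ker (lin f)).liftQ (lin g) (key g hg)
          (((lin f).quotKerEquivOfSurjective hsurj).symm (lin f v)) = lin g v := by
      intro T g hg v
      have : ((lin f).quotKerEquivOfSurjective hsurj).symm (lin f v) =
          (LinearMap.ker (lin f)).mkQ v := by
        rw [LinearEquiv.symm_apply_eq]
        rfl
      rw [this]
      rfl
    refine ⟨⟨ker f, kerι f, kerι_comp f, CokernelCofork.IsColimit.ofπ _ _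
      (fun {T} g hg => (⟨(LinearMap.ker (lin f)).liftQ (lin g) (key g hg) ∘ₗ
          ((lin f).quotKerEquivOfSurjective hsurj).symm.toLinearMap,
          fun a w => ?_, fun n w hw => ?_⟩ : Hom W T))
      (fun g hg => ?_) (fun g hg m hm => ?_)⟩⟩
    · obtain ⟨v, rfl⟩ := hsurj w
      rw [← lin_act f]
      exact (spec g hg _).trans ((lin_act g a v).trans
        (congrArg (T.act a) (spec g hg v)).symm)
    · obtain ⟨v, hv, rfl⟩ := exists_deg_of_surjective hsurj hw
      have := lin_deg g hv
      rw [← spec g hg v] at this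
      exact this
    · ext v
      exact spec g hg v
    · rw [← cancel_epi f, hm]
      ext v
      exact (spec g hg v).symm

instance : HasExt.{u + 1} (GrModule A) := HasExt.standard _

/-! #### Degree shift, finiteness conditions, change of rings -/

/-- The degree shift `q^d V`, with `(q^d V)_n = V_{n+d}`. -/
def shift (V : GrModule A) (d : ℤ) : GrModule A where
  carrier := V.carrier
  act := V.act
  act_mul := V.act_mul
  deg n := V.deg (n + d)
  internal := by
    refine isInternal_of_proj (fun n => homComp V.internal (n + d))
      (fun n x hx => homComp_same V.internal hx)
      (fun m n hmn x hx => homComp_ne V.internal (by omega) hx) ?_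
    rw [← iSup_deg V.internal]
    exact (Equiv.addRight d).iSup_comp (g := fun n => V.deg n)
  act_mem {m n a v} ha hv := by
    have := V.act_mem ha hv
    rwa [← add_assoc] at this
  iSup_one := V.iSup_one

/-- `V` is locally finite-dimensional: each `1_i V_d` is finite-dimensional. -/
def IsLocallyFiniteDimensional (V : GrModule A) : Prop :=
  ∀ i d, FiniteDimensional k ↥(LinearMap.range (V.act (A.one i)) ⊓ V.deg d)

/-- `V` is bounded below: `1_i V_d = 0` for `d < N_i`. -/
def IsBoundedBelow (V : GrModule A) : Prop :=
  ∀ i, ∃ N : ℤ, ∀ d < N, LinearMap.range (V.act (A.one i)) ⊓ V.deg d = ⊥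

/-- `V` is bounded above: `1_i V_d = 0` for `d > N_i`. -/
def IsBoundedAbove (V : GrModule A) : Prop :=
  ∀ i, ∃ N : ℤ, ∀ d > N, LinearMap.range (V.act (A.one i)) ⊓ V.deg d = ⊥

/-- Modules over the quotient of `A` by an ideal, viewed as `A`-modules. -/
def inflate {E : Set A.carrier} {hE : ∀ x ∈ E, x ∈ A.deg 0} (V : GrModule (A.quot E hE)) :
    GrModule A where
  carrier := V.carrier
  act := V.act ∘ₗ A.quotMk E hE
  act_mul a b v := by
    simp only [LinearMap.comp_apply, A.quotMk_mul, V.act_mul]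
  deg := V.deg
  internal := V.internal
  act_mem ha hv := V.act_mem (A.quotMk_mem E hE ha) hv
  iSup_one := V.iSup_one

/-- An `A`-module, viewed as a module over `A` with another system of distinguished idempotents:
the notion of a locally unital module does not depend on this system. -/
def toReindex {J : Type w} (S : A.IdemSystem J) (V : GrModule A) : GrModule (A.reindex S) where
  carrier := V.carrier
  act := V.act
  act_mul := V.act_mul
  deg := V.deg
  internal := V.internal
  act_mem := V.act_mem
  iSup_one := by
    rw [eq_top_iff]
    rintro v -
    obtain ⟨s, hs⟩ := V.exists_local_unit v
    rw [hs]
    refine Submodule.sum_mem _ fun j _ => ?_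
    obtain ⟨t, ht⟩ := (A.reindex S).exists_local_unit (A.one j)
    have h1 : (∑ i ∈ t, S.one i) * A.one j = A.one j := (ht t le_rfl).1
    have h2 : V.act (A.one j) v = ∑ i ∈ t, V.act (S.one i) (V.act (A.one j) v) := by
      conv_lhs => rw [← h1]
      refine (V.act_mul (∑ i ∈ t, S.one i) (A.one j) v).trans ?_
      have h3 : V.act (∑ i ∈ t, S.one i) = ∑ i ∈ t, V.act (S.one i) := map_sum V.act _ _
      rw [h3, LinearMap.sum_apply]
    rw [h2]
    exact Submodule.sum_mem _ fun i _ => Submodule.mem_iSup_of_mem i ⟨_, rfl⟩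

end GrModule

/-! ### Standardization and costandardization -/

section Tensor

open TensorProduct

variable {k : Type u} [Field k] {M N : Type u} [AddCommGroup M] [Module k M] [AddCommGroup N]
  [Module k N] {U : ℤ → Submodule k M} {U' : ℤ → Submodule k N}

/-- The degree `n` part of a tensor product of graded vector spaces. -/
def tensorDeg (U : ℤ → Submodule k M) (U' : ℤ → Submodule k N) (n : ℤ) :
    Submodule k (M ⊗[k] N) :=
  Submodule.span k {t | ∃ p q : ℤ, p + q = n ∧ ∃ x ∈ U p, ∃ y ∈ U' q, t = x ⊗ₜ y}

theorem decompose_symm_of_mem (h : DirectSum.IsInternal U) {n : ℤ} {x : M} (hx : x ∈ U n) :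
    (LinearEquiv.ofBijective (DirectSum.coeLinearMap U) h).symm x =
      DirectSum.lof k ℤ (fun i => U i) n ⟨x, hx⟩ := by
  rw [LinearEquiv.symm_apply_eq]
  exact (DirectSum.coeLinearMap_lof U n ⟨x, hx⟩).symm

theorem tensor_induction (h : DirectSum.IsInternal U) (h' : DirectSum.IsInternal U')
    {P : M → N → Prop} (h0l : ∀ y, P 0 y) (h0r : ∀ x, P x 0)
    (hl : ∀ x x' y, P x y → P x' y → P (x + x') y)
    (hr : ∀ x y y', P x y → P x y' → P x (y + y'))
    (H : ∀ p q, ∀ x ∈ U p, ∀ y ∈ U' q, P x y) (x : M) (y : N) : P x y := by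
  have hx : x ∈ ⨆ n, U n := by rw [iSup_deg h]; trivial
  induction hx using Submodule.iSup_induction' with
  | mem p x hx =>
    have hy : y ∈ ⨆ n, U' n := by rw [iSup_deg h']; trivial
    induction hy using Submodule.iSup_induction' with
    | mem q y hy => exact H p q x hx y hy
    | zero => exact h0r x
    | add y y' _ _ hy hy' => exact hr x y y' hy hy'
  | zero => exact h0l y
  | add x x' _ _ hx hx' => exact hl x x' y hx hx'

theorem isInternal_tensor (h : DirectSum.IsInternal U) (h' : DirectSum.IsInternal U') :
    DirectSum.IsInternal (tensorDeg U U') := by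
  let L : ℤ → M →ₗ[k] N →ₗ[k] M ⊗[k] N := fun n =>
    DirectSum.toModule k ℤ _ (fun p =>
      ((TensorProduct.mk k M N) ∘ₗ (U p).subtype).compl₂ (homComp h' (n - p))) ∘ₗ
      (LinearEquiv.ofBijective (DirectSum.coeLinearMap U) h).symm.toLinearMap
  have hL : ∀ n p x y, x ∈ U p → L n x y = x ⊗ₜ homComp h' (n - p) y := by
    intro n p x y hx
    simp only [L, LinearMap.comp_apply, LinearEquiv.coe_coe, decompose_symm_of_mem h hx,
      DirectSum.toModule_lof]
    rfl
  refine isInternal_of_proj (fun n => TensorProduct.lift (L n)) ?_ ?_ ?_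
  · intro n t ht
    induction ht using Submodule.span_induction with
    | mem t ht =>
      obtain ⟨p, q, rfl, x, hx, y, hy, rfl⟩ := ht
      rw [TensorProduct.lift.tmul, hL _ p x y hx, add_sub_cancel_left, homComp_same h' hy]
    | zero => exact map_zero _
    | add s t _ _ hs ht => rw [map_add, hs, ht]
    | smul c t _ ht => rw [map_smul, ht]
  · intro m n hmn t ht
    induction ht using Submodule.span_induction with
    | mem t ht =>
      obtain ⟨p, q, rfl, x, hx, y, hy, rfl⟩ := ht
      rw [TensorProduct.lift.tmul, hL _ p x y hx, homComp_ne h' (m := q) (by omega) hy,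
        TensorProduct.tmul_zero]
    | zero => exact map_zero _
    | add s t _ _ hs ht => rw [map_add, hs, ht, add_zero]
    | smul c t _ ht => rw [map_smul, ht, smul_zero]
  · rw [eq_top_iff, ← TensorProduct.span_tmul_eq_top, Submodule.span_le]
    rintro _ ⟨x, y, rfl⟩
    refine tensor_induction h h' (P := fun x y => x ⊗ₜ[k] y ∈ ⨆ n, tensorDeg U U' n)
      (fun y => by simp) (fun x => by simp)
      (fun x x' y h1 h2 => by rw [TensorProduct.add_tmul]; exact add_mem h1 h2)
      (fun x y y' h1 h2 => by rw [TensorProduct.tmul_add]; exact add_mem h1 h2) ?_ x y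
    intro p q x hx y hy
    exact Submodule.mem_iSup_of_mem (p + q)
      (Submodule.subset_span ⟨p, q, rfl, x, hx, y, hy, rfl⟩)

end Tensor

namespace GrAlgebra.Idem

open TensorProduct

variable {k : Type u} [Field k] {I : Type v} {A : GrAlgebra k I} (e : A.Idem)

/-- Left multiplication `A × Ae → Ae`. -/
def lmul : A.carrier →ₗ[k] e.leftIdeal →ₗ[k] e.leftIdeal where
  toFun a := (LinearMap.mulLeft k a).restrict (fun x hx => by
    change a * x * e.val = a * x
    rw [mul_assoc, show x * e.val = x from hx])
  map_add' a b := by ext x; exact add_mul a b x.1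
  map_smul' c a := by ext x; exact smul_mul_assoc c a x.1

/-- Right multiplication `A × eA → eA`. -/
def rmul : A.carrier →ₗ[k] e.rightIdeal →ₗ[k] e.rightIdeal where
  toFun a := (LinearMap.mulRight k a).restrict (fun x hx => by
    change e.val * (x * a) = x * a
    rw [← mul_assoc, show e.val * x = x from hx])
  map_add' a b := by ext x; exact mul_add x.1 a b
  map_smul' c a := by ext x; exact mul_smul_comm c x.1 a

/-- Right multiplication `Ae × eAe → Ae`. -/
def mulCorner (x : e.leftIdeal) (h : (A.corner e).carrier) : e.leftIdeal :=
  ⟨x.1 * h.1, by change _ * _ * _ = _; rw [mul_assoc, h.2.2]⟩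

/-- Left multiplication `eAe × eA → eA`. -/
def cornerMul (h : (A.corner e).carrier) (x : e.rightIdeal) : e.rightIdeal :=
  ⟨h.1 * x.1, by change _ * (_ * _) = _; rw [← mul_assoc, h.2.1]⟩

theorem isInternal_tensorObj (V : GrModule (A.corner e)) : DirectSum.IsInternal
    (tensorDeg (fun n => (A.deg n).comap e.leftIdeal.subtype) V.deg) :=
  isInternal_tensor (isInternal_sub A.internal e.leftIdeal e.homComp_mem_leftIdeal) V.internal

/-- The graded `A`-module `Ae ⊗_k V`. -/
def tensorObj (V : GrModule (A.corner e)) : GrModule A where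
  carrier := e.leftIdeal ⊗[k] V.carrier
  act := LinearMap.rTensorHom V.carrier ∘ₗ e.lmul
  act_mul a b t := by
    induction t using TensorProduct.induction_on with
    | zero => simp
    | tmul x v =>
      change e.lmul (a * b) x ⊗ₜ v = e.lmul a (e.lmul b x) ⊗ₜ v
      congr 1
      exact Subtype.ext (mul_assoc a b x.1)
    | add s t hs ht => rw [map_add, map_add, map_add, hs, ht]
  deg := tensorDeg (fun n => (A.deg n).comap e.leftIdeal.subtype) V.deg
  internal := e.isInternal_tensorObj V
  act_mem := by
    intro m n a t ha ht
    induction ht using Submodule.span_induction with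
    | mem t ht =>
      obtain ⟨p, q, rfl, x, hx, y, hy, rfl⟩ := ht
      exact Submodule.subset_span
        ⟨m + p, q, by omega, e.lmul a x, A.mul_mem ha hx, y, hy, rfl⟩
    | zero => rw [map_zero]; exact zero_mem _
    | add s t _ _ hs ht => rw [map_add]; exact add_mem hs ht
    | smul c t _ ht => rw [map_smul]; exact Submodule.smul_mem _ _ ht
  iSup_one := by
    rw [eq_top_iff, ← TensorProduct.span_tmul_eq_top, Submodule.span_le]
    rintro _ ⟨x, y, rfl⟩
    obtain ⟨s, hs⟩ := A.exists_local_unit x.1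
    have : x = ∑ i ∈ s, e.lmul (A.one i) x := by
      have h1 : e.lmul (∑ i ∈ s, A.one i) x = x := Subtype.ext (hs s le_rfl).1
      conv_lhs => rw [← h1]
      rw [map_sum, LinearMap.sum_apply]
    rw [SetLike.mem_coe, this, TensorProduct.sum_tmul]
    exact Submodule.sum_mem _ fun i _ => Submodule.mem_iSup_of_mem i ⟨x ⊗ₜ y, rfl⟩

/-- The relations `xh ⊗ v = x ⊗ hv` for `x ∈ Ae`, `h ∈ eAe` and `v ∈ V`. -/
def tensorRel (V : GrModule (A.corner e)) : Submodule k (e.leftIdeal ⊗[k] V.carrier) :=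
  Submodule.span k {t | ∃ x h v, t = e.mulCorner x h ⊗ₜ[k] v - x ⊗ₜ[k] V.act h v}

theorem act_mem_tensorRel (V : GrModule (A.corner e)) (a : A.carrier)
    (t : e.leftIdeal ⊗[k] V.carrier) (ht : t ∈ e.tensorRel V) :
    (e.lmul a).rTensor V.carrier t ∈ e.tensorRel V := by
  induction ht using Submodule.span_induction with
  | mem t ht =>
    obtain ⟨x, h, v, rfl⟩ := ht
    refine Submodule.subset_span ⟨e.lmul a x, h, v, ?_⟩
    rw [map_sub]
    change e.lmul a (e.mulCorner x h) ⊗ₜ v - e.lmul a x ⊗ₜ[k] V.act h v = _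
    congr 2
    exact Subtype.ext (mul_assoc a x.1 h.1).symm
  | zero => rw [map_zero]; exact zero_mem _
  | add s t _ _ hs ht => rw [map_add]; exact add_mem hs ht
  | smul c t _ ht => rw [map_smul]; exact Submodule.smul_mem _ _ ht

theorem homComp_mem_tensorRel (V : GrModule (A.corner e)) (n : ℤ)
    (t : e.leftIdeal ⊗[k] V.carrier) (ht : t ∈ e.tensorRel V) :
    homComp (e.isInternal_tensorObj V) n t ∈ e.tensorRel V := by
  have hAe := isInternal_sub A.internal e.leftIdeal e.homComp_mem_leftIdeal
  induction ht using Submodule.span_induction with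
  | mem t ht =>
    obtain ⟨x, h, v, rfl⟩ := ht
    have hh : h ∈ ⨆ r, (A.corner e).deg r := by rw [iSup_deg (A.corner e).internal]; trivial
    induction hh using Submodule.iSup_induction' with
    | mem r h hh =>
      refine tensor_induction hAe V.internal
        (P := fun x v => homComp (e.isInternal_tensorObj V) n
          (e.mulCorner x h ⊗ₜ[k] v - x ⊗ₜ[k] V.act h v) ∈ e.tensorRel V) ?_ ?_ ?_ ?_ ?_ x v
      · intro v
        have : e.mulCorner 0 h = 0 := Subtype.ext (zero_mul _)
        rw [this, TensorProduct.zero_tmul, TensorProduct.zero_tmul, sub_zero]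
        rw [map_zero]
        exact zero_mem _
      · intro x
        rw [map_zero, TensorProduct.tmul_zero, TensorProduct.tmul_zero, sub_zero]
        rw [map_zero]
        exact zero_mem _
      · intro x x' v h1 h2
        have : e.mulCorner (x + x') h = e.mulCorner x h + e.mulCorner x' h :=
          Subtype.ext (add_mul _ _ _)
        rw [this, TensorProduct.add_tmul, TensorProduct.add_tmul, add_sub_add_comm]
        rw [map_add]
        exact add_mem h1 h2
      · intro x v v' h1 h2
        rw [map_add, TensorProduct.tmul_add, TensorProduct.tmul_add, add_sub_add_comm]
        rw [map_add]
        exact add_mem h1 h2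
      · intro p q x hx v hv
        have hmem : (e.mulCorner x h ⊗ₜ[k] v - x ⊗ₜ[k] V.act h v :
            e.leftIdeal ⊗[k] V.carrier) ∈ tensorDeg (fun n => (A.deg n).comap e.leftIdeal.subtype) V.deg (p + r + q) := by
          refine sub_mem (Submodule.subset_span ⟨p + r, q, rfl, _, A.mul_mem hx hh, v, hv, rfl⟩)
            (Submodule.subset_span ⟨p, r + q, by omega, x, hx, _, V.act_mem hh hv, rfl⟩)
        by_cases hn : p + r + q = n
        · subst hn
          rw [homComp_same (e.isInternal_tensorObj V) hmem]
          exact Submodule.subset_span ⟨x, h, v, rfl⟩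
        · rw [homComp_ne (e.isInternal_tensorObj V) hn hmem]
          exact zero_mem _
    | zero =>
      have : e.mulCorner x 0 = 0 := Subtype.ext (mul_zero _)
      rw [this, map_zero, TensorProduct.zero_tmul, LinearMap.zero_apply,
        TensorProduct.tmul_zero, sub_zero]
      rw [map_zero]
      exact zero_mem _
    | add h h' _ _ h1 h2 =>
      have : e.mulCorner x (h + h') = e.mulCorner x h + e.mulCorner x h' :=
        Subtype.ext (mul_add _ _ _)
      rw [this, map_add, LinearMap.add_apply, TensorProduct.add_tmul, TensorProduct.tmul_add,
        add_sub_add_comm]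
      rw [map_add]
      exact add_mem h1 h2
  | zero => rw [map_zero]; exact zero_mem _
  | add s t _ _ hs ht => rw [map_add]; exact add_mem hs ht
  | smul c t _ ht => rw [map_smul]; exact Submodule.smul_mem _ _ ht

/-- The functor `j_! = Ae ⊗_{eAe} -` on objects. -/
def jShriek (V : GrModule (A.corner e)) : GrModule A :=
  (e.tensorObj V).quot (e.tensorRel V) (e.act_mem_tensorRel V) (e.homComp_mem_tensorRel V)

/-- `Hom_{eAe}(eA 1_i, V)_d`, viewed inside the space of linear maps `eA → V` by composing with
right multiplication by `1_i`. -/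
def homDeg (V : GrModule (A.corner e)) (i : I) (d : ℤ) :
    Submodule k (e.rightIdeal →ₗ[k] V.carrier) where
  carrier := {f | (∀ h x, f (e.cornerMul h x) = V.act h (f x)) ∧
    (∀ x, f (e.rmul (A.one i) x) = f x) ∧
    ∀ m, ∀ x : e.rightIdeal, x.1 ∈ A.deg m → f x ∈ V.deg (m + d)}
  add_mem' := by
    rintro f g ⟨h1, h2, h3⟩ ⟨h4, h5, h6⟩
    exact ⟨fun h x => by simp [h1, h4], fun x => by simp [h2, h5],
      fun m x hx => add_mem (h3 m x hx) (h6 m x hx)⟩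
  zero_mem' := ⟨by simp, by simp, by simp⟩
  smul_mem' := by
    rintro c f ⟨h1, h2, h3⟩
    exact ⟨fun h x => by simp [h1], fun x => by simp [h2],
      fun m x hx => Submodule.smul_mem _ _ (h3 m x hx)⟩

/-- `⨁_i Hom_{eAe}(eA 1_i, V)` inside the space of linear maps `eA → V`. -/
def homTotal (V : GrModule (A.corner e)) : Submodule k (e.rightIdeal →ₗ[k] V.carrier) :=
  ⨆ d, ⨆ i, e.homDeg V i d

theorem comp_rmul_mem_homDeg (V : GrModule (A.corner e)) (d : ℤ) {p : ℤ} {a : A.carrier}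
    (ha : a ∈ A.deg p) {f : e.rightIdeal →ₗ[k] V.carrier} (hf : f ∈ ⨆ i, e.homDeg V i d) :
    f ∘ₗ e.rmul a ∈ ⨆ i, e.homDeg V i (p + d) := by
  induction hf using Submodule.iSup_induction' with
  | mem i f hf =>
    obtain ⟨s, hs⟩ := A.exists_local_unit a
    have hsum : f ∘ₗ e.rmul a = ∑ j ∈ s, f ∘ₗ e.rmul (A.one j * a) := by
      conv_lhs => rw [← (hs s le_rfl).1, Finset.sum_mul, map_sum]
      ext x
      simp
    rw [hsum]
    refine Submodule.sum_mem _ fun j _ => Submodule.mem_iSup_of_mem j ?_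
    have hja : A.one j * a ∈ A.deg p := by
      have := A.mul_mem (A.one_mem j) ha
      rwa [zero_add] at this
    have hj : ∀ x, e.rmul (A.one j * a) (e.rmul (A.one j) x) = e.rmul (A.one j * a) x := by
      intro x
      apply Subtype.ext
      change x.1 * A.one j * (A.one j * a) = x.1 * (A.one j * a)
      rw [mul_assoc, ← mul_assoc (A.one j), A.one_mul_one]
    obtain ⟨h1, h2, h3⟩ := hf
    refine ⟨fun h x => ?_, fun x => ?_, fun m x hx => ?_⟩
    · simp only [LinearMap.comp_apply]
      rw [← h1]
      congr 1
      exact Subtype.ext (mul_assoc _ _ _)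
    · simp only [LinearMap.comp_apply, hj]
    · have := h3 (m + p) (e.rmul (A.one j * a) x) (A.mul_mem hx hja)
      rwa [add_assoc] at this
  | zero => rw [LinearMap.zero_comp]; exact zero_mem _
  | add f g _ _ hf hg => rw [LinearMap.add_comp]; exact add_mem hf hg

theorem comp_rmul_mem_homTotal (V : GrModule (A.corner e)) (a : A.carrier)
    {f : e.rightIdeal →ₗ[k] V.carrier} (hf : f ∈ e.homTotal V) :
    f ∘ₗ e.rmul a ∈ e.homTotal V := by
  have ha : a ∈ ⨆ n, A.deg n := by rw [iSup_deg A.internal]; trivial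
  induction ha using Submodule.iSup_induction' with
  | mem p a ha =>
    induction hf using Submodule.iSup_induction' with
    | mem d f hf => exact Submodule.mem_iSup_of_mem (p + d) (e.comp_rmul_mem_homDeg V d ha hf)
    | zero => rw [LinearMap.zero_comp]; exact zero_mem _
    | add f g _ _ hf hg => rw [LinearMap.add_comp]; exact add_mem hf hg
  | zero => rw [map_zero, LinearMap.comp_zero]; exact zero_mem _
  | add a b _ _ ha hb => rw [map_add, LinearMap.comp_add]; exact add_mem ha hb

theorem map_deg_of_mem (V : GrModule (A.corner e)) {d : ℤ}
    {f : e.rightIdeal →ₗ[k] V.carrier} (hf : f ∈ ⨆ i, e.homDeg V i d) {m : ℤ}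
    {x : e.rightIdeal} (hx : x.1 ∈ A.deg m) : f x ∈ V.deg (m + d) := by
  induction hf using Submodule.iSup_induction' with
  | mem i f hf => exact hf.2.2 m x hx
  | zero => exact zero_mem _
  | add f g _ _ hf hg => exact add_mem hf hg

/-- The degree `n` component of a linear map between graded vector spaces. -/
def homProj {M N : Type u} [AddCommGroup M] [Module k M] [AddCommGroup N] [Module k N]
    {U : ℤ → Submodule k M} {U' : ℤ → Submodule k N} (h : DirectSum.IsInternal U)
    (h' : DirectSum.IsInternal U') (n : ℤ) : (M →ₗ[k] N) →ₗ[k] (M →ₗ[k] N) where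
  toFun f := DirectSum.toModule k ℤ _ (fun m => homComp h' (m + n) ∘ₗ f ∘ₗ (U m).subtype) ∘ₗ
    (LinearEquiv.ofBijective (DirectSum.coeLinearMap U) h).symm.toLinearMap
  map_add' f g := by
    ext x
    have hx : x ∈ ⨆ n, U n := by rw [iSup_deg h]; trivial
    induction hx using Submodule.iSup_induction' with
    | mem m x hx =>
      simp only [LinearMap.comp_apply, LinearEquiv.coe_coe, decompose_symm_of_mem h hx,
        DirectSum.toModule_lof, LinearMap.add_apply, map_add]
    | zero => simp only [map_zero]
    | add x y _ _ hx hy => rw [map_add, map_add, hx, hy]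
  map_smul' c f := by
    ext x
    have hx : x ∈ ⨆ n, U n := by rw [iSup_deg h]; trivial
    induction hx using Submodule.iSup_induction' with
    | mem m x hx =>
      simp only [LinearMap.comp_apply, LinearEquiv.coe_coe, decompose_symm_of_mem h hx,
        DirectSum.toModule_lof, LinearMap.smul_apply, map_smul, RingHom.id_apply]
    | zero => simp only [map_zero]
    | add x y _ _ hx hy => rw [map_add, map_add, hx, hy]

theorem homProj_apply {M N : Type u} [AddCommGroup M] [Module k M] [AddCommGroup N] [Module k N]
    {U : ℤ → Submodule k M} {U' : ℤ → Submodule k N} (h : DirectSum.IsInternal U)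
    (h' : DirectSum.IsInternal U') (n : ℤ) (f : M →ₗ[k] N) {m : ℤ} {x : M} (hx : x ∈ U m) :
    homProj h h' n f x = homComp h' (m + n) (f x) := by
  change DirectSum.toModule k ℤ _ (fun m => homComp h' (m + n) ∘ₗ f ∘ₗ (U m).subtype)
    ((LinearEquiv.ofBijective (DirectSum.coeLinearMap U) h).symm x) = _
  rw [decompose_symm_of_mem h hx, DirectSum.toModule_lof]
  rfl

theorem ext_deg {M N : Type u} [AddCommGroup M] [Module k M] [AddCommGroup N] [Module k N]
    {U : ℤ → Submodule k M} (h : DirectSum.IsInternal U) {f g : M →ₗ[k] N}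
    (hfg : ∀ m, ∀ x ∈ U m, f x = g x) : f = g := by
  ext x
  have hx : x ∈ ⨆ n, U n := by rw [iSup_deg h]; trivial
  induction hx using Submodule.iSup_induction' with
  | mem m x hx => exact hfg m x hx
  | zero => simp only [map_zero]
  | add x y _ _ hx hy => rw [map_add, map_add, hx, hy]

theorem isInternal_rightIdeal :
    DirectSum.IsInternal (fun n => (A.deg n).comap e.rightIdeal.subtype) :=
  isInternal_sub A.internal e.rightIdeal e.homComp_mem_rightIdeal

theorem homProj_same (V : GrModule (A.corner e)) {d : ℤ}
    {f : e.rightIdeal →ₗ[k] V.carrier} (hf : f ∈ ⨆ i, e.homDeg V i d) :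
    homProj e.isInternal_rightIdeal V.internal d f = f :=
  ext_deg e.isInternal_rightIdeal fun _ _ hx =>
    (homProj_apply e.isInternal_rightIdeal V.internal _ f hx).trans
      (homComp_same V.internal (e.map_deg_of_mem V hf hx))

theorem homProj_ne (V : GrModule (A.corner e)) {d n : ℤ} (hdn : d ≠ n)
    {f : e.rightIdeal →ₗ[k] V.carrier} (hf : f ∈ ⨆ i, e.homDeg V i d) :
    homProj e.isInternal_rightIdeal V.internal n f = 0 :=
  ext_deg e.isInternal_rightIdeal fun m _ hx =>
    (homProj_apply e.isInternal_rightIdeal V.internal _ f hx).trans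
      (homComp_ne V.internal (m := m + d) (by omega) (e.map_deg_of_mem V hf hx))

theorem homProj_mem (V : GrModule (A.corner e)) (n : ℤ) (f : e.rightIdeal →ₗ[k] V.carrier)
    (hf : f ∈ e.homTotal V) :
    homProj e.isInternal_rightIdeal V.internal n f ∈ e.homTotal V := by
  induction hf using Submodule.iSup_induction' with
  | mem d f hf =>
    by_cases hdn : d = n
    · subst hdn
      rw [e.homProj_same V hf]
      exact Submodule.mem_iSup_of_mem d hf
    · rw [e.homProj_ne V hdn hf]
      exact zero_mem _
  | zero => rw [map_zero]; exact zero_mem _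
  | add f g _ _ hf hg => rw [map_add]; exact add_mem hf hg

/-- The functor `j_* = ⨁_i Hom_{eAe}(eA 1_i, -)` on objects; the action is `(af)(x) = f(xa)`. -/
def jStar (V : GrModule (A.corner e)) : GrModule A where
  carrier := e.homTotal V
  act :=
    { toFun := fun a =>
        { toFun := fun f => ⟨f.1 ∘ₗ e.rmul a, e.comp_rmul_mem_homTotal V a f.2⟩
          map_add' := fun f g => rfl
          map_smul' := fun c f => rfl }
      map_add' := fun a b => by
        ext f x
        exact (congrArg f.1 (LinearMap.congr_fun (map_add e.rmul a b) x)).trans (map_add f.1 _ _)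
      map_smul' := fun c a => by
        ext f x
        exact (congrArg f.1 (LinearMap.congr_fun (map_smul e.rmul c a) x)).trans
          (map_smul f.1 _ _) }
  act_mul a b f := by
    ext x
    exact congrArg f.1 (Subtype.ext (mul_assoc x.1 a b).symm)
  deg d := (⨆ i, e.homDeg V i d).comap (e.homTotal V).subtype
  internal := by
    refine isInternal_of_proj (fun n =>
      (homProj e.isInternal_rightIdeal V.internal n).restrict (e.homProj_mem V n)) ?_ ?_ ?_
    · intro n f hf
      exact Subtype.ext (e.homProj_same V hf)
    · intro m n hmn f hf
      exact Subtype.ext (e.homProj_ne V hmn hf)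
    · rw [eq_top_iff]
      rintro ⟨f, hf⟩ -
      induction hf using Submodule.iSup_induction' with
      | mem d f hf => exact Submodule.mem_iSup_of_mem d hf
      | zero => exact zero_mem _
      | add f g hf' hg' hf hg => exact add_mem hf hg
  act_mem ha hf := e.comp_rmul_mem_homDeg V _ ha hf
  iSup_one := by
    rw [eq_top_iff]
    rintro ⟨f, hf⟩ -
    induction hf using Submodule.iSup_induction' with
    | mem d f hf =>
      induction hf using Submodule.iSup_induction' with
      | mem i f hf =>
        refine Submodule.mem_iSup_of_mem i ⟨⟨f, ?_⟩, ?_⟩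
        · exact Submodule.mem_iSup_of_mem d (Submodule.mem_iSup_of_mem i hf)
        · exact Subtype.ext (LinearMap.ext hf.2.1)
      | zero => exact zero_mem _
      | add f g hf' hg' hf hg => exact add_mem hf hg
    | zero => exact zero_mem _
    | add f g hf' hg' hf hg => exact add_mem hf hg

end GrAlgebra.Idem

/-! ### Graded triangular bases -/

/-- A graded triangular basis of a locally unital graded algebra `A` with weight poset `L`. -/
structure TriangularBasis {k : Type u} [Field k] {I : Type v} (A : GrAlgebra k I)
    (L : Type w) [PartialOrder L] where
  /-- The set indexing the special idempotents. -/
  S : Set I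
  lower_finite : ∀ l : L, (Set.Iic l).Finite
  /-- The function `s ↦ ṡ`. -/
  wt : S → L
  fiber_finite : ∀ l : L, (wt ⁻¹' {l}).Finite
  X : I → S → Set A.carrier
  H : S → S → Set A.carrier
  Y : S → I → Set A.carrier
  X_subset : ∀ i s, ∀ x ∈ X i s, x ∈ peirce k A.one i s
  H_subset : ∀ s t, ∀ x ∈ H s t, x ∈ peirce k A.one s t
  Y_subset : ∀ t j, ∀ x ∈ Y t j, x ∈ peirce k A.one t j
  X_homogeneous : ∀ i s, ∀ x ∈ X i s, ∃ d, x ∈ A.deg d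
  H_homogeneous : ∀ s t, ∀ x ∈ H s t, ∃ d, x ∈ A.deg d
  Y_homogeneous : ∀ t j, ∀ x ∈ Y t j, ∃ d, x ∈ A.deg d
  /-- The products `xhy` form a basis: linear independence. -/
  linearIndependent : LinearIndependent k
    (fun p : {p : A.carrier × A.carrier × A.carrier //
        ∃ i s t j, p.1 ∈ X i s ∧ p.2.1 ∈ H s t ∧ p.2.2 ∈ Y t j} =>
      p.1.1 * p.1.2.1 * p.1.2.2)
  /-- The products `xhy` form a basis: spanning. -/
  span_eq_top : Submodule.span k
    {a | ∃ i s t j, ∃ x ∈ X i s, ∃ h ∈ H s t, ∃ y ∈ Y t j, a = x * h * y} = ⊤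
  X_self : ∀ s : S, X s s = {A.one s}
  Y_self : ∀ s : S, Y s s = {A.one s}
  X_lt : ∀ s t : S, s ≠ t → (X s t).Nonempty → wt t < wt s
  H_eq : ∀ s t : S, s ≠ t → (H s t).Nonempty → wt s = wt t
  Y_lt : ∀ s t : S, s ≠ t → (Y s t).Nonempty → wt s < wt t
  finite_of_notMem : ∀ i ∉ S, {s : S | (X i s ∪ Y s i).Nonempty}.Finite

namespace TriangularBasis

variable {k : Type u} [Field k] {I : Type v} {A : GrAlgebra k I} {L : Type w} [PartialOrder L]
  (T : TriangularBasis A L)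

/-- `e_l`, the sum of the special idempotents of weight `l`. -/
def e (l : L) : A.Idem where
  val := ∑ s ∈ (T.fiber_finite l).toFinset, A.one s
  mem := Submodule.sum_mem _ fun s _ => A.one_mem s
  idem := by
    rw [Finset.sum_mul]
    refine Finset.sum_congr rfl fun s hs => ?_
    rw [Finset.mul_sum, Finset.sum_eq_single s
      (fun t _ hts => A.one_orth _ _ fun h => hts (Subtype.ext h).symm)
      (fun h => absurd hs h), A.one_mul_one]

/-- The algebra `A_{≥ l}`: the quotient of `A` by the ideal generated by all `e_m` with `m ≱ l`. -/
def geq (l : L) : GrAlgebra k I :=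
  A.quot {x | ∃ m, ¬ l ≤ m ∧ x = (T.e m).val} (by rintro _ ⟨m, -, rfl⟩; exact (T.e m).mem)

/-- The image of `e_l` in `A_{≥ l}`. -/
def ebar (l : L) : (T.geq l).Idem where
  val := A.quotMk _ _ (T.e l).val
  mem := A.quotMk_mem _ _ (T.e l).mem
  idem := by
    have := A.quotMk_mul {x | ∃ m, ¬ l ≤ m ∧ x = (T.e m).val}
      (by rintro _ ⟨m, -, rfl⟩; exact (T.e m).mem) (T.e l).val (T.e l).val
    rw [(T.e l).idem] at this
    exact this.symm

/-- The unital graded algebra `A_l`. -/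
def cartan (l : L) : GrAlgebra k Unit := GrAlgebra.corner (T.ebar l)

/-- The standardization functor `j^l_!` on objects, with values viewed as `A`-modules. -/
def std (l : L) (V : GrModule (T.cartan l)) : GrModule A :=
  GrModule.inflate ((T.ebar l).jShriek V)

/-- The costandardization functor `j^l_*` on objects, with values viewed as `A`-modules. -/
def costd (l : L) (V : GrModule (T.cartan l)) : GrModule A :=
  GrModule.inflate ((T.ebar l).jStar V)

/-- `Δ`-layers of type `l`. -/
def IsDeltaLayer (l : L) (V : GrModule A) : Prop :=
  ∃ V' : GrModule (T.cartan l), Projective V' ∧ V'.IsLocallyFiniteDimensional ∧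
    V'.IsBoundedBelow ∧ Nonempty (V ≅ T.std l V')

/-- `Δ̄`-layers of type `l`. -/
def IsProperDeltaLayer (l : L) (V : GrModule A) : Prop :=
  ∃ V' : GrModule (T.cartan l), V'.IsLocallyFiniteDimensional ∧
    V'.IsBoundedBelow ∧ Nonempty (V ≅ T.std l V')

/-- `∇`-layers of type `l`. -/
def IsNablaLayer (l : L) (V : GrModule A) : Prop :=
  ∃ V' : GrModule (T.cartan l), Injective V' ∧ V'.IsLocallyFiniteDimensional ∧
    V'.IsBoundedAbove ∧ Nonempty (V ≅ T.costd l V')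

/-- `∇̄`-layers of type `l`. -/
def IsProperNablaLayer (l : L) (V : GrModule A) : Prop :=
  ∃ V' : GrModule (T.cartan l), V'.IsLocallyFiniteDimensional ∧
    V'.IsBoundedAbove ∧ Nonempty (V ≅ T.costd l V')

end TriangularBasis

/-! ### Based affine quasi-hereditary algebras -/

namespace GrAlgebra

variable {k : Type u} [Field k] {I : Type v} (R : GrAlgebra k I)

/-- Graded left ideals. -/
def IsGradedLeftIdeal (J : Submodule k R.carrier) : Prop :=
  (∀ a, ∀ x ∈ J, a * x ∈ J) ∧ ∀ n, ∀ x ∈ J, homComp R.internal n x ∈ J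

/-- The graded Jacobson radical: the intersection of the maximal graded left ideals. -/
def gradedRadical : Submodule k R.carrier :=
  sInf {J | Maximal (fun J => R.IsGradedLeftIdeal J ∧ J ≠ ⊤) J}

/-- The unital graded algebra `R` is graded local with residue algebra `k`: the quotient of `R`
by its graded Jacobson radical is one-dimensional, i.e. equal to `k`. -/
def IsGradedLocal : Prop := Module.finrank k (R.carrier ⧸ R.gradedRadical) = 1

end GrAlgebra

/-- The structure of a based affine quasi-hereditary algebra with weight poset `P` on a graded
algebra `R`: a system of idempotents and a graded triangular basis with `S = P` (identified
by means of `s ↦ ṡ`) such that all the algebras `R_p` are graded local. -/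
structure BasedAffineQuasiHereditary {k : Type u} [Field k] {J : Type v} (R : GrAlgebra k J)
    (P : Type w) [PartialOrder P] where
  index : Type w'
  idem : R.IdemSystem index
  locallyFiniteDimensional : (R.reindex idem).IsLocallyFiniteDimensional
  boundedBelow : (R.reindex idem).IsBoundedBelow
  basis : TriangularBasis (R.reindex idem) P
  wt_bijective : Function.Bijective basis.wt
  gradedLocal : ∀ p, (basis.cartan p).IsGradedLocal

/-! ### Flags -/

/-- `V` has a graded filtration `0 = V_0 ⊂ ⋯ ⊂ V_n = V` whose sections `V_r / V_{r-1}` are layers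
of distinct types. -/
def HasAscFlag {k : Type u} [Field k] {I : Type v} {A : GrAlgebra k I} {B : Type w}
    (layer : B → GrModule A → Prop) (V : GrModule A) : Prop :=
  ∃ (n : ℕ) (F : Fin (n + 1) →o Subobject V) (b : Fin n → B), Function.Injective b ∧
    F 0 = ⊥ ∧ F (Fin.last n) = ⊤ ∧
    ∀ r : Fin n, layer (b r)
      (cokernel (Subobject.ofLE (F r.castSucc) (F r.succ) (F.monotone r.castSucc_le_succ)))

/-- `V` has a graded filtration `V = V_0 ⊃ ⋯ ⊃ V_n = 0` whose sections `V_{r-1} / V_r` are layers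
of distinct types. -/
def HasDescFlag {k : Type u} [Field k] {I : Type v} {A : GrAlgebra k I} {B : Type w}
    (layer : B → GrModule A → Prop) (V : GrModule A) : Prop :=
  ∃ (n : ℕ) (F : Fin (n + 1) →o (Subobject V)ᵒᵈ) (b : Fin n → B), Function.Injective b ∧
    OrderDual.ofDual (F 0) = ⊤ ∧ OrderDual.ofDual (F (Fin.last n)) = ⊥ ∧
    ∀ r : Fin n, layer (b r)
      (cokernel (Subobject.ofLE (OrderDual.ofDual (F r.succ)) (OrderDual.ofDual (F r.castSucc))
        (F.monotone r.castSucc_le_succ)))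

/-! ### The refined setting -/

namespace TriangularBasis

variable {k : Type u} [Field k] {I : Type v} {A : GrAlgebra k I} {L : Type w} [PartialOrder L]
  (T : TriangularBasis A L) {B : L → Type*} [∀ l, PartialOrder (B l)]
  (Q : ∀ l, BasedAffineQuasiHereditary (T.cartan l) (B l))

/-- Pure `Δ`-layers of type `b ∈ B_l`: modules isomorphic to `j^l_!` of a `Δ_l`-layer. -/
def IsPureDeltaLayer (b : Σ l, B l) (V : GrModule A) : Prop :=
  ∃ V' : GrModule (T.cartan b.1),
    (Q b.1).basis.IsDeltaLayer b.2 (V'.toReindex (Q b.1).idem) ∧ Nonempty (V ≅ T.std b.1 V')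

/-- Pure `Δ̄`-layers of type `b ∈ B_l`: modules isomorphic to `j^l_!` of a `Δ̄_l`-layer. -/
def IsPureProperDeltaLayer (b : Σ l, B l) (V : GrModule A) : Prop :=
  ∃ V' : GrModule (T.cartan b.1),
    (Q b.1).basis.IsProperDeltaLayer b.2 (V'.toReindex (Q b.1).idem) ∧
      Nonempty (V ≅ T.std b.1 V')

/-- Pure `∇`-layers of type `b ∈ B_l`: modules isomorphic to `j^l_*` of a `∇_l`-layer. -/
def IsPureNablaLayer (b : Σ l, B l) (V : GrModule A) : Prop :=
  ∃ V' : GrModule (T.cartan b.1),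
    (Q b.1).basis.IsNablaLayer b.2 (V'.toReindex (Q b.1).idem) ∧ Nonempty (V ≅ T.costd b.1 V')

/-- Pure `∇̄`-layers of type `b ∈ B_l`: modules isomorphic to `j^l_*` of a `∇̄_l`-layer. -/
def IsPureProperNablaLayer (b : Σ l, B l) (V : GrModule A) : Prop :=
  ∃ V' : GrModule (T.cartan b.1),
    (Q b.1).basis.IsProperNablaLayer b.2 (V'.toReindex (Q b.1).idem) ∧
      Nonempty (V ≅ T.costd b.1 V')

end TriangularBasis

end

end GradedTriangular

/-! Long exact sequences along the two finite flags reduce everything to one layer on each side, say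
j_! of an A_l-module M and a shift of j_* of an A_m-module N. The shift is absorbed into N, because
j_* commutes with shifts. The core statement is then: Ext^n(j_! M, j_* N) vanishes for all n ≥ 1 if
l ≠ m (`extVanish_std_costd_of_ne`), and also if l = m provided that all Ext^n(M, N), n ≥ 1, vanish
over A_l (`extVanish_std_costd`).

The core is used at two levels. Inside each A_l, with its own triangular basis, the module being
standardized is projective or the one being costandardized is injective, so the vanishing over the
innermost algebras is automatic; this gives `IsDeltaLayer.extVanish` and
`IsProperDeltaLayer.extVanish`. These results are the input for the core over A when the two outer
weights agree; when they differ, no input is needed.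

To prove the core, j_! M is placed in a class of modules with room for induction. A module V is
X-free of type l if each vector is uniquely a sum of terms x v_x with x ∈ X(i,t), t of weight l, and
v_x ∈ 1_t V. Standard modules are X-free (`std_isXFree`), since X gives coordinates of A_{≥l} e_l
over A_l, and the truncation e_l j_! M is M (`nonempty_truncAt_std`). Kernels of surjections between
X-free modules of one type are X-free (`IsXFree.of_shortExact`). The induction runs over X-free V
such that the positive Ext groups over A_m from e_m V to N vanish whenever V is supported on weights
≥ m (`Good`).

In degree one it suffices to split every extension E of V by j_* N. If m ≤ l, then E is a module
over A_{≥m}; vanishing of Ext^1(e_m V, N) extends the evaluation e_m j_* N → N to e_m E, and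
coinduction turns this extension into a retraction. If m is not ≤ l, then j_* N is killed by all
special idempotents of weight ≤ l, so e_l E → e_l V is an isomorphism, and X-freeness extends its
inverse to a section V → E.

In higher degrees V is covered by P, the quotient of a projective F = ⨁ A 1_s (all s of weight l) by
its part F' spanned by basis vectors of weight < l. The kernel of P → V is again good, and P has its
extensions controlled by F and F'. Since lower sets are finite, F' has a finite filtration by
weights whose sections are layers (`freeOnLayer`): X-free modules with a basis xhz and projective
truncation. Hence each degree follows from the preceding one.

All inputs from the triangular basis rest on one straightening rule, `mul_mem_spanOf`: a product
through an idempotent of weight l is a combination of basis vectors of weights ≤ l. So spans of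
basis vectors over lower sets of weights are two-sided ideals. -/

namespace GradedTriangular

universe u v w w'

noncomputable section

/-! ### Vanishing of extension groups in abelian categories -/

section ExtVanishing

open Abelian

variable {C : Type w} [Category.{v} C] [Abelian C] [HasExt.{w'} C]

/-- An extension group in degree one vanishes as soon as all short exact sequences split. -/
theorem ext_one_subsingleton_of_split {S : ShortComplex C} (hS : S.ShortExact)
    [Projective S.X₂] {W : C}
    (h : ∀ T : ShortComplex C, T.ShortExact → ∀ (e : T.X₁ = W) (_ : T.X₃ = S.X₃),
      ∃ r : T.X₂ ⟶ W, T.f ≫ r = eqToHom e) : Subsingleton (Ext S.X₃ W 1) := by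
  refine subsingleton_of_forall_eq 0 fun α => ?_
  -- The middle term is projective, so every class is the image under the connecting map of a
  -- morphism `f : S.X₁ ⟶ W`; the class corresponds to the pushout of `S` along `f`.
  obtain ⟨x, rfl⟩ := Ext.contravariant_sequence_exact₃ hS W α (Ext.eq_zero_of_projective _)
    (n₀ := 0) rfl
  obtain ⟨f, rfl⟩ := Ext.addEquiv₀.symm.surjective x
  have := hS.mono_f
  have := hS.epi_g
  have hq := IsPushout.of_hasPushout f S.f
  let p : pushout f S.f ⟶ S.X₃ := pushout.desc 0 S.g (by simp)
  have hp1 : pushout.inl f S.f ≫ p = 0 := pushout.inl_desc _ _ _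
  have hp2 : pushout.inr f S.f ≫ p = S.g := pushout.inr_desc _ _ _
  have hepi : Epi p := by
    have : Epi (pushout.inr f S.f ≫ p) := by rw [hp2]; infer_instance
    exact epi_of_epi (pushout.inr f S.f) p
  have hT : (ShortComplex.mk _ p hp1).ShortExact := by
    have : Mono (pushout.inl f S.f) := inferInstance
    refine ShortComplex.ShortExact.mk' (ShortComplex.exact_of_g_is_cokernel _ ?_) this hepi
    refine CokernelCofork.IsColimit.ofπ _ _
      (fun g hg => hS.gIsCokernel.desc (CokernelCofork.ofπ (pushout.inr f S.f ≫ g) (by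
        dsimp at g hg ⊢
        rw [← Category.assoc, ← pushout.condition, Category.assoc, hg, comp_zero]))) ?_ ?_
    · intro Z g hg
      dsimp at g hg ⊢
      apply pushout.hom_ext
      · rw [← Category.assoc, hp1, zero_comp, hg]
      · rw [← Category.assoc, hp2]
        exact hS.gIsCokernel.fac _ WalkingParallelPair.one
    · intro Z g hg m hm
      dsimp at g hg m hm ⊢
      rw [← cancel_epi p, hm]
      symm
      apply pushout.hom_ext
      · rw [← Category.assoc, hp1, zero_comp, hg]
      · rw [← Category.assoc, hp2]
        exact hS.gIsCokernel.fac _ WalkingParallelPair.one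
  obtain ⟨r, hr⟩ := h _ hT rfl rfl
  -- A retraction of the pushout sequence extends `f` over `S.X₂`, and the connecting map kills
  -- morphisms that extend.
  have hf : f = S.f ≫ (pushout.inr f S.f ≫ r) := by
    rw [← Category.assoc, ← pushout.condition, Category.assoc]
    dsimp at hr
    rw [hr, Category.comp_id]
  have : Ext.addEquiv₀.symm f = (Ext.mk₀ S.f).comp (Ext.mk₀ (pushout.inr f S.f ≫ r))
      (zero_add 0) := by
    rw [Ext.mk₀_comp_mk₀, ← hf]
    rfl
  rw [this]
  exact hS.extClass_comp_assoc _

/-- All extension groups in positive degrees vanish. -/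
def ExtVanish (V W : C) : Prop := ∀ n : ℕ, Subsingleton (Ext V W (n + 1))

/-! ### Vanishing along isomorphisms and long exact sequences -/

theorem ExtVanish.of_iso_left {V V' W : C} (h : ExtVanish V W) (e : V ≅ V') :
    ExtVanish V' W := fun n => by
  have := h n
  refine subsingleton_of_forall_eq 0 fun x => ?_
  have h1 : (Ext.mk₀ e.inv).comp ((Ext.mk₀ e.hom).comp x (zero_add _)) (zero_add _) = x := by
    simp
  rw [← h1, Subsingleton.elim ((Ext.mk₀ e.hom).comp x (zero_add _)) 0, Ext.comp_zero]

theorem ExtVanish.of_iso_right {V W W' : C} (h : ExtVanish V W) (e : W ≅ W') :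
    ExtVanish V W' := fun n => by
  have := h n
  refine subsingleton_of_forall_eq 0 fun x => ?_
  have h1 : (x.comp (Ext.mk₀ e.inv) (add_zero _)).comp (Ext.mk₀ e.hom) (add_zero _) = x := by
    simp
  rw [← h1, Subsingleton.elim (x.comp (Ext.mk₀ e.inv) (add_zero _)) 0, Ext.zero_comp]

theorem ExtVanish.of_projective {V W : C} (h : Projective V) : ExtVanish V W :=
  fun n => Ext.subsingleton_of_projective V W n

theorem ExtVanish.of_injective {V W : C} (h : Injective W) : ExtVanish V W :=
  fun n => Ext.subsingleton_of_injective V W n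

theorem ext_subsingleton_middle {S : ShortComplex C} (hS : S.ShortExact) {W : C} (n : ℕ)
    (h1 : Subsingleton (Ext S.X₁ W n)) (h3 : Subsingleton (Ext S.X₃ W n)) :
    Subsingleton (Ext S.X₂ W n) := by
  refine subsingleton_of_forall_eq 0 fun x => ?_
  obtain ⟨y, rfl⟩ := Ext.contravariant_sequence_exact₂ hS W x (Subsingleton.elim _ _)
  rw [Subsingleton.elim y 0, Ext.comp_zero]

theorem ext_subsingleton_middle' {S : ShortComplex C} (hS : S.ShortExact) {V : C} (n : ℕ)
    (h1 : Subsingleton (Ext V S.X₁ n)) (h3 : Subsingleton (Ext V S.X₃ n)) :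
    Subsingleton (Ext V S.X₂ n) := by
  refine subsingleton_of_forall_eq 0 fun x => ?_
  obtain ⟨y, rfl⟩ := Ext.covariant_sequence_exact₂ V hS x (Subsingleton.elim _ _)
  rw [Subsingleton.elim y 0, Ext.zero_comp]

/-- Dimension shifting: when the middle group vanishes, the connecting map from Ext^n of `S.X₁` is
onto Ext^(n+1) of `S.X₃`. -/
theorem ext_subsingleton_right {S : ShortComplex C} (hS : S.ShortExact) {W : C} (n : ℕ)
    (h1 : Subsingleton (Ext S.X₁ W n)) (h2 : Subsingleton (Ext S.X₂ W (n + 1))) :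
    Subsingleton (Ext S.X₃ W (n + 1)) := by
  refine subsingleton_of_forall_eq 0 fun x => ?_
  obtain ⟨y, rfl⟩ := Ext.contravariant_sequence_exact₃ hS W x (Subsingleton.elim _ _)
    (add_comm 1 n)
  rw [Subsingleton.elim y 0, Ext.comp_zero]

/-- This passes vanishing to a kernel, at the cost of one further degree for the quotient term. -/
theorem ext_subsingleton_left {S : ShortComplex C} (hS : S.ShortExact) {W : C} (n : ℕ)
    (h2 : Subsingleton (Ext S.X₂ W n)) (h3 : Subsingleton (Ext S.X₃ W (n + 1))) :
    Subsingleton (Ext S.X₁ W n) := by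
  refine subsingleton_of_forall_eq 0 fun x => ?_
  obtain ⟨y, rfl⟩ := Ext.contravariant_sequence_exact₁ hS W x (add_comm 1 n)
    (Subsingleton.elim _ _)
  rw [Subsingleton.elim y 0, Ext.comp_zero]

/-- A morphism from the first term of a short exact sequence extends to the middle term if the
first extension group of the third term vanishes. -/
theorem exists_extension {S : ShortComplex C} (hS : S.ShortExact) {W : C}
    (h : Subsingleton (Ext S.X₃ W 1)) (f : S.X₁ ⟶ W) : ∃ g : S.X₂ ⟶ W, S.f ≫ g = f := by
  obtain ⟨y, hy⟩ := Ext.contravariant_sequence_exact₁ hS W (Ext.mk₀ f) (n₁ := 1) rfl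
    (Subsingleton.elim _ _)
  obtain ⟨g, rfl⟩ := Ext.addEquiv₀.symm.surjective y
  refine ⟨g, Ext.addEquiv₀.symm.injective ?_⟩
  change Ext.mk₀ _ = Ext.mk₀ _
  rw [← hy, ← Ext.mk₀_comp_mk₀]
  rfl

end ExtVanishing

/-! ### Graded modules: elementary constructions -/

namespace GrModule

variable {k : Type u} [Field k] {I : Type v} {A : GrAlgebra k I} {V W T : GrModule A}

theorem mono_of_injective (f : V ⟶ W) (h : Function.Injective (lin f)) : Mono f :=
  ⟨fun g g' hg => by
    ext v
    exact h (LinearMap.congr_fun (congrArg lin hg) v)⟩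

theorem epi_of_surjective (f : V ⟶ W) (h : Function.Surjective (lin f)) : Epi f :=
  ⟨fun g g' hg => by
    ext v
    obtain ⟨v, rfl⟩ := h v
    exact LinearMap.congr_fun (congrArg lin hg) v⟩

theorem isIso_of_bijective (f : V ⟶ W) (h : Function.Bijective (lin f)) : IsIso f := by
  have := mono_of_injective f h.1
  have := epi_of_surjective f h.2
  exact isIso_of_mono_of_epi f

/-- Short exact sequences of graded modules in terms of elements. -/
theorem shortExact_iff (S : ShortComplex (GrModule A)) : S.ShortExact ↔
    Function.Injective (lin S.f) ∧ Function.Surjective (lin S.g) ∧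
      ∀ v, lin S.g v = 0 → ∃ w, lin S.f w = v := by
  constructor
  · intro h
    have := h.mono_f
    have := h.epi_g
    refine ⟨injective_of_mono _, surjective_of_epi _, fun v hv => ?_⟩
    have h1 : h.fIsKernel.lift (KernelFork.ofι (kerι S.g) (kerι_comp S.g)) ≫ S.f = kerι S.g :=
      h.fIsKernel.fac _ WalkingParallelPair.zero
    exact ⟨_, LinearMap.congr_fun (congrArg lin h1) ⟨v, hv⟩⟩
  · rintro ⟨h1, h2, h3⟩
    refine ShortComplex.ShortExact.mk' ?_ (mono_of_injective _ h1) (epi_of_surjective _ h2)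
    rw [ShortComplex.exact_iff_epi_kernel_lift]
    refine epi_of_surjective _ fun v => ?_
    obtain ⟨w, hw⟩ := h3 (lin (kernel.ι S.g) v)
      (LinearMap.congr_fun (congrArg lin (kernel.condition S.g)) v)
    refine ⟨w, injective_of_mono (kernel.ι S.g) ?_⟩
    rw [← hw]
    exact LinearMap.congr_fun (congrArg lin (kernel.lift_ι S.g S.f S.zero)) w

theorem lin_comp_zero (S : ShortComplex (GrModule A)) (v : S.X₁.carrier) :
    lin S.g (lin S.f v) = 0 :=
  LinearMap.congr_fun (congrArg lin S.zero) v

theorem isZero_of_forall_eq_zero (h : ∀ v : V.carrier, v = 0) : IsZero V := by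
  rw [IsZero.iff_id_eq_zero]
  ext v
  exact (h v).trans (h _).symm

theorem homComp_act {p : ℤ} {a : A.carrier} (ha : a ∈ A.deg p) (n : ℤ) (v : V.carrier) :
    homComp V.internal n (V.act a v) = V.act a (homComp V.internal (n - p) v) := by
  have := map_homComp V.internal V.internal (V.act a) p
    (fun m x hx => by rw [add_comm]; exact V.act_mem ha hx) (n - p) v
  simpa using this

theorem act_one_act {i : I} {a : A.carrier} (h : A.one i * a = a) (v : V.carrier) :
    V.act (A.one i) (V.act a v) = V.act a v := by
  rw [← V.act_mul, h]

theorem act_act_one {i : I} {a : A.carrier} (h : a * A.one i = a) (v : V.carrier) :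
    V.act a (V.act (A.one i) v) = V.act a v := by
  rw [← V.act_mul, h]

end GrModule

/-- The degree projections of `regSum` are built with `Finsupp.lsum`; this shows that they act
coordinatewise. -/
theorem lsum_lsingle_comp_apply {k : Type u} [Field k] {ι M : Type*} [AddCommGroup M] [Module k M]
    {N : Type*} [AddCommGroup N] [Module k N] (c : ι → M →ₗ[k] N) (g : ι →₀ M) (j : ι) :
    Finsupp.lsum k (fun j => Finsupp.lsingle j ∘ₗ c j) g j = c j (g j) := by
  induction g using Finsupp.induction_linear with
  | zero => simp
  | add f g hf hg => rw [map_add, Finsupp.add_apply, hf, hg, Finsupp.add_apply, map_add]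
  | single i m =>
    rw [Finsupp.lsum_single]
    by_cases h : i = j
    · subst h; simp
    · simp [h]

namespace GrModule

variable {k : Type u} [Field k] {I : Type v} {A : GrAlgebra k I}

/-- A morphism, from the underlying linear map. -/
def ofLin {V W : GrModule A} (f : V.carrier →ₗ[k] W.carrier)
    (h : ∀ a v, f (V.act a v) = W.act a (f v)) (h' : ∀ n, ∀ v ∈ V.deg n, f v ∈ W.deg n) :
    V ⟶ W :=
  (⟨f, h, h'⟩ : Hom V W)

/-! ### Free modules -/

/-- The direct sum of copies of the regular module, with the generator numbered `j` in degree
`d j`. -/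
def regSum (A : GrAlgebra k I) {ι : Type u} (d : ι → ℤ) : GrModule A where
  carrier := ι →₀ A.carrier
  act :=
    { toFun := fun a => Finsupp.mapRange.linearMap (LinearMap.mulLeft k a)
      map_add' := fun a b => LinearMap.ext fun g => Finsupp.ext fun j => add_mul a b (g j)
      map_smul' := fun c a => LinearMap.ext fun g => Finsupp.ext fun j =>
        smul_mul_assoc c a (g j) }
  act_mul a b g := Finsupp.ext fun j => mul_assoc a b (g j)
  deg n :=
    { carrier := {g | ∀ j, g j ∈ A.deg (n - d j)}
      add_mem' := fun h h' j => add_mem (h j) (h' j)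
      zero_mem' := fun j => zero_mem _
      smul_mem' := fun c g h j => Submodule.smul_mem _ c (h j) }
  internal := by
    refine isInternal_of_proj (fun n => Finsupp.lsum k fun j =>
      Finsupp.lsingle j ∘ₗ homComp A.internal (n - d j)) ?_ ?_ ?_
    · intro n g hg
      refine Finsupp.ext fun j => ?_
      rw [lsum_lsingle_comp_apply, homComp_same A.internal (hg j)]
    · intro m n hmn g hg
      refine Finsupp.ext fun j => ?_
      rw [lsum_lsingle_comp_apply, homComp_ne A.internal (by omega) (hg j), Finsupp.zero_apply]
    · rw [eq_top_iff]
      rintro g -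
      induction g using Finsupp.induction_linear with
      | zero => exact zero_mem _
      | add f g hf hg => exact add_mem hf hg
      | single j a =>
        obtain ⟨s, hs⟩ := exists_sum_homComp A.internal a
        rw [hs, ← Finsupp.lsingle_apply (R := k), map_sum]
        refine Submodule.sum_mem _ fun n _ => Submodule.mem_iSup_of_mem (n + d j) fun i => ?_
        by_cases h : j = i
        · subst h
          simpa using homComp_mem A.internal n a
        · simp [h]
  act_mem {m n a g} ha hg j := by
    have := A.mul_mem ha (hg j)
    rwa [← add_sub_assoc] at this
  iSup_one := by
    rw [eq_top_iff]
    rintro g -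
    induction g using Finsupp.induction_linear with
    | zero => exact zero_mem _
    | add f g hf hg => exact add_mem hf hg
    | single j a =>
      obtain ⟨s, hs⟩ := A.exists_local_unit a
      rw [← (hs s le_rfl).1, Finset.sum_mul, ← Finsupp.lsingle_apply (R := k), map_sum]
      refine Submodule.sum_mem _ fun i _ => Submodule.mem_iSup_of_mem i ⟨Finsupp.single j a, ?_⟩
      simp

theorem regSum_act {ι : Type u} (d : ι → ℤ) (a : A.carrier) (g : (regSum A d).carrier) (j : ι) :
    DFunLike.coe (F := ι →₀ A.carrier) ((regSum A d).act a g) j =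
      a * DFunLike.coe (F := ι →₀ A.carrier) g j := by
  exact Finsupp.mapRange_apply (hf := map_zero (LinearMap.mulLeft k a))

theorem regSum_homComp {ι : Type u} (d : ι → ℤ) (n : ℤ) (g : (regSum A d).carrier) (j : ι) :
    DFunLike.coe (F := ι →₀ A.carrier) (homComp (regSum A d).internal n g) j =
      homComp A.internal (n - d j) (DFunLike.coe (F := ι →₀ A.carrier) g j) := by
  have hg : g ∈ ⨆ n, (regSum A d).deg n := by rw [iSup_deg (regSum A d).internal]; trivial
  induction hg using Submodule.iSup_induction' with
  | mem m x hx =>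
    by_cases h : m = n
    · subst h
      rw [homComp_same _ hx, homComp_same _ (hx j)]
    · rw [homComp_ne _ h hx, homComp_ne A.internal (m := m - d j) (by omega) (hx j)]
      rfl
  | zero => rw [map_zero]; exact (map_zero _).symm
  | add x y _ _ hx hy =>
    rw [map_add]
    refine (congrArg₂ (· + ·) hx hy).trans ?_
    rw [← map_add]
    rfl

/-- The elements of a direct sum of copies of `A` with components in `J 1_{s j}`. -/
def freeSub {ι : Type u} (s : ι → I) (J : Submodule k A.carrier) :
    Submodule k (ι →₀ A.carrier) where
  carrier := {g | ∀ j, g j ∈ J ∧ g j * A.one (s j) = g j}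
  add_mem' h h' j := ⟨add_mem (h j).1 (h' j).1, by
    rw [Finsupp.add_apply, add_mul, (h j).2, (h' j).2]⟩
  zero_mem' j := ⟨zero_mem _, by simp⟩
  smul_mem' c g h j := ⟨Submodule.smul_mem _ c (h j).1, by
    rw [Finsupp.smul_apply, smul_mul_assoc, (h j).2]⟩

/-- The graded module `⨁_j J 1_{s j}`, for a graded left ideal `J`. -/
def free {ι : Type u} (s : ι → I) (d : ι → ℤ) (J : Submodule k A.carrier)
    (hJ : A.IsGradedLeftIdeal J) : GrModule A :=
  (regSum A d).sub (freeSub s J)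
    (fun a g hg j => by
      rw [regSum_act]
      exact ⟨hJ.1 _ _ (hg j).1, by rw [mul_assoc, (hg j).2]⟩)
    (fun n g hg j => by
      rw [regSum_homComp]
      refine ⟨hJ.2 _ _ (hg j).1, ?_⟩
      have := A.mul_homComp_right (A.one_mem (s j)) (n - d j)
        (DFunLike.coe (F := ι →₀ A.carrier) g j)
      rw [(hg j).2, sub_zero] at this
      exact this.symm)

section free

variable {ι : Type u} {s : ι → I} {d : ι → ℤ} {J : Submodule k A.carrier}
  {hJ : A.IsGradedLeftIdeal J}

/-- The components of an element of a free module. -/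
def coord (g : (free s d J hJ).carrier) : ι →₀ A.carrier := g.1

theorem coord_injective : Function.Injective (coord : (free s d J hJ).carrier → _) :=
  Subtype.val_injective

/-- The element `a` in the summand numbered `j`. -/
def incl (j : ι) (a : A.carrier) (ha : a ∈ J) (ha' : a * A.one (s j) = a) :
    (free s d J hJ).carrier :=
  ⟨Finsupp.single j a, fun i => by
    by_cases h : j = i
    · subst h
      simpa using ⟨ha, ha'⟩
    · simp [h]⟩

theorem act_incl (j : ι) (a b : A.carrier) (ha : a ∈ J) (ha' : a * A.one (s j) = a) :
    (free s d J hJ).act b (incl j a ha ha') =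
      incl j (b * a) (hJ.1 b a ha) (by rw [mul_assoc, ha']) := by
  refine Subtype.ext ?_
  exact Finsupp.mapRange_single (hf := map_zero (LinearMap.mulLeft k b))

theorem incl_mem {j : ι} {a : A.carrier} {ha : a ∈ J} {ha' : a * A.one (s j) = a} {n : ℤ}
    (h : a ∈ A.deg n) : (incl j a ha ha' : (free s d J hJ).carrier) ∈
      (free s d J hJ).deg (n + d j) := fun i => by
  change (Finsupp.single j a : ι →₀ A.carrier) i ∈ _
  by_cases hi : j = i
  · subst hi
    simpa using h
  · simp [hi]

theorem free_induction {p : (free s d J hJ).carrier → Prop} (h0 : p 0)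
    (hadd : ∀ x y, p x → p y → p (x + y)) (h : ∀ j a ha ha', p (incl j a ha ha'))
    (g : (free s d J hJ).carrier) : p g := by
  have : ∀ f : ι →₀ A.carrier, ∀ hf : f ∈ freeSub s J, p ⟨f, hf⟩ := by
    intro f
    induction f using Finsupp.induction with
    | zero => exact fun _ => h0
    | single_add j a f hj ha ih =>
      intro hf
      have hz : f j = 0 := by simpa using hj
      have hf' : f ∈ freeSub s J := fun i => by
        by_cases hi : j = i
        · subst hi
          rw [hz]
          exact ⟨zero_mem _, zero_mul _⟩
        · have := hf i
          simpa [Finsupp.single_apply, hi] using this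
      have ha' := hf j
      simp only [Finsupp.add_apply, Finsupp.single_eq_same, hz, add_zero] at ha'
      exact hadd (incl j a ha'.1 ha'.2) ⟨f, hf'⟩ (h _ _ _ _) (ih hf')
  exact this g.1 g.2

/-- The linear map underlying `freeLift`. -/
def freeLiftLin {E : GrModule A} (x : ι → E.carrier) :
    (free s d J hJ).carrier →ₗ[k] E.carrier :=
  Finsupp.lsum k (fun j => E.act.flip (x j)) ∘ₗ (freeSub s J).subtype

theorem freeLiftLin_incl {E : GrModule A} (x : ι → E.carrier)
    (j : ι) (a : A.carrier) (ha : a ∈ J) (ha' : a * A.one (s j) = a) :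
    freeLiftLin x (incl j a ha ha' : (free s d J hJ).carrier) = E.act a (x j) := by
  change Finsupp.lsum k (fun j => E.act.flip (x j)) (Finsupp.single j a) = _
  simp

/-- The morphism from a free module determined by the images of the generators. -/
def freeLift {E : GrModule A} (x : ι → E.carrier) (hd : ∀ j, x j ∈ E.deg (d j)) :
    free s d J hJ ⟶ E :=
  (⟨freeLiftLin x,
    fun a g => by
      induction g using free_induction with
      | h0 => simp only [map_zero]
      | hadd g g' h h' => simp only [map_add, h, h']
      | h j b hb hb' =>
        rw [act_incl, freeLiftLin_incl, freeLiftLin_incl, E.act_mul],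
    fun n g hg => by
      change (Finsupp.lsum k (fun j => E.act.flip (x j)) (coord g)) ∈ _
      rw [Finsupp.lsum_apply]
      refine Submodule.sum_mem _ fun j _ => ?_
      have := E.act_mem (hg j) (hd j)
      rwa [sub_add_cancel] at this⟩ : Hom _ _)

theorem freeLift_incl {E : GrModule A} (x : ι → E.carrier) (hd : ∀ j, x j ∈ E.deg (d j))
    (j : ι) (a : A.carrier) (ha : a ∈ J) (ha' : a * A.one (s j) = a) :
    lin (freeLift (hJ := hJ) x hd) (incl j a ha ha') = E.act a (x j) :=
  freeLiftLin_incl x j a ha ha'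

/-- If `1_{s j}` lies in `J`, then `J 1_{s j}` is all of `A 1_{s j}`, generated by its idempotent,
so a lift is prescribed by homogeneous preimages of the images of these generators. -/
theorem free_projective (h : ∀ j, A.one (s j) ∈ J) : Projective (free s d J hJ) where
  factors {E X} f e _ := by
    have hs := surjective_of_epi e
    let q : ∀ j, (free s d J hJ).carrier := fun j => incl j _ (h j) (A.one_mul_one _)
    have hq : ∀ j, q j ∈ (free s d J hJ).deg (d j) := fun j => by
      have := incl_mem (hJ := hJ) (d := d) (ha := h j) (ha' := A.one_mul_one _) (A.one_mem (s j))
      rwa [zero_add] at this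
    choose x hx hx' using fun j => exists_deg_of_surjective hs (lin_deg f (hq j))
    refine ⟨freeLift x hx, ?_⟩
    ext g
    induction g using free_induction with
    | h0 => simp
    | hadd g g' h h' => rw [map_add, h, h', map_add]
    | h j a ha ha' =>
      rw [lin_comp, LinearMap.comp_apply, freeLift_incl, lin_act, hx', ← lin_act, act_incl]
      congr 2

end free

theorem top_isGradedLeftIdeal : A.IsGradedLeftIdeal ⊤ :=
  ⟨fun _ _ _ => trivial, fun _ _ _ => trivial⟩

/-- Homogeneous vectors that belong to one weight space generate. -/
theorem weight_induction {V : GrModule A} {p : V.carrier → Prop} (h0 : p 0)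
    (hadd : ∀ x y, p x → p y → p (x + y))
    (h : ∀ i n v, v ∈ V.deg n → V.act (A.one i) v = v → p v) (v : V.carrier) : p v := by
  obtain ⟨s, hs⟩ := exists_sum_homComp V.internal v
  rw [hs]
  refine Finset.sum_induction _ p hadd h0 fun n _ => ?_
  obtain ⟨t, ht⟩ := V.exists_local_unit (homComp V.internal n v)
  rw [ht]
  refine Finset.sum_induction _ p hadd h0 fun i _ => h i n _ ?_ ?_
  · have := V.act_mem (A.one_mem i) (homComp_mem V.internal n v)
    rwa [zero_add] at this
  · exact act_one_act (A.one_mul_one i) _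

instance : EnoughProjectives (GrModule A) where
  presentation V := by
    refine ⟨?_⟩
    let ι := {v : V.carrier // ∃ i n, v ∈ V.deg n ∧ V.act (A.one i) v = v}
    choose s d hd hs using show ∀ j : ι, ∃ i n, j.1 ∈ V.deg n ∧ V.act (A.one i) j.1 = j.1 from
      fun j => j.2
    have hp : Projective (free s d ⊤ (top_isGradedLeftIdeal (A := A))) :=
      free_projective fun _ => trivial
    refine
      { p := free s d ⊤ top_isGradedLeftIdeal
        projective := hp
        f := freeLift (s := s) (d := d) (fun j : ι => j.1) hd
        epi := epi_of_surjective _ fun v => ?_ }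
    induction v using weight_induction with
    | h0 => exact ⟨0, map_zero _⟩
    | hadd x y hx hy =>
      obtain ⟨x, rfl⟩ := hx
      obtain ⟨y, rfl⟩ := hy
      exact ⟨x + y, map_add _ _ _⟩
    | h i n v hv hv' =>
      let j : ι := ⟨v, i, n, hv, hv'⟩
      exact ⟨incl j (A.one (s j)) trivial (A.one_mul_one _), (freeLift_incl _ _ _ _ _ _).trans (hs j)⟩

/-! ### Change of the system of idempotents -/

/-- The functor underlying `toReindex`. -/
def toReindexFunctor {J : Type w} (S : A.IdemSystem J) : GrModule A ⥤ GrModule (A.reindex S) where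
  obj V := V.toReindex S
  map {V W} f := ofLin (V := V.toReindex S) (W := W.toReindex S) (lin f :) (lin_act f :)
    (fun _ _ h => (lin_deg f h :))

/-- The original system of idempotents. -/
def _root_.GradedTriangular.GrAlgebra.origSystem {J : Type w} (S : A.IdemSystem J) :
    (A.reindex S).IdemSystem I where
  one := A.one
  one_mem := A.one_mem
  one_mul_one := A.one_mul_one
  one_orth := A.one_orth
  iSup_peirce := A.iSup_peirce

/-- The inverse of `toReindex`. -/
def ofReindexFunctor {J : Type w} (S : A.IdemSystem J) : GrModule (A.reindex S) ⥤ GrModule A :=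
  toReindexFunctor (A := A.reindex S) (GrAlgebra.origSystem S)

/-- The change of the system of idempotents is an equivalence. -/
def reindexEquivalence {J : Type w} (S : A.IdemSystem J) :
    GrModule A ≌ GrModule (A.reindex S) :=
  CategoryTheory.Equivalence.mk (toReindexFunctor S) (ofReindexFunctor S)
    (show 𝟭 (GrModule A) ≅ toReindexFunctor S ⋙ ofReindexFunctor S from
      Iso.refl (𝟭 (GrModule A)))
    (show ofReindexFunctor S ⋙ toReindexFunctor S ≅ 𝟭 (GrModule (A.reindex S)) from
      Iso.refl (𝟭 (GrModule (A.reindex S))))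

instance {J : Type w} (S : A.IdemSystem J) : (toReindexFunctor S).IsEquivalence :=
  (reindexEquivalence S).isEquivalence_functor

instance {J : Type w} (S : A.IdemSystem J) : (toReindexFunctor S).Additive where
  map_add {_ _ _ _} := rfl

/-- Reindexing is an additive equivalence between categories with enough projectives, hence
bijective on Ext groups. -/
theorem extVanish_of_toReindex {J : Type w} (S : A.IdemSystem J) {V W : GrModule A}
    (h : ExtVanish (V.toReindex S) (W.toReindex S)) : ExtVanish V W := fun n => by
  have : Subsingleton (Abelian.Ext ((toReindexFunctor S).obj V) ((toReindexFunctor S).obj W)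
    (n + 1)) := h n
  exact ((toReindexFunctor S).mapExt_bijective_of_preservesProjectiveObjects V W
    (n + 1)).injective.subsingleton

/-! ### Shifts -/

variable {V W : GrModule A}

/-- The shift of a morphism. -/
def shiftMap (f : V ⟶ W) (d : ℤ) : V.shift d ⟶ W.shift d :=
  ofLin (V := V.shift d) (W := W.shift d) (lin f :) (lin_act f :)
    (fun _ _ h => (lin_deg f h :))

theorem nonempty_shiftIso (e : V ≅ W) (d : ℤ) : Nonempty (V.shift d ≅ W.shift d) := by
  refine ⟨⟨shiftMap e.hom d, shiftMap e.inv d, ?_, ?_⟩⟩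
  · exact congrArg (shiftMap (d := d)) e.hom_inv_id
  · exact congrArg (shiftMap (d := d)) e.inv_hom_id

/-- Shifting the source by `-d` turns an extension problem with target `V.shift d` into one with
target `V`. -/
theorem shift_injective (h : Injective V) (d : ℤ) : Injective (V.shift d) where
  factors {X Y} g f _ := by
    let g' : X.shift (-d) ⟶ V := ofLin (V := X.shift (-d)) (lin g :) (lin_act g :)
      (fun n v hv => by
        have : (lin g :) v ∈ V.deg (n + -d + d) := (lin_deg g hv :)
        rwa [neg_add_cancel_right] at this)
    have : Mono (shiftMap f (-d)) := mono_of_injective (shiftMap f (-d))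
      (injective_of_mono f :)
    obtain ⟨r, hr⟩ := Injective.factors g' (shiftMap f (-d))
    refine ⟨ofLin (W := V.shift d) (lin r :) (lin_act r :) (fun n v hv => ?_), ?_⟩
    · have hv' : v ∈ Y.deg (n + d + -d) := by rwa [add_neg_cancel_right]
      exact lin_deg r (n := n + d) hv'
    · ext v
      exact LinearMap.congr_fun (congrArg lin hr) v

theorem shortExact_shift {S : ShortComplex (GrModule A)} (h : S.ShortExact) (d : ℤ) :
    (ShortComplex.mk (shiftMap S.f d) (shiftMap S.g d)
      (by exact congrArg (shiftMap (d := d)) S.zero)).ShortExact :=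
  (shortExact_iff _).2 ((shortExact_iff S).1 h :)

end GrModule

/-! ### Idempotent truncation and coinduction -/

namespace GrAlgebra.Idem

open GrModule

variable {k : Type u} [Field k] {I : Type v} {A : GrAlgebra k I} (e : A.Idem)

/-- The subspace `eV`. -/
def fixed (V : GrModule A) : Submodule k V.carrier where
  carrier := {v | V.act e.val v = v}
  add_mem' h h' := by
    simp only [Set.mem_ofPred_eq] at *
    rw [map_add, h, h']
  zero_mem' := map_zero _
  smul_mem' c v h := by
    simp only [Set.mem_ofPred_eq] at *
    rw [map_smul, h]

theorem homComp_mem_fixed (V : GrModule A) (n : ℤ) (v : V.carrier) (hv : v ∈ e.fixed V) :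
    homComp V.internal n v ∈ e.fixed V := by
  have := homComp_act e.mem n v
  rw [show V.act e.val v = v from hv, sub_zero] at this
  exact this.symm

/-- The `eAe`-module `eV`. -/
def trunc (V : GrModule A) : GrModule (A.corner e) where
  carrier := e.fixed V
  act :=
    { toFun := fun h => (V.act h.1).restrict (fun v _ => act_one_fixed h v)
      map_add' := fun a b => LinearMap.ext fun v => Subtype.ext (by
        exact LinearMap.congr_fun (map_add V.act a.1 b.1) v.1)
      map_smul' := fun c a => LinearMap.ext fun v => Subtype.ext (by
        exact LinearMap.congr_fun (map_smul V.act c a.1) v.1) }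
  act_mul a b v := Subtype.ext (V.act_mul a.1 b.1 v.1)
  deg n := (V.deg n).comap (e.fixed V).subtype
  internal := isInternal_sub V.internal (e.fixed V) (e.homComp_mem_fixed V)
  act_mem ha hv := V.act_mem ha hv
  iSup_one := by
    rw [eq_top_iff]
    rintro v -
    exact Submodule.mem_iSup_of_mem () ⟨v, Subtype.ext v.2⟩
where
  act_one_fixed (h : (A.corner e).carrier) (v : V.carrier) : V.act h.1 v ∈ e.fixed V := by
    change V.act e.val (V.act h.1 v) = _
    rw [← V.act_mul, h.2.1]

variable {e}

/-- The morphism between truncations. -/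
def truncMap {V W : GrModule A} (f : V ⟶ W) : e.trunc V ⟶ e.trunc W :=
  ofLin (V := e.trunc V) (W := e.trunc W)
    ((lin f).restrict fun v hv => by
      change W.act e.val (lin f v) = lin f v
      rw [← lin_act, show V.act e.val v = v from hv])
    (fun h v => Subtype.ext (lin_act f h.1 v.1))
    (fun _ _ h => (lin_deg f h :))

/-- Exactness of `V ↦ eV`: a preimage of a fixed vector becomes a fixed preimage after acting by
`e`. -/
theorem shortExact_trunc {S : ShortComplex (GrModule A)} (h : S.ShortExact) :
    (ShortComplex.mk (truncMap (e := e) S.f) (truncMap S.g)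
      (by ext v; exact Subtype.ext (lin_comp_zero S v.1))).ShortExact := by
  obtain ⟨h1, h2, h3⟩ := (shortExact_iff S).1 h
  refine (shortExact_iff _).2 ⟨fun v w hvw => Subtype.ext (h1 (congrArg Subtype.val hvw)),
    fun w => ?_, fun v hv => ?_⟩
  · obtain ⟨v, hv⟩ := h2 w.1
    refine ⟨⟨S.X₂.act e.val v, ?_⟩, Subtype.ext ?_⟩
    · change S.X₂.act _ (S.X₂.act _ v) = _
      rw [← S.X₂.act_mul, e.idem]
    · change lin S.g (S.X₂.act e.val v) = w.1
      rw [lin_act, hv]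
      exact w.2
  · obtain ⟨w, hw⟩ := h3 v.1 (congrArg Subtype.val hv)
    refine ⟨⟨w, h1 ?_⟩, Subtype.ext hw⟩
    rw [lin_act, hw]
    exact v.2

/-- The map `v ↦ (x ↦ f (xv))`. -/
def coindLin {V : GrModule A} {N : GrModule (A.corner e)} (f : e.trunc V ⟶ N) :
    V.carrier →ₗ[k] (e.rightIdeal →ₗ[k] N.carrier) :=
  LinearMap.mk₂ k (fun v x => lin f (⟨V.act x.1 v, by
      change V.act e.val (V.act x.1 v) = _
      rw [← V.act_mul, show e.val * x.1 = x.1 from x.2]⟩ : e.fixed V))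
    (fun v v' x => (congrArg (lin f) (Subtype.ext (map_add (V.act x.1) v v'))).trans
      (map_add (lin f) _ _))
    (fun c v x => (congrArg (lin f) (Subtype.ext (map_smul (V.act x.1) c v))).trans
      (map_smul (lin f) _ _))
    (fun v x x' => (congrArg (lin f) (Subtype.ext
      (LinearMap.congr_fun (map_add V.act x.1 x'.1) v))).trans (map_add (lin f) _ _))
    (fun c v x => (congrArg (lin f) (Subtype.ext
      (LinearMap.congr_fun (map_smul V.act c x.1) v))).trans (map_smul (lin f) _ _))

theorem coindLin_apply {V : GrModule A} {N : GrModule (A.corner e)} (f : e.trunc V ⟶ N)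
    (v : V.carrier) (x : e.rightIdeal) (w : e.fixed V) (h : w.1 = V.act x.1 v) :
    coindLin f v x = lin f w :=
  congrArg (lin f) (Subtype.ext h.symm)

/-- A homogeneous vector is a finite sum of weight vectors `1_i v`, and each of them gives a map `x
↦ f (x 1_i v)` that is unchanged by right multiplication of `x` by `1_i`. -/
theorem coindLin_mem {V : GrModule A} {N : GrModule (A.corner e)} (f : e.trunc V ⟶ N) {n : ℤ}
    {v : V.carrier} (hv : v ∈ V.deg n) : coindLin f v ∈ ⨆ i, e.homDeg N i n := by
  obtain ⟨s, hs⟩ := V.exists_local_unit v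
  rw [hs, map_sum]
  refine Submodule.sum_mem _ fun i _ => Submodule.mem_iSup_of_mem i
    ⟨fun h x => ?_, fun x => ?_, fun m x hx => ?_⟩
  · refine Eq.trans ?_ (lin_act f h _)
    exact congrArg (lin f) (Subtype.ext (V.act_mul _ _ _))
  · refine congrArg (lin f) (Subtype.ext ?_)
    change V.act (x.1 * A.one i) _ = V.act x.1 _
    rw [V.act_mul, act_one_act (A.one_mul_one i)]
  · refine lin_deg f ?_
    change V.act x.1 _ ∈ V.deg (m + n)
    refine V.act_mem hx ?_
    have := V.act_mem (A.one_mem i) hv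
    rwa [zero_add] at this

/-- Coinduction: the morphism to `j_* N` corresponding to a morphism `eV ⟶ N`. -/
def coind {V : GrModule A} {N : GrModule (A.corner e)} (f : e.trunc V ⟶ N) :
    V ⟶ e.jStar N :=
  ofLin (W := e.jStar N) ((coindLin f).codRestrict (e.homTotal N) fun v => by
      obtain ⟨s, hs⟩ := exists_sum_homComp V.internal v
      rw [hs, map_sum]
      exact Submodule.sum_mem _ fun n _ =>
        Submodule.mem_iSup_of_mem n (coindLin_mem f (homComp_mem V.internal n v)))
    (fun a v => Subtype.ext (LinearMap.ext fun x => congrArg (lin f) (Subtype.ext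
      (V.act_mul x.1 a v).symm)))
    (fun n v hv => coindLin_mem f hv)

/-- The element `e` of `eA`. -/
def unitRight (e : A.Idem) : e.rightIdeal := ⟨e.val, e.idem⟩

/-- Evaluation at `e`. -/
def evalUnit (N : GrModule (A.corner e)) : e.trunc (e.jStar N) ⟶ N :=
  ofLin (V := e.trunc (e.jStar N))
    (LinearMap.applyₗ e.unitRight ∘ₗ (e.homTotal N).subtype ∘ₗ (e.fixed (e.jStar N)).subtype)
    (fun h v => by
      have h1 : ∀ f ∈ e.homTotal N, ∀ (h : (A.corner e).carrier) x,
          f (e.cornerMul h x) = N.act h (f x) := by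
        intro f hf
        induction hf using Submodule.iSup_induction' with
        | mem d f hf =>
          induction hf using Submodule.iSup_induction' with
          | mem i f hf => exact hf.1
          | zero => simp
          | add f g _ _ hf hg => intro h x; simp [hf, hg]
        | zero => simp
        | add f g _ _ hf hg => intro h x; simp [hf, hg]
      -- Acting by `h` and evaluating at `e` gives the value at `eh = h = he`, from which linearity
      -- over `eAe` extracts `h` on the left.
      refine Eq.trans ?_ (h1 _ v.1.2 h e.unitRight)
      refine congrArg v.1.1 (Subtype.ext ?_)
      change e.val * h.1 = h.1 * e.val
      rw [h.2.1, h.2.2])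
    (fun n v hv => by
      have := e.map_deg_of_mem N (f := v.1.1) hv (x := e.unitRight) e.mem
      rwa [zero_add] at this)

/-- An element `w` of `j_* N` is recovered from evaluation at `e`: its value at `x ∈ eA` is the
value of `xw` at `e`. Hence any extension of the evaluation map along `g` coinduces to a retraction
of `g`. -/
theorem coind_eq_of_evalUnit {V : GrModule A} {N : GrModule (A.corner e)}
    (g : e.jStar N ⟶ V) (f : e.trunc V ⟶ N) (h : truncMap g ≫ f = evalUnit N) :
    g ≫ coind f = 𝟙 _ := by
  ext w
  refine Subtype.ext (LinearMap.ext fun x => ?_)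
  have hx : (e.jStar N).act x.1 w ∈ e.fixed (e.jStar N) := by
    change (e.jStar N).act e.val ((e.jStar N).act x.1 w) = _
    rw [← (e.jStar N).act_mul, show e.val * x.1 = x.1 from x.2]
  have h1 := LinearMap.congr_fun (congrArg lin h)
    (⟨(e.jStar N).act x.1 w, hx⟩ : e.fixed (e.jStar N))
  refine Eq.trans ?_ (h1.trans ?_)
  · exact coindLin_apply f _ x _ (lin_act g x.1 w)
  · exact congrArg w.1 (Subtype.ext (show e.val * x.1 = x.1 from x.2))

theorem jStar_act_apply (N : GrModule (A.corner e)) (a : A.carrier) (f : (e.jStar N).carrier)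
    (x : e.rightIdeal) : ((e.jStar N).act a f).1 x = f.1 (e.rmul a x) :=
  rfl

/-- Costandardization commutes with shifts. -/
theorem nonempty_jStarShift (N : GrModule (A.corner e)) (d : ℤ) :
    Nonempty (e.jStar (N.shift d) ≅ (e.jStar N).shift d) := by
  have hdeg : ∀ i n, e.homDeg (N.shift d) i n = e.homDeg N i (n + d) := by
    intro i n
    ext f
    have : ∀ m, (N.shift d).deg (m + n) = N.deg (m + (n + d)) := fun m =>
      congrArg N.deg (add_assoc m n d)
    constructor
    · rintro ⟨h1, h2, h3⟩
      exact ⟨h1, h2, fun m x hx => (this m).le (h3 m x hx)⟩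
    · rintro ⟨h1, h2, h3⟩
      exact ⟨h1, h2, fun m x hx => (this m).ge (h3 m x hx)⟩
  -- The shift only renumbers the degree pieces, so the total spaces of maps coincide and just the
  -- grading differs.
  have htot : e.homTotal (N.shift d) = e.homTotal N := by
    refine le_antisymm (iSup_le fun n => iSup_le fun i => ?_)
      (iSup_le fun n => iSup_le fun i => ?_)
    · rw [hdeg]
      exact le_iSup_of_le (n + d) (le_iSup (fun i => e.homDeg N i (n + d)) i)
    · have := hdeg i (n - d)
      rw [sub_add_cancel] at this
      rw [← this]
      exact le_iSup_of_le (n - d) (le_iSup (fun i => e.homDeg (N.shift d) i (n - d)) i)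
  let K : Submodule k (e.rightIdeal →ₗ[k] N.carrier) := e.homTotal (N.shift d)
  let f₀ : K ≃ₗ[k] e.homTotal N := LinearEquiv.ofEq _ _ htot
  let f₁ : (e.jStar (N.shift d)).carrier →ₗ[k] ((e.jStar N).shift d).carrier := f₀.toLinearMap
  have h1 : ∀ a v, f₁ ((e.jStar (N.shift d)).act a v) = ((e.jStar N).shift d).act a (f₁ v) := by
    intro a v
    refine Subtype.ext (LinearMap.ext fun x => ?_)
    exact (jStar_act_apply (N.shift d) a v x).trans (jStar_act_apply N a (f₀ v) x).symm
  have h2 : ∀ n, ∀ v ∈ (e.jStar (N.shift d)).deg n, f₁ v ∈ ((e.jStar N).shift d).deg n := by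
    intro n f hf
    have h1 : (⨆ i, e.homDeg (N.shift d) i n) = ⨆ i, e.homDeg N i (n + d) :=
      iSup_congr fun i => hdeg i n
    exact h1.le hf
  have h4 : Function.Bijective f₁ := f₀.bijective
  obtain ⟨f, hf⟩ : ∃ f : e.jStar (N.shift d) ⟶ (e.jStar N).shift d, lin f = f₁ :=
    ⟨ofLin f₁ h1 h2, rfl⟩
  have := isIso_of_bijective f (by rw [hf]; exact h4)
  exact ⟨asIso f⟩

end GrAlgebra.Idem

/-! ### Modules over quotient algebras -/

namespace GrModule

variable {k : Type u} [Field k] {I : Type v} {A : GrAlgebra k I} {E : Set A.carrier}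
  {hE : ∀ x ∈ E, x ∈ A.deg 0}

/-- The annihilator of a module is a two-sided ideal. -/
theorem act_eq_zero_of_mem_ideal {V : GrModule A} (h : ∀ x ∈ E, V.act x = 0) {a : A.carrier}
    (ha : a ∈ A.ideal E) : V.act a = 0 := by
  have : A.ideal E ≤ LinearMap.ker V.act := by
    refine sInf_le ⟨fun x hx => h x hx, fun a x hx => ?_⟩
    rw [LinearMap.mem_ker] at hx
    constructor
    · rw [LinearMap.mem_ker]
      ext v
      rw [V.act_mul, hx, LinearMap.zero_apply, map_zero]
    · rw [LinearMap.mem_ker]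
      ext v
      rw [V.act_mul, hx]
      rfl
  exact this ha

variable (hE) in
/-- A module annihilated by an ideal, viewed as a module over the quotient. -/
def deflate (V : GrModule A) (h : ∀ x ∈ E, V.act x = 0) : GrModule (A.quot E hE) where
  carrier := V.carrier
  act := (A.ideal E).liftQ V.act fun _ ha => act_eq_zero_of_mem_ideal h ha
  act_mul a b v := by
    obtain ⟨a, rfl⟩ := A.quotMk_surjective E hE a
    obtain ⟨b, rfl⟩ := A.quotMk_surjective E hE b
    exact V.act_mul a b v
  deg := V.deg
  internal := V.internal
  act_mem := by
    rintro m n _ v ⟨a, ha, rfl⟩ hv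
    exact V.act_mem ha hv
  iSup_one := V.iSup_one

/-- Morphisms are morphisms of modules over the quotient. -/
def deflateMap {V W : GrModule A} (f : V ⟶ W) (h : ∀ x ∈ E, V.act x = 0)
    (h' : ∀ x ∈ E, W.act x = 0) : V.deflate hE h ⟶ W.deflate hE h' :=
  ofLin (V := V.deflate hE h) (W := W.deflate hE h') (lin f :)
    (fun a v => by
      obtain ⟨a, rfl⟩ := A.quotMk_surjective E hE a
      exact lin_act f a v)
    (fun _ _ h => (lin_deg f h :))

theorem shortExact_deflate {S : ShortComplex (GrModule A)} (hS : S.ShortExact)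
    (h1 : ∀ x ∈ E, S.X₁.act x = 0) (h2 : ∀ x ∈ E, S.X₂.act x = 0)
    (h3 : ∀ x ∈ E, S.X₃.act x = 0) :
    (ShortComplex.mk (deflateMap (hE := hE) S.f h1 h2) (deflateMap S.g h2 h3)
      (by ext v; exact lin_comp_zero S v)).ShortExact :=
  (shortExact_iff _).2 ((shortExact_iff S).1 hS :)

/-- A morphism from a deflation to a module over the quotient, as a morphism of `A`-modules. -/
def inflateHom {V : GrModule A} {h : ∀ x ∈ E, V.act x = 0} {N : GrModule (A.quot E hE)}
    (f : V.deflate hE h ⟶ N) : V ⟶ N.inflate :=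
  ofLin (W := N.inflate) (lin f :) (fun a v => (lin_act f (A.quotMk E hE a) v :))
    (fun _ _ h => (lin_deg f h :))

/-- A morphism from an inflation, as a morphism of modules over the quotient. -/
def deflateHom {V : GrModule A} {h : ∀ x ∈ E, V.act x = 0} {N : GrModule (A.quot E hE)}
    (f : N.inflate ⟶ V) : N ⟶ V.deflate hE h :=
  ofLin (W := V.deflate hE h) (lin f :)
    (fun a v => by
      obtain ⟨a, rfl⟩ := A.quotMk_surjective E hE a
      exact lin_act f a v)
    (fun _ _ h => (lin_deg f h :))

theorem inflate_act_eq_zero (N : GrModule (A.quot E hE)) {x : A.carrier} (hx : x ∈ E) :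
    N.inflate.act x = 0 := by
  change N.act (A.quotMk E hE x) = 0
  rw [show A.quotMk E hE x = 0 from (Submodule.Quotient.mk_eq_zero _).2 (A.subset_ideal E hx),
    map_zero]

/-- Inflations of isomorphic modules are isomorphic. -/
def inflateIso {N N' : GrModule (A.quot E hE)} (f : N ≅ N') : N.inflate ≅ N'.inflate where
  hom := ofLin (V := N.inflate) (W := N'.inflate) (lin f.hom :)
    (fun a v => (lin_act f.hom (A.quotMk E hE a) v :)) (fun _ _ h => (lin_deg f.hom h :))
  inv := ofLin (V := N'.inflate) (W := N.inflate) (lin f.inv :)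
    (fun a v => (lin_act f.inv (A.quotMk E hE a) v :)) (fun _ _ h => (lin_deg f.inv h :))
  hom_inv_id := by
    ext v
    exact LinearMap.congr_fun (congrArg lin f.hom_inv_id) v
  inv_hom_id := by
    ext v
    exact LinearMap.congr_fun (congrArg lin f.inv_hom_id) v

end GrModule

/-! ### Combinatorics of triangular bases -/

theorem homComp_mem_span {k : Type u} [Field k] {M : Type u} [AddCommGroup M] [Module k M]
    {U : ℤ → Submodule k M} (h : DirectSum.IsInternal U) {E : Set M}
    (hE : ∀ x ∈ E, ∃ n, x ∈ U n) (n : ℤ) {x : M} (hx : x ∈ Submodule.span k E) :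
    homComp h n x ∈ Submodule.span k E := by
  induction hx using Submodule.span_induction with
  | mem x hx =>
    obtain ⟨m, hm⟩ := hE x hx
    by_cases hmn : m = n
    · subst hmn
      rw [homComp_same h hm]
      exact Submodule.subset_span hx
    · rw [homComp_ne h hmn hm]
      exact zero_mem _
  | zero => rw [map_zero]; exact zero_mem _
  | add x y _ _ hx hy => rw [map_add]; exact add_mem hx hy
  | smul c x _ hx => rw [map_smul]; exact Submodule.smul_mem _ _ hx

namespace TriangularBasis

variable {k : Type u} [Field k] {I : Type v} {A : GrAlgebra k I} {L : Type w} [PartialOrder L]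
  (T : TriangularBasis A L)

/-- The index set of the triangular basis. -/
abbrev Idx : Type u := {p : A.carrier × A.carrier × A.carrier //
  ∃ i s t j, p.1 ∈ T.X i s ∧ p.2.1 ∈ T.H s t ∧ p.2.2 ∈ T.Y t j}

/-- The triangular basis, as a basis. -/
def toBasis : Module.Basis T.Idx k A.carrier :=
  Module.Basis.mk T.linearIndependent (by
    rw [← T.span_eq_top]
    refine Submodule.span_mono ?_
    rintro _ ⟨i, s, t, j, x, hx, h, hh, y, hy, rfl⟩
    exact ⟨⟨(x, h, y), i, s, t, j, hx, hh, hy⟩, rfl⟩)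

theorem toBasis_apply (p : T.Idx) : T.toBasis p = p.1.1 * p.1.2.1 * p.1.2.2 :=
  Module.Basis.mk_apply _ _ p

variable {T} {i j : I} {s t u : T.S} {x h y : A.carrier}

theorem one_mul_X (hx : x ∈ T.X i s) : A.one i * x = x := (T.X_subset i s x hx).1
theorem X_mul_one (hx : x ∈ T.X i s) : x * A.one s = x := (T.X_subset i s x hx).2
theorem one_mul_H (hh : h ∈ T.H s t) : A.one s * h = h := (T.H_subset s t h hh).1
theorem H_mul_one (hh : h ∈ T.H s t) : h * A.one t = h := (T.H_subset s t h hh).2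
theorem one_mul_Y (hy : y ∈ T.Y t j) : A.one t * y = y := (T.Y_subset t j y hy).1
theorem Y_mul_one (hy : y ∈ T.Y t j) : y * A.one j = y := (T.Y_subset t j y hy).2

theorem one_mem_X (s : T.S) : A.one s ∈ T.X s s := by rw [T.X_self]; rfl
theorem one_mem_Y (s : T.S) : A.one s ∈ T.Y s s := by rw [T.Y_self]; rfl

theorem wt_eq_of_H (hh : h ∈ T.H s t) : T.wt s = T.wt t := by
  by_cases hst : s = t
  · rw [hst]
  · exact T.H_eq s t hst ⟨h, hh⟩

theorem wt_le_of_X (hx : x ∈ T.X s t) : T.wt t ≤ T.wt s := by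
  by_cases hst : s = t
  · rw [hst]
  · exact (T.X_lt s t hst ⟨x, hx⟩).le

theorem mul_ne_zero_of_mem (hx : x ∈ T.X i s) (hh : h ∈ T.H s t) (hy : y ∈ T.Y t j) :
    x * h * y ≠ 0 := by
  rw [← T.toBasis_apply ⟨(x, h, y), i, s, t, j, hx, hh, hy⟩]
  exact T.toBasis.ne_zero _

theorem H_ne_zero (hh : h ∈ T.H s t) : h ≠ 0 := by
  rintro rfl
  exact mul_ne_zero_of_mem (one_mem_X s) hh (one_mem_Y t) (by simp)

/-- A nonzero element cannot be fixed by two orthogonal idempotents. Hence the vertices of a basis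
vector can be recovered from its factors, and arbitrary choices of vertices made later are harmless.
-/
theorem eq_of_mul_one {i j : I} {a : A.carrier} (ha : a ≠ 0) (h1 : a * A.one i = a)
    (h2 : a * A.one j = a) : i = j := by
  by_contra hij
  rw [← h1, mul_assoc, A.one_orth _ _ hij, mul_zero] at h2
  exact ha (h1.symm.trans h2.symm)

theorem eq_of_one_mul {i j : I} {a : A.carrier} (ha : a ≠ 0) (h1 : A.one i * a = a)
    (h2 : A.one j * a = a) : i = j := by
  by_contra hij
  rw [← h1, ← mul_assoc, A.one_orth _ _ (Ne.symm hij), zero_mul] at h2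
  exact ha (h1.symm.trans h2.symm)

/-! #### Spanning -/

/-- Compression by `1_i` and `1_j` fixes `a` and kills every basis product outside the block from
`i` to `j`. -/
theorem mem_span_of_peirce {i j : I} {a : A.carrier} (h1 : A.one i * a = a)
    (h2 : a * A.one j = a) : a ∈ Submodule.span k
      {b | ∃ s t, ∃ x ∈ T.X i s, ∃ h ∈ T.H s t, ∃ y ∈ T.Y t j, b = x * h * y} := by
  have : ∀ b ∈ Submodule.span k {a | ∃ i s t j, ∃ x ∈ T.X i s, ∃ h ∈ T.H s t, ∃ y ∈ T.Y t j,
      a = x * h * y}, A.one i * b * A.one j ∈ Submodule.span k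
      {b | ∃ s t, ∃ x ∈ T.X i s, ∃ h ∈ T.H s t, ∃ y ∈ T.Y t j, b = x * h * y} := by
    intro b hb
    induction hb using Submodule.span_induction with
    | mem b hb =>
      obtain ⟨i', s, t, j', x, hx, h, hh, y, hy, rfl⟩ := hb
      by_cases hi : i = i'
      · subst hi
        by_cases hj : j = j'
        · subst hj
          refine Submodule.subset_span ⟨s, t, x, hx, h, hh, y, hy, ?_⟩
          rw [mul_assoc, mul_assoc (x * h), Y_mul_one hy, mul_assoc x, ← mul_assoc, one_mul_X hx]
        · have : x * h * y * A.one j = 0 := by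
            rw [← Y_mul_one hy, mul_assoc, mul_assoc y, A.one_orth _ _ (Ne.symm hj), mul_zero,
              mul_zero]
          rw [mul_assoc, this, mul_zero]
          exact zero_mem _
      · have : A.one i * (x * h * y) = 0 := by
          rw [← one_mul_X hx, mul_assoc, mul_assoc, ← mul_assoc, A.one_orth _ _ hi, zero_mul]
        rw [this, zero_mul]
        exact zero_mem _
    | zero => simp
    | add a b _ _ ha hb => rw [mul_add, add_mul]; exact add_mem ha hb
    | smul c a _ ha =>
      rw [mul_smul_comm, smul_mul_assoc]
      exact Submodule.smul_mem _ c ha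
  have h3 := this a (by rw [T.span_eq_top]; trivial)
  rwa [h1, h2] at h3

theorem mem_of_forall_left {K : Submodule k A.carrier} {a : A.carrier}
    (h : ∀ i, A.one i * a ∈ K) : a ∈ K := by
  obtain ⟨s, hs⟩ := A.exists_local_unit a
  rw [← (hs s le_rfl).1, Finset.sum_mul]
  exact Submodule.sum_mem _ fun i _ => h i

theorem mem_of_forall_right {K : Submodule k A.carrier} {a : A.carrier}
    (h : ∀ i, a * A.one i ∈ K) : a ∈ K := by
  obtain ⟨s, hs⟩ := A.exists_local_unit a
  rw [← (hs s le_rfl).2, Finset.mul_sum]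
  exact Submodule.sum_mem _ fun i _ => h i

/-- Products of elements of `A` through special idempotents of weight `< l`. -/
def lower (T : TriangularBasis A L) (l : L) : Set A.carrier :=
  {c | ∃ u : T.S, T.wt u < l ∧ ∃ a b, a * A.one u = a ∧ A.one u * b = b ∧ c = a * b}

/-- The last factor of a basis vector ending at `t` is either `1_t` or an element of `Y(u,t)` with
`u ≠ t`; in the second case `u` has smaller weight and the product passes through `1_u`. -/
theorem right_expand {t : T.S} {a : A.carrier} (ha : a * A.one t = a) : a ∈ Submodule.span k
    ({b | ∃ i s, ∃ x ∈ T.X i s, ∃ h ∈ T.H s t, b = x * h} ∪ T.lower (T.wt t)) := by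
  refine mem_of_forall_left fun i => ?_
  refine Submodule.span_le.2 ?_ (mem_span_of_peirce (T := T) (i := i) (j := t) (a := A.one i * a)
    (by rw [← mul_assoc, A.one_mul_one]) (by rw [mul_assoc, ha]))
  rintro _ ⟨s, u, x, hx, h, hh, y, hy, rfl⟩
  refine Submodule.subset_span ?_
  by_cases hut : u = t
  · subst hut
    rw [T.Y_self] at hy
    rw [Set.mem_singleton_iff.1 hy, mul_assoc, H_mul_one hh]
    exact Or.inl ⟨i, s, x, hx, h, hh, rfl⟩
  · exact Or.inr ⟨u, T.Y_lt u t hut ⟨y, hy⟩, x * h, y, by rw [mul_assoc, H_mul_one hh],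
      one_mul_Y hy, rfl⟩

theorem left_expand {s : T.S} {a : A.carrier} (ha : A.one s * a = a) : a ∈ Submodule.span k
    ({b | ∃ t j, ∃ h ∈ T.H s t, ∃ y ∈ T.Y t j, b = h * y} ∪ T.lower (T.wt s)) := by
  refine mem_of_forall_right fun j => ?_
  refine Submodule.span_le.2 ?_ (mem_span_of_peirce (T := T) (i := s) (j := j) (a := a * A.one j)
    (by rw [← mul_assoc, ha]) (by rw [mul_assoc, A.one_mul_one]))
  rintro _ ⟨u, t, x, hx, h, hh, y, hy, rfl⟩
  refine Submodule.subset_span ?_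
  by_cases hus : s = u
  · subst hus
    rw [T.X_self] at hx
    rw [Set.mem_singleton_iff.1 hx, one_mul_H hh]
    exact Or.inl ⟨t, j, h, hh, y, hy, rfl⟩
  · exact Or.inr ⟨u, T.X_lt s u hus ⟨x, hx⟩, x, h * y, X_mul_one hx,
      by rw [← mul_assoc, one_mul_H hh], by rw [mul_assoc]⟩

/-- Between two vertices of the same weight, any nontrivial factor from X or Y forces a passage
through a smaller weight. -/
theorem both_expand {s t : T.S} (hst : T.wt s = T.wt t) {a : A.carrier} (h1 : A.one s * a = a)
    (h2 : a * A.one t = a) : a ∈ Submodule.span k (T.H s t ∪ T.lower (T.wt t)) := by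
  refine Submodule.span_le.2 ?_ (mem_span_of_peirce (T := T) h1 h2)
  rintro _ ⟨u, u', x, hx, h, hh, y, hy, rfl⟩
  refine Submodule.subset_span ?_
  by_cases hus : s = u
  · subst hus
    rw [T.X_self] at hx
    rw [Set.mem_singleton_iff.1 hx, one_mul_H hh]
    by_cases hut : u' = t
    · subst hut
      rw [T.Y_self] at hy
      rw [Set.mem_singleton_iff.1 hy, H_mul_one hh]
      exact Or.inl hh
    · exact Or.inr ⟨u', T.Y_lt u' t hut ⟨y, hy⟩, h, y, H_mul_one hh, one_mul_Y hy, rfl⟩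
  · exact Or.inr ⟨u, hst ▸ T.X_lt s u hus ⟨x, hx⟩, x, h * y, X_mul_one hx,
      by rw [← mul_assoc, one_mul_H hh], by rw [mul_assoc]⟩

/-! #### Ideals attached to lower sets -/

/-- The span of the basis vectors with weight in `D`. -/
def spanOf (T : TriangularBasis A L) (D : Set L) : Submodule k A.carrier :=
  Submodule.span k
    {b | ∃ i s t j, T.wt t ∈ D ∧ ∃ x ∈ T.X i s, ∃ h ∈ T.H s t, ∃ y ∈ T.Y t j, b = x * h * y}

theorem spanOf_mono {D D' : Set L} (h : D ⊆ D') : T.spanOf D ≤ T.spanOf D' := by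
  refine Submodule.span_mono ?_
  rintro _ ⟨i, s, t, j, ht, h'⟩
  exact ⟨i, s, t, j, h ht, h'⟩

/-- The cardinality of the finite set of weights below a given one is strictly monotone, so it
serves as a rank. -/
theorem wellFoundedLT (T : TriangularBasis A L) : WellFoundedLT L := by
  refine ⟨Subrelation.wf (r := InvImage (· < ·) fun l : L => (Set.Iic l).ncard) ?_
    (InvImage.wf _ wellFounded_lt)⟩
  intro a b hab
  refine Set.ncard_lt_ncard ?_ (T.lower_finite b)
  exact Set.Iic_ssubset_Iic.2 hab

/-- The straightening rule. Modulo products through smaller weights, `a` is a combination of terms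
`xh`, `b` of terms `h'y`, and then `hh'` of elements of H, so that `ab` becomes a combination of
basis vectors of the weight of `s`. The discarded products are treated by well-founded induction on
the weight. -/
theorem mul_mem_spanOf {s : T.S} {a b : A.carrier} (ha : a * A.one s = a) (hb : A.one s * b = b) :
    a * b ∈ T.spanOf (Set.Iic (T.wt s)) := by
  have := T.wellFoundedLT
  obtain ⟨l, hl⟩ : ∃ l, l = T.wt s := ⟨_, rfl⟩
  rw [← hl]
  induction l using WellFoundedLT.induction generalizing s a b with
  | ind l ih =>
  -- Outer factors can be merged into the two halves of a product through a smaller weight, so the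
  -- induction hypothesis covers them too.
  have low : ∀ c ∈ T.lower l, ∀ a b, a * c * b ∈ T.spanOf (Set.Iic l) := by
    rintro _ ⟨u, hu, c, d, hc, hd, rfl⟩ a b
    have := ih (T.wt u) hu (s := u) (a := a * c) (b := d * b) (by rw [mul_assoc, hc])
      (by rw [← mul_assoc, hd]) rfl
    rw [mul_assoc] at this
    rw [mul_assoc, mul_assoc]
    exact spanOf_mono (Set.Iic_subset_Iic.2 hu.le) this
  have ha' := right_expand ha
  clear ha
  induction ha' using Submodule.span_induction with
  | mem c hc =>
    rcases hc with ⟨i, t, x, hx, h, hh, rfl⟩ | hc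
    · have hb' := left_expand hb
      clear hb
      induction hb' using Submodule.span_induction with
      | mem d hd =>
        rcases hd with ⟨t', j, h', hh', y, hy, rfl⟩ | hd
        · have ht : T.wt t = T.wt t' := (wt_eq_of_H hh).trans (wt_eq_of_H hh')
          have ht' : T.wt t' = l := (wt_eq_of_H hh').symm.trans hl.symm
          have hm := both_expand (T := T) ht (a := h * h')
            (by rw [← mul_assoc, one_mul_H hh]) (by rw [mul_assoc, H_mul_one hh'])
          have : ∀ m ∈ Submodule.span k (T.H t t' ∪ T.lower (T.wt t')),
              x * m * y ∈ T.spanOf (Set.Iic l) := by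
            intro m hm
            induction hm using Submodule.span_induction with
            | mem m hm =>
              rcases hm with hm | hm
              · exact Submodule.subset_span ⟨i, t, t', j, ht'.le, x, hx, m, hm, y, hy, rfl⟩
              · exact low m (ht' ▸ hm) x y
            | zero => simp
            | add m m' _ _ hm hm' => rw [mul_add, add_mul]; exact add_mem hm hm'
            | smul c m _ hm =>
              rw [mul_smul_comm, smul_mul_assoc]; exact Submodule.smul_mem _ c hm
          have := this _ hm
          simpa only [mul_assoc] using this
        -- A local unit of `d` serves as the right-hand outer factor required by `low`.
        · have := low d (hl ▸ hd) (x * h) (∑ i ∈ (A.exists_local_unit d).choose, A.one i)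
          rwa [mul_assoc (x * h), ((A.exists_local_unit d).choose_spec _ le_rfl).2] at this
      | zero => simp
      | add m m' _ _ hm hm' => rw [mul_add]; exact add_mem hm hm'
      | smul c m _ hm => rw [mul_smul_comm]; exact Submodule.smul_mem _ c hm
    · have := low c (hl ▸ hc) (∑ i ∈ (A.exists_local_unit c).choose, A.one i) b
      rwa [((A.exists_local_unit c).choose_spec _ le_rfl).1] at this
  | zero => simp
  | add m m' _ _ hm hm' => rw [add_mul]; exact add_mem hm hm'
  | smul c m _ hm => rw [smul_mul_assoc]; exact Submodule.smul_mem _ c hm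

theorem mul_mem_spanOf_of_mem {D : Set L} (hD : IsLowerSet D) {s : T.S} (hs : T.wt s ∈ D)
    {a b : A.carrier} (ha : a * A.one s = a) (hb : A.one s * b = b) : a * b ∈ T.spanOf D :=
  spanOf_mono (fun _ h => hD h hs) (mul_mem_spanOf ha hb)

theorem one_mem_spanOf {D : Set L} (hD : IsLowerSet D) {s : T.S} (hs : T.wt s ∈ D) :
    A.one s ∈ T.spanOf D := by
  have := mul_mem_spanOf_of_mem hD hs (A.one_mul_one s) (A.one_mul_one s)
  rwa [A.one_mul_one] at this

theorem mul_mem_spanOf_left {D : Set L} (hD : IsLowerSet D) (a : A.carrier) {b : A.carrier}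
    (hb : b ∈ T.spanOf D) : a * b ∈ T.spanOf D := by
  induction hb using Submodule.span_induction with
  | mem b hb =>
    obtain ⟨i, s, t, j, ht, x, hx, h, hh, y, hy, rfl⟩ := hb
    rw [mul_assoc, ← mul_assoc]
    exact mul_mem_spanOf_of_mem hD (s := s) (by rwa [wt_eq_of_H hh]) (by rw [mul_assoc, X_mul_one hx])
      (by rw [← mul_assoc, one_mul_H hh])
  | zero => simp
  | add m m' _ _ hm hm' => rw [mul_add]; exact add_mem hm hm'
  | smul c m _ hm => rw [mul_smul_comm]; exact Submodule.smul_mem _ c hm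

theorem mul_mem_spanOf_right {D : Set L} (hD : IsLowerSet D) (a : A.carrier) {b : A.carrier}
    (hb : b ∈ T.spanOf D) : b * a ∈ T.spanOf D := by
  induction hb using Submodule.span_induction with
  | mem b hb =>
    obtain ⟨i, s, t, j, ht, x, hx, h, hh, y, hy, rfl⟩ := hb
    rw [mul_assoc]
    exact mul_mem_spanOf_of_mem hD ht (by rw [mul_assoc, H_mul_one hh])
      (by rw [← mul_assoc, one_mul_Y hy])
  | zero => simp
  | add m m' _ _ hm hm' => rw [add_mul]; exact add_mem hm hm'
  | smul c m _ hm => rw [smul_mul_assoc]; exact Submodule.smul_mem _ c hm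

theorem spanOf_isGradedLeftIdeal (T : TriangularBasis A L) {D : Set L} (hD : IsLowerSet D) :
    A.IsGradedLeftIdeal (T.spanOf D) := by
  refine ⟨fun a b hb => mul_mem_spanOf_left hD a hb, fun n b hb =>
    homComp_mem_span A.internal ?_ n hb⟩
  rintro _ ⟨i, s, t, j, ht, x, hx, h, hh, y, hy, rfl⟩
  obtain ⟨p, hp⟩ := T.X_homogeneous i s x hx
  obtain ⟨q, hq⟩ := T.H_homogeneous s t h hh
  obtain ⟨r, hr⟩ := T.Y_homogeneous t j y hy
  exact ⟨_, A.mul_mem (A.mul_mem hp hq) hr⟩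

theorem eq_of_mem_H (hh : h ∈ T.H s t) {s' : T.S} {t' : T.S} (hh' : h ∈ T.H s' t') :
    s = s' ∧ t = t' :=
  ⟨Subtype.ext (eq_of_one_mul (H_ne_zero hh) (one_mul_H hh) (one_mul_H hh')),
    Subtype.ext (eq_of_mul_one (H_ne_zero hh) (H_mul_one hh) (H_mul_one hh'))⟩

/-- The middle factor of a basis vector determines its weight, so one of weight outside `D` differs
from all vectors spanning `T.spanOf D`. -/
theorem repr_eq_zero_of_mem_spanOf {D : Set L} {a : A.carrier} (ha : a ∈ T.spanOf D) (p : T.Idx)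
    {s t : T.S} (hp : p.1.2.1 ∈ T.H s t) (ht : T.wt t ∉ D) : T.toBasis.repr a p = 0 := by
  classical
  induction ha using Submodule.span_induction with
  | mem b hb =>
    obtain ⟨i, s', t', j, ht', x, hx, h, hh, y, hy, rfl⟩ := hb
    have h1 := T.toBasis_apply ⟨(x, h, y), i, s', t', j, hx, hh, hy⟩
    rw [← h1, Module.Basis.repr_self, Finsupp.single_apply, if_neg]
    rintro rfl
    exact ht ((eq_of_mem_H hp hh).2 ▸ ht')
  | zero => simp
  | add m m' _ _ hm hm' => rw [map_add, Finsupp.add_apply, hm, hm', add_zero]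
  | smul c m _ hm => rw [map_smul, Finsupp.smul_apply, hm, smul_zero]

/-! ### The idempotents e_l and the kernel of A → A_{≥l} -/

theorem one_mul_e {l : L} {s : T.S} (hs : T.wt s = l) : A.one s * (T.e l).val = A.one s := by
  classical
  change A.one s * ∑ t ∈ (T.fiber_finite l).toFinset, A.one t = _
  rw [Finset.mul_sum, Finset.sum_eq_single s, A.one_mul_one]
  · exact fun t _ hts => A.one_orth _ _ fun h => hts (Subtype.ext h).symm
  · exact fun h => absurd (by simpa using hs) h

theorem e_mul_one {l : L} {s : T.S} (hs : T.wt s = l) : (T.e l).val * A.one s = A.one s := by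
  classical
  change (∑ t ∈ (T.fiber_finite l).toFinset, A.one t) * A.one s = _
  rw [Finset.sum_mul, Finset.sum_eq_single s, A.one_mul_one]
  · exact fun t _ hts => A.one_orth _ _ fun h => hts (Subtype.ext h)
  · exact fun h => absurd (by simpa using hs) h

/-- The generators of the kernel of `A → A_{≥ l}`. -/
abbrev notGeq (T : TriangularBasis A L) (l : L) : Set A.carrier :=
  {x | ∃ m, ¬ l ≤ m ∧ x = (T.e m).val}

theorem notGeq_mem (T : TriangularBasis A L) (l : L) : ∀ x ∈ T.notGeq l, x ∈ A.deg 0 := by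
  rintro _ ⟨m, -, rfl⟩; exact (T.e m).mem

/-- The weights not above `l` form a lower set, whose span is a two-sided ideal and contains the
generators. This upper bound on the kernel of A → A_{≥l} is what lets `coeffs` descend to the
quotient. -/
theorem ideal_le_spanOf (T : TriangularBasis A L) (l : L) :
    A.ideal (T.notGeq l) ≤ T.spanOf {m | ¬ l ≤ m} := by
  have hD : IsLowerSet {m | ¬ l ≤ m} := fun a b hba ha hb => ha (hb.trans hba)
  refine sInf_le ⟨?_, fun a x hx => ⟨mul_mem_spanOf_left hD a hx, mul_mem_spanOf_right hD a hx⟩⟩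
  rintro _ ⟨m, hm, rfl⟩
  refine Submodule.sum_mem _ fun s hs => one_mem_spanOf hD ?_
  have : T.wt s = m := by simpa using hs
  rwa [this]

theorem one_mem_ideal {l : L} {s : T.S} (hs : ¬ l ≤ T.wt s) : A.one s ∈ A.ideal (T.notGeq l) := by
  rw [← one_mul_e (T := T) (s := s) rfl]
  exact (A.mul_mem_ideal _ _ (A.subset_ideal (T.notGeq l) ⟨_, hs, rfl⟩)).1

theorem lower_subset_ideal {l : L} {c : A.carrier} (hc : c ∈ T.lower l) :
    c ∈ A.ideal (T.notGeq l) := by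
  obtain ⟨u, hu, a, b, ha, hb, rfl⟩ := hc
  rw [← ha]
  exact (A.mul_mem_ideal _ b (A.mul_mem_ideal _ a (one_mem_ideal hu.not_ge)).1).2

end TriangularBasis

namespace TriangularBasis

open GrModule

variable {k : Type u} [Field k] {I : Type v} {A : GrAlgebra k I} {L : Type w} [PartialOrder L]
  (T : TriangularBasis A L)

/-! ### Modules that are free over the lower half of a triangular basis -/

/-- The elements of the sets `X(i,t)` with `t` of weight `l`. -/
def XIdx (l : L) : Type (max u v) :=
  {p : T.S × A.carrier // T.wt p.1 = l ∧ ∃ i, p.2 ∈ T.X i p.1}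

/-- The map sending a family `f` to `∑ x f(x)`. -/
def xsum (l : L) (V : GrModule A) : (T.XIdx l →₀ V.carrier) →ₗ[k] V.carrier :=
  Finsupp.lsum k fun p => V.act p.1.2

/-- The families `f` with `f(x) ∈ 1_t V` for all `x ∈ X(i,t)`. -/
def xsub (l : L) (V : GrModule A) : Submodule k (T.XIdx l →₀ V.carrier) where
  carrier := {f | ∀ p, V.act (A.one p.1.1) (f p) = f p}
  add_mem' h h' p := by rw [Finsupp.add_apply, map_add, h, h']
  zero_mem' p := by simp
  smul_mem' c f h p := by rw [Finsupp.smul_apply, map_smul, h]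

/-- Every vector is uniquely of the form `∑ x f(x)`. -/
def IsXFree (l : L) (V : GrModule A) : Prop :=
  Function.Bijective (T.xsum l V ∘ₗ (T.xsub l V).subtype)

/-- The special idempotents of weight not above `l` annihilate `V`. -/
def Supp (l : L) (V : GrModule A) : Prop :=
  ∀ s : T.S, ¬ l ≤ T.wt s → V.act (A.one s) = 0

variable {T} {l : L}

theorem xsum_single (V : GrModule A) (p : T.XIdx l) (v : V.carrier) :
    T.xsum l V (Finsupp.single p v) = V.act p.1.2 v := by
  simp [xsum]

theorem single_mem_xsub {V : GrModule A} (p : T.XIdx l) {v : V.carrier}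
    (h : V.act (A.one p.1.1) v = v) : Finsupp.single p v ∈ T.xsub l V := fun q => by
  classical
  rw [Finsupp.single_apply]
  split_ifs with h'
  · rw [← h', h]
  · rw [map_zero]

/-! ### Naturality of the X-decomposition -/

theorem xsum_mapRange {V W : GrModule A} (f : V ⟶ W) (g : T.XIdx l →₀ V.carrier) :
    T.xsum l W (Finsupp.mapRange.linearMap (lin f) g) = lin f (T.xsum l V g) := by
  induction g using Finsupp.induction_linear with
  | zero => simp
  | add g g' h h' => rw [map_add, map_add, h, h', map_add, map_add]
  | single p v =>
    rw [Finsupp.mapRange.linearMap_apply, Finsupp.mapRange_single, xsum_single, xsum_single,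
      lin_act]

theorem mapRange_mem_xsub {V W : GrModule A} (f : V ⟶ W) {g : T.XIdx l →₀ V.carrier}
    (hg : g ∈ T.xsub l V) : Finsupp.mapRange.linearMap (lin f) g ∈ T.xsub l W := fun p => by
  rw [Finsupp.mapRange.linearMap_apply, Finsupp.mapRange_apply, ← lin_act, hg p]

theorem IsXFree.eq_zero {V : GrModule A} (h : T.IsXFree l V) {f : T.XIdx l →₀ V.carrier}
    (hf : f ∈ T.xsub l V) (hf' : T.xsum l V f = 0) : f = 0 :=
  congrArg Subtype.val (h.1 (a₁ := ⟨f, hf⟩) (a₂ := 0) (by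
    rw [map_zero]
    exact hf'))

/-- Kernels of epimorphisms between `X`-free modules are `X`-free. -/
theorem IsXFree.of_shortExact {S : ShortComplex (GrModule A)} (hS : S.ShortExact)
    (h2 : T.IsXFree l S.X₂) (h3 : T.IsXFree l S.X₃) : T.IsXFree l S.X₁ := by
  obtain ⟨i1, i2, i3⟩ := (shortExact_iff S).1 hS
  constructor
  · rw [injective_iff_map_eq_zero]
    rintro ⟨g, hg⟩ h0
    have h : Finsupp.mapRange.linearMap (lin S.f) g = 0 := h2.eq_zero (mapRange_mem_xsub _ hg)
      (by rw [xsum_mapRange, show T.xsum l S.X₁ g = 0 from h0, map_zero])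
    refine Subtype.ext (Finsupp.ext fun p => i1 ?_)
    have := DFunLike.congr_fun h p
    rw [Finsupp.mapRange.linearMap_apply, Finsupp.mapRange_apply] at this
    exact this.trans (map_zero _).symm
  · intro v
    obtain ⟨⟨g, hg⟩, hv⟩ := h2.2 (lin S.f v)
    change T.xsum l S.X₂ g = lin S.f v at hv
    have h : Finsupp.mapRange.linearMap (lin S.g) g = 0 := h3.eq_zero (mapRange_mem_xsub _ hg)
      (by rw [xsum_mapRange, hv, lin_comp_zero])
    have h' : ∀ p, ∃ w, lin S.f w = g p := fun p => i3 _ (by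
      have := DFunLike.congr_fun h p
      rwa [Finsupp.mapRange.linearMap_apply, Finsupp.mapRange_apply] at this)
    choose w hw using h'
    -- The coordinatewise preimages have finite support, because injectivity of `S.f` makes the
    -- preimage of `0` equal to `0`.
    let g' : T.XIdx l →₀ S.X₁.carrier := Finsupp.onFinset g.support w fun p hp => by
      rw [Finsupp.mem_support_iff]
      intro h0
      exact hp (i1 (by rw [hw, h0, map_zero]))
    have hg' : Finsupp.mapRange.linearMap (lin S.f) g' = g := Finsupp.ext fun p => by
      rw [Finsupp.mapRange.linearMap_apply, Finsupp.mapRange_apply]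
      exact hw p
    refine ⟨⟨g', fun p => i1 ?_⟩, i1 ?_⟩
    · rw [lin_act, show lin S.f (g' p) = g p from hw p, hg]
    · change lin S.f (T.xsum l S.X₁ g') = _
      rw [← xsum_mapRange, hg', hv]

theorem IsXFree.induction {V : GrModule A} (hV : T.IsXFree l V) {p : V.carrier → Prop}
    (h0 : p 0) (hadd : ∀ x y, p x → p y → p (x + y))
    (h : ∀ i (t : T.S) x v, T.wt t = l → x ∈ T.X i t → V.act (A.one t) v = v → p (V.act x v))
    (v : V.carrier) : p v := by
  obtain ⟨⟨g, hg⟩, rfl⟩ := hV.2 v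
  change p (T.xsum l V g)
  rw [xsum, Finsupp.lsum_apply]
  refine Finset.sum_induction _ p hadd h0 fun q _ => ?_
  obtain ⟨i, hi⟩ := q.2.2
  exact h i q.1.1 q.1.2 (g q) q.2.1 hi (hg q)

/-- If `1_s` does not kill a generating vector `xv`, then `x ∈ X(s,t)` with `t` of weight `l`, and
such an `x` exists only when `l ≤ T.wt s`. -/
theorem IsXFree.supp {V : GrModule A} (hV : T.IsXFree l V) : T.Supp l V := by
  intro s hs
  refine LinearMap.ext fun v => ?_
  change V.act (A.one s) v = 0
  induction v using hV.induction with
  | h0 => simp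
  | hadd x y hx hy => rw [map_add, hx, hy, add_zero]
  | h i t x v ht hx hv =>
    rw [← V.act_mul]
    by_cases his : (s : I) = i
    · subst his
      exact absurd (ht ▸ wt_le_of_X hx) hs
    · rw [← one_mul_X hx, ← mul_assoc, A.one_orth _ _ his, zero_mul, map_zero,
        LinearMap.zero_apply]

theorem act_lower {V : GrModule A} (h : ∀ s : T.S, T.wt s < l → V.act (A.one s) = 0)
    {c : A.carrier} (hc : c ∈ T.lower l) : V.act c = 0 := by
  obtain ⟨u, hu, a, b, ha, hb, rfl⟩ := hc
  ext v
  rw [← hb, V.act_mul, V.act_mul, h u hu, LinearMap.zero_apply, map_zero, LinearMap.zero_apply]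

theorem Supp.lt {V : GrModule A} (h : T.Supp l V) (s : T.S) (hs : T.wt s < l) :
    V.act (A.one s) = 0 :=
  h s hs.not_ge

/-- Morphisms from an `X`-free module are determined by their restriction to `e_l V`. -/
theorem IsXFree.exists_hom {V E : GrModule A} (hV : T.IsXFree l V)
    (hE : ∀ s : T.S, T.wt s < l → E.act (A.one s) = 0) (f : V.carrier →ₗ[k] E.carrier)
    (h1 : ∀ (s t : T.S) a v, T.wt s = l → T.wt t = l → A.one s * a = a → a * A.one t = a →
      V.act (A.one t) v = v → f (V.act a v) = E.act a (f v))
    (h2 : ∀ (t : T.S) n v, T.wt t = l → v ∈ V.deg n → V.act (A.one t) v = v → f v ∈ E.deg n) :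
    ∃ F : V ⟶ E, ∀ (t : T.S) v, T.wt t = l → V.act (A.one t) v = v → lin F v = f v := by
  let e := LinearEquiv.ofBijective _ hV
  -- The extension is forced: a vector `∑ x v_x` must go to `∑ x f(v_x)`.
  let F : V.carrier →ₗ[k] E.carrier := T.xsum l E ∘ₗ Finsupp.mapRange.linearMap f ∘ₗ
    (T.xsub l V).subtype ∘ₗ e.symm.toLinearMap
  have hF : ∀ i (t : T.S) x v, T.wt t = l → x ∈ T.X i t → V.act (A.one t) v = v →
      F (V.act x v) = E.act x (f v) := by
    intro i t x v ht hx hv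
    let p : T.XIdx l := ⟨(t, x), ht, i, hx⟩
    have : e ⟨Finsupp.single p v, single_mem_xsub p hv⟩ = V.act x v := xsum_single V p v
    rw [← this]
    simp only [F, LinearMap.comp_apply, LinearEquiv.coe_coe, LinearEquiv.symm_apply_apply,
      Submodule.subtype_apply, Finsupp.mapRange.linearMap_apply, Finsupp.mapRange_single,
      xsum_single]
    rfl
  -- Straightening `c` into terms `xh` reduces the claim to linearity of `f` under `h`; the terms
  -- through smaller weights act by zero on both modules.
  have hF' : ∀ (t : T.S) c v, T.wt t = l → c * A.one t = c → V.act (A.one t) v = v →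
      F (V.act c v) = E.act c (f v) := by
    intro t c v ht hc hv
    have := right_expand hc
    clear hc
    induction this using Submodule.span_induction with
    | mem c hc =>
      rcases hc with ⟨i, s, x, hx, h, hh, rfl⟩ | hc
      · have hs : T.wt s = l := (wt_eq_of_H hh).trans ht
        rw [V.act_mul, hF i s x _ hs hx (act_one_act (one_mul_H hh) v),
          h1 s t h v hs ht (one_mul_H hh) (H_mul_one hh) hv, E.act_mul]
      · rw [act_lower hV.supp.lt (ht ▸ hc), act_lower hE (ht ▸ hc)]
        simp
    | zero => simp
    | add c c' _ _ h h' => rw [map_add, map_add, LinearMap.add_apply, LinearMap.add_apply,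
        map_add, h, h']
    | smul r c _ h => rw [map_smul, map_smul, LinearMap.smul_apply, LinearMap.smul_apply,
        map_smul, h]
  refine ⟨ofLin F (fun a v => ?_) (fun n v hv => ?_), fun t v ht hv => ?_⟩
  · induction v using hV.induction with
    | h0 => simp
    | hadd x y hx hy => simp only [map_add, hx, hy]
    | h i t x v ht hx hv =>
      rw [← V.act_mul, hF' t _ v ht (by rw [mul_assoc, X_mul_one hx]) hv, E.act_mul,
        hF i t x v ht hx hv]
  -- Commuting with the degree projections, unlike preserving degrees, can be tested on the
  -- generating vectors `xv` without knowing that these are homogeneous.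
  · have : ∀ v : V.carrier, F (homComp V.internal n v) = homComp E.internal n (F v) := by
      intro v
      induction v using hV.induction with
      | h0 => simp
      | hadd x y hx hy => simp only [map_add, hx, hy]
      | h i t x v ht hx hv =>
        obtain ⟨p, hp⟩ := T.X_homogeneous i t x hx
        have hv' : ∀ m, V.act (A.one t) (homComp V.internal m v) = homComp V.internal m v := by
          intro m
          have := homComp_act (A.one_mem t) m v
          rw [hv, sub_zero] at this
          exact this.symm
        have hfv : ∀ m, f (homComp V.internal m v) = homComp E.internal m (f v) := by
          intro m
          obtain ⟨s, hs⟩ := exists_sum_homComp V.internal v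
          have hm : homComp E.internal m (f v) =
              ∑ n ∈ s, homComp E.internal m (f (homComp V.internal n v)) := by
            conv_lhs => rw [hs, map_sum, map_sum]
          have hm' : f (homComp V.internal m v) =
              ∑ n ∈ s, f (homComp V.internal m (homComp V.internal n v)) := by
            conv_lhs => rw [hs, map_sum, map_sum]
          rw [hm, hm']
          refine Finset.sum_congr rfl fun n _ => ?_
          have hE := h2 t n _ ht (homComp_mem V.internal n v) (hv' n)
          by_cases hnm : n = m
          · subst hnm
            rw [homComp_same _ hE, homComp_same _ (homComp_mem _ _ _)]
          · rw [homComp_ne _ hnm hE, homComp_ne _ hnm (homComp_mem _ _ _), map_zero]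
        rw [homComp_act hp, hF i t x _ ht hx (hv' _), hF i t x v ht hx hv, homComp_act hp, hfv]
    rw [← homComp_same V.internal hv, this]
    exact homComp_mem _ _ _
  · have := hF t t (A.one t) v ht (one_mem_X t) hv
    rw [hv] at this
    have h3 := h1 t t (A.one t) v ht ht (A.one_mul_one t) (A.one_mul_one t) hv
    rw [hv] at h3
    exact this.trans h3.symm

/-! ### Layers -/

variable (T) in
/-- A module with a homogeneous basis consisting of the vectors `xhz`, for `x ∈ X(i,t)`,
`h ∈ H(t,u)` with `u` of weight `l`, and generators `z`. -/
structure Layer (l : L) (V : GrModule A) where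
  index : Type w'
  gen : index → V.carrier
  vertex : index → T.S
  degree : index → ℤ
  wt_vertex : ∀ c, T.wt (vertex c) = l
  one_gen : ∀ c, V.act (A.one (vertex c)) (gen c) = gen c
  gen_mem : ∀ c, gen c ∈ V.deg (degree c)
  vanish : ∀ s : T.S, T.wt s < l → V.act (A.one s) = 0
  linearIndependent : LinearIndependent k
    (fun p : {p : index × A.carrier × A.carrier //
        ∃ i t, p.2.1 ∈ T.X i t ∧ p.2.2 ∈ T.H t (vertex p.1)} =>
      V.act (p.1.2.1 * p.1.2.2) (gen p.1.1))
  span_eq_top : Submodule.span k {a | ∃ c i t, ∃ x ∈ T.X i t, ∃ h ∈ T.H t (vertex c),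
    a = V.act (x * h) (gen c)} = ⊤

namespace Layer

variable {V : GrModule A} (B : T.Layer l V)

/-- The index set of the basis. -/
abbrev Idx := {p : B.index × A.carrier × A.carrier //
        ∃ i t, p.2.1 ∈ T.X i t ∧ p.2.2 ∈ T.H t (B.vertex p.1)}

/-- The basis of a layer. -/
def toBasis : Module.Basis B.Idx k V.carrier :=
  Module.Basis.mk B.linearIndependent (by
    rw [← B.span_eq_top]
    refine Submodule.span_mono ?_
    rintro _ ⟨c, i, t, x, hx, h, hh, rfl⟩
    exact ⟨⟨(c, x, h), i, t, hx, hh⟩, rfl⟩)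

theorem toBasis_apply (p : B.Idx) : B.toBasis p = V.act (p.1.2.1 * p.1.2.2) (B.gen p.1.1) :=
  Module.Basis.mk_apply _ _ p

include B in
theorem induction {p : V.carrier → Prop}
    (h0 : p 0) (hadd : ∀ x y, p x → p y → p (x + y)) (hsmul : ∀ (r : k) x, p x → p (r • x))
    (h : ∀ c i (t : T.S) x h, x ∈ T.X i t → h ∈ T.H t (B.vertex c) →
      p (V.act (x * h) (B.gen c)))
    (v : V.carrier) : p v := by
  have hv : v ∈ Submodule.span k {a | ∃ c i t, ∃ x ∈ T.X i t, ∃ h ∈ T.H t (B.vertex c),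
    a = V.act (x * h) (B.gen c)} := by rw [B.span_eq_top]; trivial
  induction hv using Submodule.span_induction with
  | mem v hv =>
    obtain ⟨c, i, t, x, hx, h', hh, rfl⟩ := hv
    exact h c i t x h' hx hh
  | zero => exact h0
  | add x y _ _ hx hy => exact hadd x y hx hy
  | smul r x _ hx => exact hsmul r x hx

/-- Between vertices of weight `l` the only element of X is the idempotent, so `1_t` kills a
spanning vector `xhz` unless `x = 1_t`. -/
theorem mem_span {t : T.S} (ht : T.wt t = l) {v : V.carrier} (hv : V.act (A.one t) v = v) :
    v ∈ Submodule.span k {w | ∃ c, ∃ h ∈ T.H t (B.vertex c), w = V.act h (B.gen c)} := by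
  have : ∀ v, V.act (A.one t) v ∈
      Submodule.span k {w | ∃ c, ∃ h ∈ T.H t (B.vertex c), w = V.act h (B.gen c)} := by
    intro v
    induction v using B.induction with
    | h0 => simp
    | hadd x y hx hy => rw [map_add]; exact add_mem hx hy
    | hsmul r x hx => rw [map_smul]; exact Submodule.smul_mem _ r hx
    | h c i s x h hx hh =>
      rw [← V.act_mul, ← mul_assoc]
      by_cases hti : (t : I) = i
      · subst hti
        have hst : t = s := by
          by_contra hne
          have := T.X_lt t s hne ⟨x, hx⟩
          rw [wt_eq_of_H hh, B.wt_vertex, ht] at this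
          exact lt_irrefl _ this
        subst hst
        rw [T.X_self] at hx
        rw [Set.mem_singleton_iff.1 hx, A.one_mul_one, one_mul_H hh]
        exact Submodule.subset_span ⟨c, h, hh, rfl⟩
      · rw [← one_mul_X hx, ← mul_assoc, A.one_orth _ _ hti, zero_mul, zero_mul, map_zero,
          LinearMap.zero_apply]
        exact zero_mem _
  rw [← hv]
  exact this v

-- The X-decomposition groups the basis vectors `xhz` by `x`; it works because the vectors `hz` with
-- `h` starting at `t` span `1_t V`.
include B in
theorem isXFree : T.IsXFree l V := by
  constructor
  · choose i t hi ht using fun p : B.Idx => p.2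
    -- The left inverse of `∑ x f(x)` places `hz` at the index `x` for each basis vector `xhz`.
    let r : V.carrier →ₗ[k] (T.XIdx l →₀ V.carrier) := B.toBasis.constr k fun p =>
      Finsupp.single ⟨(t p, p.1.2.1), (wt_eq_of_H (ht p)).trans (B.wt_vertex _), i p, hi p⟩
        (V.act p.1.2.2 (B.gen p.1.1))
    have hr : ∀ (q : T.XIdx l) v, V.act (A.one q.1.1) v = v →
        r (V.act q.1.2 v) = Finsupp.single q v := by
      intro q v hv
      have := B.mem_span q.2.1 hv
      clear hv
      induction this using Submodule.span_induction with
      | mem v hv =>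
        obtain ⟨c, h, hh, rfl⟩ := hv
        obtain ⟨j, hj⟩ := q.2.2
        let p : B.Idx := ⟨(c, q.1.2, h), j, q.1.1, hj, hh⟩
        rw [← V.act_mul, show V.act (q.1.2 * h) (B.gen c) = B.toBasis p from
          (B.toBasis_apply p).symm, Module.Basis.constr_basis]
        congr 1
        exact Subtype.ext (Prod.ext (eq_of_mem_H (ht p) hh).1 rfl)
      | zero => simp
      | add x y _ _ hx hy => rw [map_add, map_add, hx, hy, Finsupp.single_add]
      | smul c x _ hx => rw [map_smul, map_smul, hx, Finsupp.smul_single]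
    have hr' : ∀ f ∈ T.xsub l V, r (T.xsum l V f) = f := by
      intro f hf
      rw [xsum, Finsupp.lsum_apply, Finsupp.sum, map_sum]
      conv_rhs => rw [← Finsupp.sum_single f]
      exact Finset.sum_congr rfl fun q _ => hr q _ (hf q)
    rintro ⟨f, hf⟩ ⟨g, hg⟩ hfg
    exact Subtype.ext ((hr' f hf).symm.trans ((congrArg r hfg).trans (hr' g hg)))
  · rw [← LinearMap.range_eq_top, eq_top_iff, ← B.span_eq_top, Submodule.span_le]
    rintro _ ⟨c, i, t, x, hx, h, hh, rfl⟩
    let p : T.XIdx l := ⟨(t, x), (wt_eq_of_H hh).trans (B.wt_vertex _), i, hx⟩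
    exact ⟨⟨Finsupp.single p (V.act h (B.gen c)),
      single_mem_xsub p (act_one_act (one_mul_H hh) _)⟩,
      (xsum_single V p _).trans (V.act_mul _ _ _).symm⟩

end Layer

end TriangularBasis

namespace TriangularBasis

open GrModule

variable {k : Type u} [Field k] {I : Type v} {A : GrAlgebra k I} {L : Type w} [PartialOrder L]
  (T : TriangularBasis A L) {l : L}

/-! ### Truncation to `A_l` -/

/-- The map `a ↦ e a e` to `A_l`. -/
def toCartan (l : L) : A.carrier →ₗ[k] (T.cartan l).carrier where
  toFun a := ⟨A.quotMk _ (T.notGeq_mem l) ((T.e l).val * a * (T.e l).val), by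
    constructor
    · refine (A.quotMk_mul _ (T.notGeq_mem l) _ _).symm.trans ?_
      rw [← mul_assoc, ← mul_assoc, (T.e l).idem]
    · refine (A.quotMk_mul _ (T.notGeq_mem l) _ _).symm.trans ?_
      rw [mul_assoc, (T.e l).idem]⟩
  map_add' a b := Subtype.ext ((congrArg (A.quotMk _ (T.notGeq_mem l))
    (by rw [mul_add, add_mul])).trans (map_add _ _ _))
  map_smul' c a := Subtype.ext ((congrArg (A.quotMk _ (T.notGeq_mem l))
    (by rw [mul_smul_comm, smul_mul_assoc, RingHom.id_apply])).trans (map_smul _ _ _))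

variable {T}

theorem toCartan_surjective : Function.Surjective (T.toCartan l) := by
  rintro ⟨x, h1, h2⟩
  obtain ⟨a, rfl⟩ := A.quotMk_surjective _ (T.notGeq_mem l) x
  refine ⟨a, Subtype.ext ?_⟩
  refine (A.quotMk_mul _ (T.notGeq_mem l) _ _).trans ?_
  refine Eq.trans ?_ h2
  exact congrArg (fun x : (T.geq l).carrier => x * (T.ebar l).val)
    ((A.quotMk_mul _ (T.notGeq_mem l) _ _).trans h1)

theorem toCartan_mul (a b : A.carrier) :
    T.toCartan l a * T.toCartan l b = T.toCartan l (a * (T.e l).val * b) := by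
  refine Subtype.ext ((A.quotMk_mul _ (T.notGeq_mem l) _ _).symm.trans ?_)
  change A.quotMk _ (T.notGeq_mem l) _ = A.quotMk _ (T.notGeq_mem l) _
  congr 1
  simp only [mul_assoc]
  rw [← mul_assoc (T.e l).val (T.e l).val, (T.e l).idem]

theorem toCartan_mul_of_one {s : T.S} (hs : T.wt s = l) {a b : A.carrier}
    (ha : a * A.one s = a) : T.toCartan l a * T.toCartan l b = T.toCartan l (a * b) := by
  rw [toCartan_mul]
  congr 2
  rw [← ha, mul_assoc, one_mul_e hs]

theorem toCartan_e_mul (a : A.carrier) : T.toCartan l ((T.e l).val * a) = T.toCartan l a := by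
  refine Subtype.ext (congrArg (A.quotMk _ (T.notGeq_mem l)) ?_)
  rw [← mul_assoc, (T.e l).idem]

theorem toCartan_mul_e (a : A.carrier) : T.toCartan l (a * (T.e l).val) = T.toCartan l a := by
  refine Subtype.ext (congrArg (A.quotMk _ (T.notGeq_mem l)) ?_)
  rw [mul_assoc, mul_assoc, (T.e l).idem, ← mul_assoc]

theorem toCartan_eq_zero {a : A.carrier} (ha : a ∈ A.ideal (T.notGeq l)) :
    T.toCartan l a = 0 :=
  Subtype.ext ((Submodule.Quotient.mk_eq_zero _).2
    (A.mul_mem_ideal _ _ (A.mul_mem_ideal _ (T.e l).val ha).1).2)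

theorem toCartan_mem {n : ℤ} {a : A.carrier} (ha : a ∈ A.deg n) :
    T.toCartan l a ∈ (T.cartan l).deg n := by
  refine A.quotMk_mem _ (T.notGeq_mem l) ?_
  have := A.mul_mem (A.mul_mem (T.e l).mem ha) (T.e l).mem
  rwa [zero_add, add_zero] at this

theorem one_toCartan_e : T.toCartan l (T.e l).val = (T.cartan l).one () := by
  refine Subtype.ext (congrArg (A.quotMk _ (T.notGeq_mem l)) ?_)
  rw [(T.e l).idem, (T.e l).idem]

theorem act_e (M : GrModule (T.cartan l)) (v : M.carrier) :
    M.act (T.toCartan l (T.e l).val) v = v := by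
  obtain ⟨s, hs⟩ := M.exists_local_unit v
  rw [one_toCartan_e]
  conv_lhs => rw [hs]
  conv_rhs => rw [hs]
  rw [map_sum]
  exact Finset.sum_congr rfl fun _ _ => act_one_act ((T.cartan l).one_mul_one ()) v

theorem e_eq_sum : (T.e l).val = ∑ s ∈ (T.fiber_finite l).toFinset, A.one s := rfl

theorem Supp.act_eq_zero {V : GrModule A} (h : T.Supp l V) : ∀ x ∈ T.notGeq l, V.act x = 0 := by
  rintro _ ⟨m, hm, rfl⟩
  rw [e_eq_sum, map_sum]
  refine Finset.sum_eq_zero fun s hs => h s ?_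
  have : T.wt s = m := by simpa using hs
  rwa [this]

variable (T l) in
/-- The `A_l`-module `e_l V`. -/
def truncAt (V : GrModule A) (h : T.Supp l V) : GrModule (T.cartan l) :=
  (T.ebar l).trunc (V.deflate (T.notGeq_mem l) h.act_eq_zero)

/-- Elements of `e_l V`. -/
def truncMk {V : GrModule A} (h : T.Supp l V) (v : V.carrier) (hv : V.act (T.e l).val v = v) :
    (T.truncAt l V h).carrier :=
  (⟨v, hv⟩ : (T.ebar l).fixed (V.deflate (T.notGeq_mem l) h.act_eq_zero))

/-- The inclusion of `e_l V`. -/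
def truncVal {V : GrModule A} (h : T.Supp l V) : (T.truncAt l V h).carrier →ₗ[k] V.carrier :=
  ((T.ebar l).fixed (V.deflate (T.notGeq_mem l) h.act_eq_zero)).subtype

theorem truncVal_injective {V : GrModule A} (h : T.Supp l V) :
    Function.Injective (truncVal h) :=
  Subtype.val_injective

theorem truncVal_truncMk {V : GrModule A} (h : T.Supp l V) (v : V.carrier)
    (hv : V.act (T.e l).val v = v) : truncVal h (truncMk h v hv) = v :=
  rfl

theorem truncVal_mem {V : GrModule A} (h : T.Supp l V) (v : (T.truncAt l V h).carrier) :
    V.act (T.e l).val (truncVal h v) = truncVal h v :=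
  v.2

theorem truncVal_act {V : GrModule A} (h : T.Supp l V) (a : A.carrier)
    (v : (T.truncAt l V h).carrier) :
    truncVal h ((T.truncAt l V h).act (T.toCartan l a) v) =
      V.act ((T.e l).val * a * (T.e l).val) (truncVal h v) :=
  rfl

theorem truncVal_deg {V : GrModule A} (h : T.Supp l V) (n : ℤ)
    (v : (T.truncAt l V h).carrier) : v ∈ (T.truncAt l V h).deg n ↔ truncVal h v ∈ V.deg n :=
  Iff.rfl

theorem truncAt_isZero {V : GrModule A} (h : T.Supp l V)
    (h' : ∀ s : T.S, T.wt s = l → V.act (A.one s) = 0) : IsZero (T.truncAt l V h) := by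
  refine isZero_of_forall_eq_zero fun v => truncVal_injective h ?_
  rw [map_zero, ← truncVal_mem h v, e_eq_sum, map_sum, LinearMap.sum_apply]
  refine Finset.sum_eq_zero fun s hs => ?_
  rw [h' s (by simpa using hs), LinearMap.zero_apply]

/-- An idempotent killing both ends of an extension has square zero on the middle term, hence is
zero there. -/
theorem Supp.middle {S : ShortComplex (GrModule A)} (hS : S.ShortExact) (h1 : T.Supp l S.X₁)
    (h3 : T.Supp l S.X₃) : T.Supp l S.X₂ := fun s hs => by
  obtain ⟨i1, i2, i3⟩ := (shortExact_iff S).1 hS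
  refine LinearMap.ext fun v => ?_
  obtain ⟨w, hw⟩ := i3 (S.X₂.act (A.one s) v) (by rw [lin_act, h3 s hs]; rfl)
  rw [← act_one_act (A.one_mul_one s), ← hw, ← lin_act, h1 s hs]
  simp

theorem truncAt_shortExact {S : ShortComplex (GrModule A)} (hS : S.ShortExact)
    (h1 : T.Supp l S.X₁) (h2 : T.Supp l S.X₂) (h3 : T.Supp l S.X₃) :
    ∃ S' : ShortComplex (GrModule (T.cartan l)), S'.ShortExact ∧ S'.X₁ = T.truncAt l S.X₁ h1 ∧
      S'.X₂ = T.truncAt l S.X₂ h2 ∧ S'.X₃ = T.truncAt l S.X₃ h3 :=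
  ⟨_, GrAlgebra.Idem.shortExact_trunc (e := T.ebar l)
    (shortExact_deflate (hE := T.notGeq_mem l) hS h1.act_eq_zero h2.act_eq_zero h3.act_eq_zero),
    rfl, rfl, rfl⟩

/-! ### Layers have projective truncations -/

namespace Layer

variable {V : GrModule A} (B : T.Layer l V)

-- The generators `z` behave like free generators of `e_l V` over `A_l`, each placed at the
-- idempotent of its vertex: the basis leaves no relation beyond `1_u z = z`. A lift is therefore
-- given by homogeneous preimages of the images of the `z`.
include B in
theorem truncAt_projective (hV : T.Supp l V) : Projective (T.truncAt l V hV) where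
  factors {E X} f e _ := by
    have hs := surjective_of_epi e
    have hg : ∀ c, V.act (T.e l).val (B.gen c) = B.gen c := fun c => by
      rw [← B.one_gen c, ← V.act_mul, e_mul_one (B.wt_vertex c)]
    let z : ∀ c, (T.truncAt l V hV).carrier := fun c => truncMk hV (B.gen c) (hg c)
    choose x hx hx' using fun c => exists_deg_of_surjective hs
      (lin_deg f ((truncVal_deg hV _ (z c)).2 (B.gen_mem c)))
    -- The lift is first defined on all of `V`, where the basis is available; only its restriction
    -- to `e_l V` is kept.
    let r : V.carrier →ₗ[k] E.carrier := B.toBasis.constr k fun p =>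
      E.act (T.toCartan l (p.1.2.1 * p.1.2.2)) (x p.1.1)
    have hr₀ : ∀ c i (t : T.S) x' h, x' ∈ T.X i t → h ∈ T.H t (B.vertex c) →
        r (V.act (x' * h) (B.gen c)) = E.act (T.toCartan l (x' * h)) (x c) := by
      intro c i t x' h hx hh
      let p : B.Idx := ⟨(c, x', h), i, t, hx, hh⟩
      rw [show V.act (x' * h) (B.gen c) = B.toBasis p from (B.toBasis_apply p).symm]
      exact Module.Basis.constr_basis _ _ _ p
    have hr : ∀ c a, a * A.one (B.vertex c) = a →
        r (V.act a (B.gen c)) = E.act (T.toCartan l a) (x c) := by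
      intro c a ha
      have := right_expand ha
      clear ha
      induction this using Submodule.span_induction with
      | mem a ha =>
        rcases ha with ⟨i, s, x', hx, h, hh, rfl⟩ | ha
        · exact hr₀ c i s x' h hx hh
        · rw [B.wt_vertex] at ha
          rw [act_lower B.vanish ha, toCartan_eq_zero (lower_subset_ideal ha)]
          simp
      | zero => simp
      | add a b _ _ ha hb => simp only [map_add, LinearMap.add_apply, ha, hb]
      | smul c a _ ha => simp only [map_smul, LinearMap.smul_apply, ha]
    let F : T.truncAt l V hV ⟶ E := ofLin (r ∘ₗ truncVal hV)
      (fun a v => by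
        obtain ⟨a, rfl⟩ := toCartan_surjective a
        rw [LinearMap.comp_apply, LinearMap.comp_apply, truncVal_act]
        generalize truncVal hV v = v
        induction v using B.induction with
        | h0 => simp
        | hadd x y hx hy => simp only [map_add, hx, hy]
        | hsmul c x hx => simp only [map_smul, hx]
        | h c i t x' h hx hh =>
          rw [hr₀ c i t x' h hx hh, ← V.act_mul, hr c _ (by
              rw [mul_assoc, mul_assoc x' h, H_mul_one hh]),
            ← E.act_mul, toCartan_mul, mul_assoc, mul_assoc, toCartan_e_mul, ← mul_assoc])
      (fun n v hv => by
        have key : ∀ v : V.carrier, r (homComp V.internal n v) = homComp E.internal n (r v) := by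
          intro v
          induction v using B.induction with
          | h0 => simp
          | hadd x y hx hy => simp only [map_add, hx, hy]
          | hsmul c x hx => simp only [map_smul, hx]
          | h c i t x' h hx₀ hh =>
            obtain ⟨p, hp⟩ := T.X_homogeneous i t x' hx₀
            obtain ⟨q, hq⟩ := T.H_homogeneous t _ h hh
            have h1 := V.act_mem (A.mul_mem hp hq) (B.gen_mem c)
            have h2 := E.act_mem (toCartan_mem (T := T) (l := l) (A.mul_mem hp hq)) (hx c)
            rw [← hr₀ c i t x' h hx₀ hh] at h2
            by_cases hn : p + q + B.degree c = n
            · subst hn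
              rw [homComp_same _ h1, homComp_same _ h2]
            · rw [homComp_ne _ hn h1, homComp_ne _ hn h2, map_zero]
        have h1 := key (truncVal hV v)
        have hv' : truncVal hV v ∈ V.deg n := hv
        rw [homComp_same V.internal hv'] at h1
        change r (truncVal hV v) ∈ _
        rw [h1]
        exact homComp_mem _ _ _)
    refine ⟨F, ?_⟩
    ext v
    rw [lin_comp, LinearMap.comp_apply]
    -- Replacing `w` by `e_l w` on the right makes sense of the identity on basis vectors that do
    -- not lie in `e_l V`, so it can be checked there.
    have key : ∀ w : V.carrier, ∀ hw, lin e (r w) = lin f (truncMk hV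
        (V.act (T.e l).val w) hw) := by
      intro w
      induction w using B.induction with
      | h0 =>
        intro hw
        have : truncMk hV (V.act (T.e l).val 0) hw = 0 := truncVal_injective hV (by
          rw [truncVal_truncMk, map_zero, map_zero])
        rw [this]
        simp
      | hadd x y hx hy =>
        intro hw
        have he : ∀ x, V.act (T.e l).val (V.act (T.e l).val x) = V.act (T.e l).val x := fun x => by
          rw [← V.act_mul, (T.e l).idem]
        have : truncMk hV (V.act (T.e l).val (x + y)) hw =
            truncMk hV _ (he x) + truncMk hV _ (he y) := truncVal_injective hV (by
          exact (map_add (V.act (T.e l).val) x y).trans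
            (map_add (truncVal hV) (truncMk hV _ (he x)) (truncMk hV _ (he y))).symm)
        rw [this, map_add, map_add, map_add, hx, hy]
      | hsmul c x hx =>
        intro hw
        have he : ∀ x, V.act (T.e l).val (V.act (T.e l).val x) = V.act (T.e l).val x := fun x => by
          rw [← V.act_mul, (T.e l).idem]
        have : truncMk hV (V.act (T.e l).val (c • x)) hw =
            c • truncMk hV _ (he x) := truncVal_injective hV (by
          exact (map_smul (V.act (T.e l).val) c x).trans
            (map_smul (truncVal hV) c (truncMk hV _ (he x))).symm)
        rw [this, map_smul, map_smul, map_smul, hx]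
      | h c i t x' h hx₀ hh =>
        intro hw
        rw [hr₀ c i t x' h hx₀ hh, lin_act, hx', ← lin_act]
        refine congrArg (lin f) (truncVal_injective hV ?_)
        rw [truncVal_act, truncVal_truncMk, truncVal_truncMk, V.act_mul, hg, V.act_mul]
    refine (key (truncVal hV v) (by rw [← V.act_mul, (T.e l).idem])).trans (congrArg (lin f)
      (truncVal_injective hV ?_))
    rw [truncVal_truncMk, truncVal_mem]

end Layer

end TriangularBasis

namespace TriangularBasis

open GrModule TensorProduct

variable {k : Type u} [Field k] {I : Type v} {A : GrAlgebra k I} {L : Type w} [PartialOrder L]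
  (T : TriangularBasis A L) (l : L)

/-! ### Standardization -/

/-- The map `a ↦ a e` to `A_{≥ l} e`. -/
def toLeft : A.carrier →ₗ[k] (T.ebar l).leftIdeal where
  toFun a := ⟨A.quotMk _ (T.notGeq_mem l) (a * (T.e l).val), by
    refine (A.quotMk_mul _ (T.notGeq_mem l) _ _).symm.trans ?_
    rw [mul_assoc, (T.e l).idem]⟩
  map_add' a b := Subtype.ext ((congrArg (A.quotMk _ (T.notGeq_mem l))
    (add_mul a b _)).trans (map_add _ _ _))
  map_smul' c a := Subtype.ext ((congrArg (A.quotMk _ (T.notGeq_mem l))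
    (smul_mul_assoc c a _)).trans (map_smul _ _ _))

/-- The map `(a, v) ↦ a ⊗ v`. -/
def stdMk (M : GrModule (T.cartan l)) : A.carrier →ₗ[k] M.carrier →ₗ[k] (T.std l M).carrier :=
  (TensorProduct.mk k (T.ebar l).leftIdeal M.carrier).compr₂ ((T.ebar l).tensorRel M).mkQ ∘ₗ
    T.toLeft l

variable {T l} {M : GrModule (T.cartan l)}

theorem toLeft_surjective : Function.Surjective (T.toLeft l) := by
  rintro ⟨x, h⟩
  obtain ⟨a, rfl⟩ := A.quotMk_surjective _ (T.notGeq_mem l) x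
  exact ⟨a, Subtype.ext ((A.quotMk_mul _ (T.notGeq_mem l) _ _).trans h)⟩

theorem act_stdMk (c a : A.carrier) (v : M.carrier) :
    (T.std l M).act c (T.stdMk l M a v) = T.stdMk l M (c * a) v := by
  have : (T.ebar l).lmul (A.quotMk _ (T.notGeq_mem l) c) (T.toLeft l a) = T.toLeft l (c * a) :=
    Subtype.ext ((A.quotMk_mul _ (T.notGeq_mem l) _ _).symm.trans
      (congrArg _ (mul_assoc c a _).symm))
  exact congrArg (fun z => ((T.ebar l).tensorRel M).mkQ (z ⊗ₜ[k] v)) this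

/-- This is the relation `xh ⊗ v = x ⊗ hv` for `x = ae` and `h = ebe`. -/
theorem stdMk_mul_e_mul (a b : A.carrier) (v : M.carrier) :
    T.stdMk l M (a * (T.e l).val * b) v = T.stdMk l M a (M.act (T.toCartan l b) v) := by
  have h : (T.ebar l).mulCorner (T.toLeft l a) (T.toCartan l b) =
      T.toLeft l (a * (T.e l).val * b) := by
    refine Subtype.ext ((A.quotMk_mul _ (T.notGeq_mem l) _ _).symm.trans (congrArg _ ?_))
    simp only [mul_assoc]
    rw [← mul_assoc (T.e l).val (T.e l).val, (T.e l).idem]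
  have h2 : (T.toLeft l (a * (T.e l).val * b) ⊗ₜ[k] v -
      T.toLeft l a ⊗ₜ[k] M.act (T.toCartan l b) v : (T.ebar l).leftIdeal ⊗[k] M.carrier) ∈
      (T.ebar l).tensorRel M := Submodule.subset_span ⟨T.toLeft l a, T.toCartan l b, v,
        congrArg (fun z => z ⊗ₜ[k] v - T.toLeft l a ⊗ₜ[k] M.act (T.toCartan l b) v) h.symm⟩
  exact (Submodule.Quotient.eq _).2 h2

theorem stdMk_mul_e (a : A.carrier) (v : M.carrier) :
    T.stdMk l M (a * (T.e l).val) v = T.stdMk l M a v := by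
  have : T.toLeft l (a * (T.e l).val) = T.toLeft l a := Subtype.ext
    (congrArg (A.quotMk _ (T.notGeq_mem l)) (by rw [mul_assoc, (T.e l).idem]))
  exact congrArg (fun z => ((T.ebar l).tensorRel M).mkQ (z ⊗ₜ[k] v)) this

theorem stdMk_one_mul {t : T.S} (ht : T.wt t = l) (b : A.carrier) (v : M.carrier) :
    T.stdMk l M (A.one t * b) v = T.stdMk l M (A.one t) (M.act (T.toCartan l b) v) := by
  rw [← stdMk_mul_e_mul, one_mul_e ht]

theorem std_induction {p : (T.std l M).carrier → Prop} (h0 : p 0)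
    (hadd : ∀ x y, p x → p y → p (x + y)) (h : ∀ a v, p (T.stdMk l M a v))
    (x : (T.std l M).carrier) : p x := by
  obtain ⟨x, rfl⟩ := ((T.ebar l).tensorRel M).mkQ_surjective x
  induction x using TensorProduct.induction_on with
  | zero => rw [map_zero]; exact h0
  | tmul x v =>
    obtain ⟨a, rfl⟩ := toLeft_surjective x
    exact h a v
  | add x y hx hy => rw [map_add]; exact hadd _ _ hx hy

theorem stdMk_eq_zero {a : A.carrier} (ha : a ∈ A.ideal (T.notGeq l)) (v : M.carrier) :
    T.stdMk l M a v = 0 := by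
  have : T.toLeft l a = 0 :=
    Subtype.ext ((Submodule.Quotient.mk_eq_zero _).2 (A.mul_mem_ideal _ (T.e l).val ha).2)
  rw [stdMk, LinearMap.comp_apply, this, map_zero, LinearMap.zero_apply]

theorem stdMk_mem {p q : ℤ} {a : A.carrier} (ha : a ∈ A.deg p) {v : M.carrier}
    (hv : v ∈ M.deg q) : T.stdMk l M a v ∈ (T.std l M).deg (p + q) := by
  have h1 : A.quotMk _ (T.notGeq_mem l) (a * (T.e l).val) ∈ (T.geq l).deg p := by
    refine A.quotMk_mem _ (T.notGeq_mem l) ?_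
    have := A.mul_mem ha (T.e l).mem
    rwa [add_zero] at this
  have h2 : (T.toLeft l a ⊗ₜ[k] v : (T.ebar l).leftIdeal ⊗[k] M.carrier) ∈
      tensorDeg (fun n => ((T.geq l).deg n).comap (T.ebar l).leftIdeal.subtype) M.deg (p + q) :=
    Submodule.subset_span ⟨p, q, rfl, T.toLeft l a, h1, v, hv, rfl⟩
  exact Submodule.mem_map_of_mem (f := ((T.ebar l).tensorRel M).mkQ) h2

/-! #### Coefficients -/

variable (T l) in
/-- The coefficients of `a` with respect to the basis `X` of `A_{≥ l} e` over `A_l`. -/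
def coeffs : A.carrier →ₗ[k] (T.XIdx l →₀ (T.cartan l).carrier) :=
  open Classical in
  T.toBasis.constr k fun p =>
    -- The vertices of a basis vector are merely known to exist, but its nonzero middle factor
    -- determines them, so the choice is immaterial. Basis vectors of weight other than `l` are sent
    -- to zero.
    if h : T.wt p.2.choose_spec.choose_spec.choose = l then
      Finsupp.single ⟨(p.2.choose_spec.choose, p.1.1),
        (wt_eq_of_H p.2.choose_spec.choose_spec.choose_spec.choose_spec.2.1).trans h, _,
        p.2.choose_spec.choose_spec.choose_spec.choose_spec.1⟩ (T.toCartan l (p.1.2.1 * p.1.2.2))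
    else 0

theorem coeffs_apply {i j : I} {s t : T.S} {x h y : A.carrier} (hx : x ∈ T.X i s)
    (hh : h ∈ T.H s t) (hy : y ∈ T.Y t j) (ht : T.wt t = l) (hs : T.wt s = l) :
    T.coeffs l (x * h * y) = Finsupp.single ⟨(s, x), hs, i, hx⟩ (T.toCartan l (h * y)) := by
  let p : T.Idx := ⟨(x, h, y), i, s, t, j, hx, hh, hy⟩
  have hst := eq_of_mem_H (T := T) (h := h)
    p.2.choose_spec.choose_spec.choose_spec.choose_spec.2.1 hh
  rw [show x * h * y = T.toBasis p from (T.toBasis_apply p).symm, coeffs,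
    Module.Basis.constr_basis, dif_pos (by rw [hst.2]; exact ht)]
  congr 1
  exact Subtype.ext (Prod.ext hst.1 rfl)

theorem coeffs_apply_ne {i j : I} {s t : T.S} {x h y : A.carrier} (hx : x ∈ T.X i s)
    (hh : h ∈ T.H s t) (hy : y ∈ T.Y t j) (ht : T.wt t ≠ l) :
    T.coeffs l (x * h * y) = 0 := by
  let p : T.Idx := ⟨(x, h, y), i, s, t, j, hx, hh, hy⟩
  have hst := eq_of_mem_H (T := T) (h := h)
    p.2.choose_spec.choose_spec.choose_spec.choose_spec.2.1 hh
  rw [show x * h * y = T.toBasis p from (T.toBasis_apply p).symm, coeffs,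
    Module.Basis.constr_basis, dif_neg (by rw [hst.2]; exact ht)]

/-- By `ideal_le_spanOf` the ideal involves only basis vectors of weights not above `l`, hence none
of weight `l`. -/
theorem coeffs_eq_zero {a : A.carrier} (ha : a ∈ A.ideal (T.notGeq l)) : T.coeffs l a = 0 := by
  have := ideal_le_spanOf T l ha
  clear ha
  induction this using Submodule.span_induction with
  | mem a ha =>
    obtain ⟨i, s, t, j, ht, x, hx, h, hh, y, hy, rfl⟩ := ha
    exact coeffs_apply_ne hx hh hy fun h => ht h.ge
  | zero => simp
  | add a b _ _ ha hb => rw [map_add, ha, hb, add_zero]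
  | smul c a _ ha => rw [map_smul, ha, smul_zero]

/-- Straightening `m` into terms `hy` turns `xm` into genuine basis vectors `xhy` of weight `l`; the
other terms lie in the ideal, where both sides vanish. -/
theorem coeffs_X_mul (p : T.XIdx l) {m : A.carrier} (hm : A.one p.1.1 * m = m) :
    T.coeffs l (p.1.2 * m) = Finsupp.single p (T.toCartan l m) := by
  have ht := p.2.1
  obtain ⟨i, hx⟩ := p.2.2
  have := left_expand hm
  clear hm
  induction this using Submodule.span_induction with
  | mem m hm =>
    rcases hm with ⟨s, j, h, hh, y, hy, rfl⟩ | hm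
    · rw [← mul_assoc]
      exact coeffs_apply hx hh hy ((wt_eq_of_H hh).symm.trans ht) ht
    · have hm : m ∈ T.lower l := ht ▸ hm
      rw [toCartan_eq_zero (lower_subset_ideal hm), Finsupp.single_zero]
      exact coeffs_eq_zero (A.mul_mem_ideal _ _ (lower_subset_ideal hm)).1
  | zero => simp
  | add a b _ _ ha hb => rw [mul_add, map_add, ha, hb, map_add, Finsupp.single_add]
  | smul c a _ ha => rw [mul_smul_comm, map_smul, ha, map_smul, Finsupp.smul_single]

/-- Right `A_l`-linearity of the coefficients, which allows them to pass to the tensor product in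
`stdCoeffs`. -/
theorem coeffs_mul {s : T.S} (hs : T.wt s = l) {a : A.carrier} (ha : a * A.one s = a)
    (b : A.carrier) : T.coeffs l (a * b) = Finsupp.mapRange.linearMap
      (LinearMap.mulRight k (T.toCartan l b)) (T.coeffs l a) := by
  have := right_expand ha
  clear ha
  induction this using Submodule.span_induction with
  | mem a ha =>
    rcases ha with ⟨i, t, x, hx, h, hh, rfl⟩ | ha
    · let p : T.XIdx l := ⟨(t, x), (wt_eq_of_H hh).trans hs, i, hx⟩
      have h1 := coeffs_X_mul p (m := h) (one_mul_H hh)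
      have h2 := coeffs_X_mul p (m := h * b) (by rw [← mul_assoc, one_mul_H hh])
      change T.coeffs l (x * h) = _ at h1
      change T.coeffs l (x * (h * b)) = _ at h2
      rw [mul_assoc, h1, h2, Finsupp.mapRange.linearMap_apply, Finsupp.mapRange_single,
        LinearMap.mulRight_apply, toCartan_mul_of_one hs (H_mul_one hh)]
    · have ha : a ∈ A.ideal (T.notGeq l) := lower_subset_ideal (hs ▸ ha)
      rw [coeffs_eq_zero ha, map_zero, coeffs_eq_zero (A.mul_mem_ideal _ b ha).2]
  | zero => simp
  | add a b _ _ ha hb => rw [add_mul, map_add, ha, hb, map_add, map_add]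
  | smul c a _ ha => rw [smul_mul_assoc, map_smul, ha, map_smul, map_smul]

theorem coeffs_mul_e_mul (a b : A.carrier) :
    T.coeffs l (a * (T.e l).val * b) = Finsupp.mapRange.linearMap
      (LinearMap.mulRight k (T.toCartan l b)) (T.coeffs l (a * (T.e l).val)) := by
  rw [e_eq_sum, Finset.mul_sum, Finset.sum_mul, map_sum, map_sum, map_sum]
  refine Finset.sum_congr rfl fun s hs => coeffs_mul (s := s) (by simpa using hs) ?_ b
  rw [mul_assoc, A.one_mul_one]

variable (T l) in
/-- The coefficients of an element of `A_{≥ l} e`. -/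
def leftCoeffs : (T.ebar l).leftIdeal →ₗ[k] (T.XIdx l →₀ (T.cartan l).carrier) :=
  (A.ideal (T.notGeq l)).liftQ (T.coeffs l) (fun _ ha => coeffs_eq_zero ha) ∘ₗ
    (T.ebar l).leftIdeal.subtype

theorem leftCoeffs_toLeft (a : A.carrier) :
    T.leftCoeffs l (T.toLeft l a) = T.coeffs l (a * (T.e l).val) := rfl

/-- The coefficients of a vector of a standard module. -/
def stdCoeffs (M : GrModule (T.cartan l)) :
    (T.std l M).carrier →ₗ[k] (T.XIdx l →₀ M.carrier) :=
  ((T.ebar l).tensorRel M).liftQ (TensorProduct.lift (LinearMap.mk₂ k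
    (fun x v => Finsupp.mapRange.linearMap (M.act.flip v) (T.leftCoeffs l x))
    (fun x y v => by rw [map_add, map_add])
    (fun c x v => by rw [map_smul, map_smul])
    (fun x v w => by ext p; simp [Finsupp.mapRange.linearMap_apply])
    (fun c x v => by ext p; simp [Finsupp.mapRange.linearMap_apply])))
    (by
      refine Submodule.span_le.2 ?_
      rintro _ ⟨x, h, v, rfl⟩
      obtain ⟨a, rfl⟩ := toLeft_surjective x
      obtain ⟨b, rfl⟩ := toCartan_surjective h
      have h1 : (T.ebar l).mulCorner (T.toLeft l a) (T.toCartan l b) =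
          T.toLeft l (a * (T.e l).val * b) := by
        refine Subtype.ext ((A.quotMk_mul _ (T.notGeq_mem l) _ _).symm.trans (congrArg _ ?_))
        simp only [mul_assoc]
        rw [← mul_assoc (T.e l).val (T.e l).val, (T.e l).idem]
      rw [SetLike.mem_coe, LinearMap.mem_ker, map_sub, TensorProduct.lift.tmul,
        TensorProduct.lift.tmul, LinearMap.mk₂_apply, LinearMap.mk₂_apply, h1, leftCoeffs_toLeft,
        leftCoeffs_toLeft, mul_assoc _ b, coeffs_mul_e_mul, toCartan_mul_e, sub_eq_zero]
      ext p
      simp only [Finsupp.mapRange.linearMap_apply, Finsupp.mapRange_apply,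
        LinearMap.mulRight_apply, LinearMap.flip_apply, M.act_mul]
      rfl)

/-! ### Standard modules are X-free and truncate back to M -/

theorem stdCoeffs_stdMk (a : A.carrier) (v : M.carrier) : stdCoeffs M (T.stdMk l M a v) =
    Finsupp.mapRange.linearMap (M.act.flip v) (T.coeffs l (a * (T.e l).val)) := rfl

theorem stdCoeffs_X (p : T.XIdx l) (v : M.carrier) : stdCoeffs M (T.stdMk l M p.1.2 v) =
    Finsupp.single p (M.act (T.toCartan l (A.one p.1.1)) v) := by
  obtain ⟨i, hx⟩ := p.2.2
  have h1 := coeffs_X_mul p (A.one_mul_one p.1.1)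
  rw [X_mul_one hx] at h1
  rw [stdCoeffs_stdMk, ← X_mul_one hx, mul_assoc, one_mul_e p.2.1, X_mul_one hx, h1,
    Finsupp.mapRange.linearMap_apply, Finsupp.mapRange_single, LinearMap.flip_apply]

theorem exists_stdMk_one {t : T.S} (ht : T.wt t = l) (w : (T.std l M).carrier) :
    ∃ m, (T.std l M).act (A.one t) w = T.stdMk l M (A.one t) m := by
  induction w using std_induction with
  | h0 => exact ⟨0, by rw [map_zero, map_zero]⟩
  | hadd x y hx hy =>
    obtain ⟨m, hm⟩ := hx
    obtain ⟨m', hm'⟩ := hy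
    exact ⟨m + m', by rw [map_add, hm, hm', map_add]⟩
  | h a v => exact ⟨_, (act_stdMk _ _ _).trans (stdMk_one_mul ht a v)⟩

theorem exists_stdMk_e (w : (T.std l M).carrier) :
    ∃ m, (T.std l M).act (T.e l).val w = T.stdMk l M (T.e l).val m := by
  induction w using std_induction with
  | h0 => exact ⟨0, by rw [map_zero, map_zero]⟩
  | hadd x y hx hy =>
    obtain ⟨m, hm⟩ := hx
    obtain ⟨m', hm'⟩ := hy
    exact ⟨m + m', by rw [map_add, hm, hm', map_add]⟩
  | h a v =>
    refine ⟨M.act (T.toCartan l a) v, (act_stdMk _ _ _).trans ?_⟩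
    rw [← stdMk_mul_e_mul, (T.e l).idem]

/-- A family is read off from its sum by taking coefficients. These live in `M`, whereas the family
has values in the standard module, so the comparison is made after applying `m ↦ 1_t ⊗ m`. -/
theorem stdMk_stdCoeffs_xsum (g : T.XIdx l →₀ (T.std l M).carrier) (p : T.XIdx l) :
    T.stdMk l M (A.one p.1.1) (stdCoeffs M (T.xsum l _ g) p) =
      (T.std l M).act (A.one p.1.1) (g p) := by
  classical
  induction g using Finsupp.induction_linear with
  | zero => simp
  | add g g' h h' =>
    rw [map_add, map_add, Finsupp.add_apply, map_add, h, h', Finsupp.add_apply, map_add]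
  | single q w =>
    obtain ⟨m, hm⟩ := exists_stdMk_one q.2.1 w
    obtain ⟨i, hx⟩ := q.2.2
    rw [xsum_single, ← act_act_one (X_mul_one hx), hm, act_stdMk, X_mul_one hx, stdCoeffs_X,
      Finsupp.single_apply, Finsupp.single_apply]
    split_ifs with h
    · subst h
      rw [hm, ← stdMk_one_mul q.2.1, A.one_mul_one]
    · rw [map_zero, map_zero]

/-- Injectivity holds because coefficients recover the family; for surjectivity, `a ⊗ v = ae ⊗ v` is
straightened into terms `xh ⊗ v`, and products through smaller weights vanish in `A_{≥l}`. -/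
theorem std_isXFree (M : GrModule (T.cartan l)) : T.IsXFree l (T.std l M) := by
  constructor
  · rw [injective_iff_map_eq_zero]
    rintro ⟨g, hg⟩ h0
    refine Subtype.ext (Finsupp.ext fun p => ?_)
    have := stdMk_stdCoeffs_xsum g p
    rw [show T.xsum l _ g = 0 from h0, map_zero, Finsupp.zero_apply, map_zero, hg p] at this
    exact this.symm
  · rw [← LinearMap.range_eq_top, eq_top_iff]
    rintro w -
    induction w using std_induction with
    | h0 => exact zero_mem _
    | hadd x y hx hy => exact add_mem hx hy
    | h a v =>
      rw [← stdMk_mul_e, e_eq_sum, Finset.mul_sum, map_sum, LinearMap.sum_apply]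
      refine Submodule.sum_mem _ fun s hs => ?_
      have hs : T.wt s = l := by simpa using hs
      have := right_expand (T := T) (t := s) (a := a * A.one s) (by rw [mul_assoc, A.one_mul_one])
      generalize a * A.one s = b at this
      induction this using Submodule.span_induction with
      | mem b hb =>
        rcases hb with ⟨i, t, x, hx, h, hh, rfl⟩ | hb
        · have ht : T.wt t = l := (wt_eq_of_H hh).trans hs
          let p : T.XIdx l := ⟨(t, x), ht, i, hx⟩
          have h1 : (T.std l M).act (A.one t) (T.stdMk l M h v) = T.stdMk l M h v := by
            rw [act_stdMk, one_mul_H hh]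
          exact ⟨⟨Finsupp.single p (T.stdMk l M h v), single_mem_xsub p h1⟩,
            (xsum_single _ p _).trans (act_stdMk _ _ _)⟩
        · rw [stdMk_eq_zero (lower_subset_ideal (hs ▸ hb))]
          exact zero_mem _
      | zero => rw [map_zero]; exact zero_mem _
      | add a b _ _ ha hb => rw [map_add]; exact add_mem ha hb
      | smul c a _ ha => rw [map_smul]; exact Submodule.smul_mem _ c ha

/-- The isomorphism is `v ↦ e ⊗ v`. It is onto since `ea ⊗ v = e ⊗ (eae)v`; it is injective since
the coefficients at the elements `1_t` of X are the `1_t v`, which sum to `v`. -/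
theorem nonempty_truncAt_std (M : GrModule (T.cartan l)) (h : T.Supp l (T.std l M)) :
    Nonempty (M ≅ T.truncAt l (T.std l M) h) := by
  have he : ∀ v, (T.std l M).act (T.e l).val (T.stdMk l M (T.e l).val v) =
      T.stdMk l M (T.e l).val v := fun v => by rw [act_stdMk, (T.e l).idem]
  let θ : M.carrier →ₗ[k] (T.truncAt l (T.std l M) h).carrier :=
    { toFun := fun v => truncMk h (T.stdMk l M (T.e l).val v) (he v)
      map_add' := fun v w => truncVal_injective h (map_add (T.stdMk l M (T.e l).val) v w)
      map_smul' := fun c v => truncVal_injective h (map_smul (T.stdMk l M (T.e l).val) c v) }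
  have hθ : ∀ v, truncVal h (θ v) = T.stdMk l M (T.e l).val v := fun v => rfl
  let f : M ⟶ T.truncAt l (T.std l M) h := ofLin θ
    (fun a v => by
      obtain ⟨a, rfl⟩ := toCartan_surjective a
      refine truncVal_injective h ?_
      rw [truncVal_act, hθ, hθ, act_stdMk, ← stdMk_mul_e_mul, (T.e l).idem,
        mul_assoc _ (T.e l).val (T.e l).val, (T.e l).idem, stdMk_mul_e])
    (fun n v hv => by
      rw [truncVal_deg, hθ]
      have := stdMk_mem (M := M) (T.e l).mem hv
      rwa [zero_add] at this)
  have hf : ∀ v, lin f v = θ v := fun v => rfl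
  have : IsIso f := by
    refine isIso_of_bijective f ⟨?_, fun w => ?_⟩
    · rw [injective_iff_map_eq_zero]
      intro v hv
      rw [hf] at hv
      have hv : T.stdMk l M (T.e l).val v = 0 := by rw [← hθ, hv, map_zero]
      rw [← act_e M v, e_eq_sum, map_sum, map_sum, LinearMap.sum_apply]
      refine Finset.sum_eq_zero fun t ht => ?_
      have ht : T.wt t = l := by simpa using ht
      let p : T.XIdx l := ⟨(t, A.one t), ht, t, one_mem_X t⟩
      have h1 : T.stdMk l M (A.one t) v = 0 := by
        rw [← e_mul_one ht, ← stdMk_mul_e, mul_assoc, one_mul_e ht, e_mul_one ht,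
          ← one_mul_e ht, ← act_stdMk, hv, map_zero]
      have h2 := stdCoeffs_X (M := M) p v
      rw [show T.stdMk l M p.1.2 v = 0 from h1, map_zero] at h2
      exact Finsupp.single_eq_zero.1 h2.symm
    · obtain ⟨m, hm⟩ := exists_stdMk_e (truncVal h w)
      refine ⟨m, truncVal_injective h ?_⟩
      rw [hf, hθ, ← hm, truncVal_mem]
  exact ⟨asIso f⟩

/-- The module is inflated from `A_{≥l}`, where `e_m` is zero for every `m` not above `l`. -/
theorem costd_supp (N : GrModule (T.cartan l)) : T.Supp l (T.costd l N) := by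
  intro s hs
  have h := inflate_act_eq_zero (hE := T.notGeq_mem l) ((T.ebar l).jStar N)
    (x := (T.e (T.wt s)).val) ⟨_, hs, rfl⟩
  have h : (T.costd l N).act (T.e (T.wt s)).val = 0 := h
  ext v
  rw [← one_mul_e (T := T) (s := s) rfl, (T.costd l N).act_mul, h]
  simp

end TriangularBasis

/-! ### Filtrations of free modules -/

namespace GrModule

variable {k : Type u} [Field k] {I : Type v} {A : GrAlgebra k I}

/-- The short exact sequence defined by a monomorphism. -/
theorem shortExact_coker {V W : GrModule A} (f : V ⟶ W) (h : Function.Injective (lin f)) :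
    (ShortComplex.mk f (cokerπ f) (comp_cokerπ f)).ShortExact :=
  (shortExact_iff _).2 ⟨h, (LinearMap.range (lin f)).mkQ_surjective,
    fun _ hv => (Submodule.Quotient.mk_eq_zero _).1 hv⟩

/-- The short exact sequence defined by an epimorphism. -/
theorem shortExact_ker {V W : GrModule A} (f : V ⟶ W) (h : Function.Surjective (lin f)) :
    (ShortComplex.mk (kerι f) f (kerι_comp f)).ShortExact :=
  (shortExact_iff _).2 ⟨Subtype.val_injective, h, fun v hv => ⟨⟨v, hv⟩, rfl⟩⟩

/-- The morphism from the cokernel determined by a morphism vanishing on the image. -/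
def cokerDesc {V W E : GrModule A} (f : V ⟶ W) (g : W ⟶ E) (h : ∀ v, lin g (lin f v) = 0) :
    GrModule.coker f ⟶ E :=
  ofLin (V := GrModule.coker f) ((LinearMap.range (lin f)).liftQ (lin g) (by
      rintro _ ⟨v, rfl⟩
      exact h v))
    (fun a v => by
      obtain ⟨v, rfl⟩ := (LinearMap.range (lin f)).mkQ_surjective v
      exact lin_act g a v)
    (by
      rintro n _ ⟨v, hv, rfl⟩
      exact lin_deg g hv)

theorem cokerDesc_surjective {V W E : GrModule A} (f : V ⟶ W) (g : W ⟶ E)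
    (h : ∀ v, lin g (lin f v) = 0) (hg : Function.Surjective (lin g)) :
    Function.Surjective (lin (cokerDesc f g h)) := fun v => by
  obtain ⟨w, rfl⟩ := hg v
  exact ⟨(LinearMap.range (lin f)).mkQ w, rfl⟩

section free

variable {ι : Type u} {s : ι → I} {d : ι → ℤ} {J J' : Submodule k A.carrier}

/-- The inclusion of free modules attached to graded left ideals `J ≤ J'`. -/
def freeMap (hJ : A.IsGradedLeftIdeal J) (hJ' : A.IsGradedLeftIdeal J') (h : J ≤ J') :
    free s d J hJ ⟶ free s d J' hJ' :=
  ofLin (V := free s d J hJ) (W := free s d J' hJ')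
    (Submodule.inclusion (p := freeSub s J) (p' := freeSub s J')
      fun _ hg j => ⟨h (hg j).1, (hg j).2⟩)
    (fun _ _ => rfl) (fun _ _ hv => hv)

theorem freeMap_injective (hJ : A.IsGradedLeftIdeal J) (hJ' : A.IsGradedLeftIdeal J')
    (h : J ≤ J') : Function.Injective (lin (freeMap (s := s) (d := d) hJ hJ' h)) :=
  fun _ _ hvw => coord_injective (congrArg coord hvw :)

variable {hJ : A.IsGradedLeftIdeal J}

theorem incl_congr {j : ι} {a b : A.carrier} (h : a = b) {ha : a ∈ J} {hb : b ∈ J}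
    {ha' : a * A.one (s j) = a} {hb' : b * A.one (s j) = b} :
    (incl j a ha ha' : (free s d J hJ).carrier) = incl j b hb hb' := by
  subst h
  rfl

theorem incl_add {j : ι} {a b : A.carrier} {ha : a ∈ J} {hb : b ∈ J}
    {ha' : a * A.one (s j) = a} {hb' : b * A.one (s j) = b} {hab : a + b ∈ J}
    {hab' : (a + b) * A.one (s j) = a + b} :
    (incl j (a + b) hab hab' : (free s d J hJ).carrier) = incl j a ha ha' + incl j b hb hb' :=
  Subtype.ext (Finsupp.single_add j a b)

theorem incl_smul {j : ι} {a : A.carrier} (c : k) {ha : a ∈ J}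
    {ha' : a * A.one (s j) = a} {hca : c • a ∈ J} {hca' : (c • a) * A.one (s j) = c • a} :
    (incl j (c • a) hca hca' : (free s d J hJ).carrier) = c • incl j a ha ha' :=
  Subtype.ext (Finsupp.smul_single c j a).symm

theorem incl_zero {j : ι} {h : (0 : A.carrier) ∈ J} {h' : (0 : A.carrier) * A.one (s j) = 0} :
    (incl j 0 h h' : (free s d J hJ).carrier) = 0 :=
  Subtype.ext (Finsupp.single_zero j)

/-- The coordinate with index `j`, as a linear map. -/
def coordLin (j : ι) : (free s d J hJ).carrier →ₗ[k] A.carrier :=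
  Finsupp.lapply j ∘ₗ (freeSub s J).subtype

theorem coordLin_incl {i j : ι} (h : i = j) {a : A.carrier} {ha : a ∈ J}
    {ha' : a * A.one (s i) = a} :
    coordLin j (incl i a ha ha' : (free s d J hJ).carrier) = a := by
  subst h
  exact Finsupp.single_eq_same

theorem coordLin_incl_ne {i j : ι} (h : i ≠ j) {a : A.carrier} {ha : a ∈ J}
    {ha' : a * A.one (s i) = a} :
    coordLin j (incl i a ha ha' : (free s d J hJ).carrier) = 0 :=
  Finsupp.single_eq_of_ne' h

theorem coordLin_mem (j : ι) (g : (free s d J hJ).carrier) : coordLin j g ∈ J :=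
  (g.2 j).1

end free

end GrModule

namespace TriangularBasis

open GrModule

variable {k : Type u} [Field k] {I : Type v} {A : GrAlgebra k I} {L : Type w} [PartialOrder L]
  (T : TriangularBasis A L)

section filtration

variable {ι : Type u} (s : ι → T.S) (d : ι → ℤ)

/-- The submodule of a free module spanned by the basis vectors with weights in `D`. -/
abbrev freeOn (D : Set L) (hD : IsLowerSet D) : GrModule A :=
  free (fun j => (s j : I)) d (T.spanOf D) (T.spanOf_isGradedLeftIdeal hD)

/-- The inclusion between the submodules attached to two lower sets. -/
def freeOnMap {D D' : Set L} (hD : IsLowerSet D) (hD' : IsLowerSet D') (h : D ⊆ D') :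
    T.freeOn s d D hD ⟶ T.freeOn s d D' hD' :=
  freeMap _ _ (spanOf_mono h)

variable {D D' : Set L} (hD : IsLowerSet D) (hD' : IsLowerSet D') (h : D ⊆ D')

theorem cokerπ_freeOnMap {j : ι} {a : A.carrier} (ha : a ∈ T.spanOf D) (ha₂ : a ∈ T.spanOf D')
    (ha' : a * A.one (s j) = a) : lin (cokerπ (T.freeOnMap s d hD hD' h))
      (incl (s := fun j => (s j : I)) (hJ := T.spanOf_isGradedLeftIdeal hD') j a ha₂ ha') = 0 :=
  (Submodule.Quotient.mk_eq_zero _).2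
    ⟨incl (s := fun j => (s j : I)) (hJ := T.spanOf_isGradedLeftIdeal hD) j a ha ha', rfl⟩

theorem act_cokerπ_freeOnMap {j : ι} (b : A.carrier) {a : A.carrier} (ha : a ∈ T.spanOf D')
    (ha' : a * A.one (s j) = a) : (GrModule.coker (T.freeOnMap s d hD hD' h)).act b
      (lin (cokerπ (T.freeOnMap s d hD hD' h))
        (incl (s := fun j => (s j : I)) (hJ := T.spanOf_isGradedLeftIdeal hD') j a ha ha')) =
      lin (cokerπ (T.freeOnMap s d hD hD' h))
        (incl (s := fun j => (s j : I)) (hJ := T.spanOf_isGradedLeftIdeal hD') j (b * a)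
          (mul_mem_spanOf_left hD' b ha) (by rw [mul_assoc, ha'])) :=
  (lin_act _ _ _).symm.trans (congrArg _ (act_incl _ _ _ _ _))

/-- Basis vectors with weight in `D` die in the quotient, so a subspace is everything once it
contains the images of those with weight in `D'` but not in `D`. -/
theorem freeOn_mem {K : Submodule k (GrModule.coker (T.freeOnMap s d hD hD' h)).carrier}
    (hK : ∀ j i (t u : T.S), T.wt u ∈ D' → T.wt u ∉ D → ∀ x ∈ T.X i t, ∀ h' ∈ T.H t u,
      ∀ y ∈ T.Y u (s j), ∀ hm hm', lin (cokerπ (T.freeOnMap s d hD hD' h))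
        (incl j (x * h' * y) hm hm') ∈ K)
    (v : (GrModule.coker (T.freeOnMap s d hD hD' h)).carrier) : v ∈ K := by
  obtain ⟨v, rfl⟩ := (LinearMap.range (lin (T.freeOnMap s d hD hD' h))).mkQ_surjective v
  change lin (cokerπ (T.freeOnMap s d hD hD' h)) v ∈ _
  induction v using free_induction with
  | h0 => rw [map_zero]; exact zero_mem _
  | hadd x y hx hy => rw [map_add]; exact add_mem hx hy
  | h j a ha ha' =>
    -- Right multiplication by `1_{s j}` puts each term of a combination into the summand numbered
    -- `j`, so that span induction can run over all of `T.spanOf D'`.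
    have h4 : ∀ a : A.carrier, a * A.one (s j) * A.one (s j) = a * A.one (s j) := fun a => by
      rw [mul_assoc, A.one_mul_one]
    have key : ∀ b ∈ T.spanOf D', ∀ hb, lin (cokerπ (T.freeOnMap s d hD hD' h))
        (incl j (b * A.one (s j)) hb (h4 b)) ∈ K := by
      intro b hb
      induction hb using Submodule.span_induction with
      | mem b hb =>
        obtain ⟨i, t, u, j', hu, x, hx, h', hh, y, hy, rfl⟩ := hb
        intro hb
        by_cases hj : (s j : I) = j'
        · subst hj
          by_cases huD : T.wt u ∈ D
          · rw [T.cokerπ_freeOnMap s d hD hD' h (mul_mem_spanOf_right hD _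
              (Submodule.subset_span ⟨i, t, u, _, huD, x, hx, h', hh, y, hy, rfl⟩)) hb]
            exact zero_mem _
          · have he : x * h' * y * A.one (s j) = x * h' * y := by rw [mul_assoc, Y_mul_one hy]
            rw [incl_congr he (hb := he ▸ hb) (hb' := he)]
            exact hK j i t u hu huD x hx h' hh y hy _ _
        · have : x * h' * y * A.one (s j) = 0 := by
            rw [← Y_mul_one hy, mul_assoc, mul_assoc y, A.one_orth _ _ (Ne.symm hj), mul_zero,
              mul_zero]
          rw [incl_congr this (hb := zero_mem _) (hb' := zero_mul _), incl_zero, map_zero]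
          exact zero_mem _
      | zero =>
        intro hb
        rw [incl_congr (zero_mul (A.one (s j))) (hb := zero_mem _) (hb' := zero_mul _), incl_zero, map_zero]
        exact zero_mem _
      | add a b ha hb iha ihb =>
        intro hab
        have h5 := mul_mem_spanOf_right hD' (A.one (s j)) ha
        have h6 := mul_mem_spanOf_right hD' (A.one (s j)) hb
        rw [incl_congr (add_mul _ _ _) (hb := add_mem h5 h6) (hb' := by rw [add_mul, h4, h4]),
          incl_add (ha := h5) (hb := h6) (ha' := h4 a) (hb' := h4 b), map_add]
        exact add_mem (iha _) (ihb _)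
      | smul c a ha iha =>
        intro hb
        have h5 := mul_mem_spanOf_right hD' (A.one (s j)) ha
        rw [incl_congr (smul_mul_assoc _ _ _) (hb := Submodule.smul_mem _ c h5)
          (hb' := by rw [smul_mul_assoc, h4]), incl_smul c (ha := h5) (ha' := h4 a), map_smul]
        exact Submodule.smul_mem _ c (iha _)
    rw [incl_congr ha'.symm (hb := ha'.symm ▸ ha) (hb' := h4 a)]
    exact key a ha _

/-- The coefficient of a basis vector in a subquotient. -/
def freeOnCoeff (j : ι) (p : T.Idx) {t u : T.S} (hp : p.1.2.1 ∈ T.H t u) (hu : T.wt u ∉ D) :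
    (GrModule.coker (T.freeOnMap s d hD hD' h)).carrier →ₗ[k] k :=
  (LinearMap.range (lin (T.freeOnMap s d hD hD' h))).liftQ
    (Finsupp.lapply p ∘ₗ T.toBasis.repr.toLinearMap ∘ₗ coordLin j) (by
      rintro _ ⟨v, rfl⟩
      exact repr_eq_zero_of_mem_spanOf (coordLin_mem j v) p hp hu)

theorem freeOnCoeff_apply (i j : ι) (p : T.Idx) {t u : T.S} (hp : p.1.2.1 ∈ T.H t u)
    (hu : T.wt u ∉ D) {a : A.carrier} (ha : a ∈ T.spanOf D') (ha' : a * A.one (s i) = a) :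
    T.freeOnCoeff s d hD hD' h j p hp hu (lin (cokerπ (T.freeOnMap s d hD hD' h))
        (incl (s := fun j => (s j : I)) (hJ := T.spanOf_isGradedLeftIdeal hD') i a ha ha')) =
      T.toBasis.repr (coordLin j (incl (s := fun j => (s j : I)) (d := d)
        (hJ := T.spanOf_isGradedLeftIdeal hD') i a ha ha')) p :=
  rfl

variable {T s d} {l : L} (h1 : ∀ m ∈ D', m = l ∨ m ∈ D) (h2 : l ∈ D') (h3 : l ∉ D)

/-- The subquotients are layers. -/
def freeOnLayer : T.Layer l (GrModule.coker (T.freeOnMap s d hD hD' h)) where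
  index := {c : ι × A.carrier // ∃ u : T.S, T.wt u = l ∧ c.2 ∈ T.Y u (s c.1)}
  gen c := lin (cokerπ (T.freeOnMap s d hD hD' h))
    (incl (s := fun j => (s j : I)) (hJ := T.spanOf_isGradedLeftIdeal hD') c.1.1 c.1.2
      (by
        obtain ⟨u, hu, hy⟩ := c.2
        rw [← one_mul_Y hy]
        exact mul_mem_spanOf_of_mem hD' (hu ▸ h2) (A.one_mul_one u) (one_mul_Y hy))
      (Y_mul_one c.2.choose_spec.2))
  vertex c := c.2.choose
  degree c := (T.Y_homogeneous _ _ _ c.2.choose_spec.2).choose + d c.1.1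
  wt_vertex c := c.2.choose_spec.1
  one_gen c := by
    exact (lin_act _ _ _).symm.trans <| congrArg _ ((act_incl _ _ _ _ _).trans (incl_congr (one_mul_Y c.2.choose_spec.2)))
  gen_mem c := lin_deg _ (incl_mem (T.Y_homogeneous _ _ _ c.2.choose_spec.2).choose_spec)
  vanish t ht := by
    have ht' : T.wt t ∈ D := (h1 _ (hD' ht.le h2)).resolve_left ht.ne
    ext v
    obtain ⟨v, rfl⟩ := (LinearMap.range (lin (T.freeOnMap s d hD hD' h))).mkQ_surjective v
    change (GrModule.coker _).act (A.one t) (lin (cokerπ (T.freeOnMap s d hD hD' h)) v) = 0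
    rw [← lin_act]
    induction v using free_induction with
    | h0 => simp only [map_zero]
    | hadd x y hx hy => rw [map_add, map_add, hx, hy, add_zero]
    | h j a ha ha' =>
      exact (congrArg _ (act_incl _ _ _ _ _)).trans (T.cokerπ_freeOnMap s d hD hD' h
        (mul_mem_spanOf_right hD a (one_mem_spanOf hD ht')) _ _)
  linearIndependent := by
    classical
    -- The vector indexed by `(j, y)`, `x`, `h` is the image of `xhy` in the summand `j`, so the
    -- coefficient functionals of the triangular basis are dual to the family.
    refine LinearIndependent.of_pairwise_dual_eq_zero_one _ (fun p =>
      T.freeOnCoeff s d hD hD' h p.1.1.1.1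
        ⟨(p.1.2.1, p.1.2.2, p.1.1.1.2), p.2.choose, p.2.choose_spec.choose, p.1.1.2.choose, _,
          p.2.choose_spec.choose_spec.1, p.2.choose_spec.choose_spec.2,
          p.1.1.2.choose_spec.2⟩
        p.2.choose_spec.choose_spec.2 (p.1.1.2.choose_spec.1.symm ▸ h3)) ?_ ?_
    · intro p q hpq
      refine (congrArg _ (T.act_cokerπ_freeOnMap s d hD hD' h _ _ _)).trans ?_
      rw [freeOnCoeff_apply]
      by_cases hj : q.1.1.1.1 = p.1.1.1.1
      · have hq := T.toBasis_apply ⟨(q.1.2.1, q.1.2.2, q.1.1.1.2), q.2.choose,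
          q.2.choose_spec.choose, q.1.1.2.choose, _, q.2.choose_spec.choose_spec.1,
          q.2.choose_spec.choose_spec.2, q.1.1.2.choose_spec.2⟩
        rw [coordLin_incl hj, ← hq, Module.Basis.repr_self, Finsupp.single_apply, if_neg]
        intro he
        have he := congrArg Subtype.val he
        simp only [Prod.mk.injEq] at he
        exact hpq (Subtype.ext (Prod.ext (Subtype.ext (Prod.ext hj.symm he.2.2.symm))
          (Prod.ext he.1.symm he.2.1.symm)))
      · rw [coordLin_incl_ne hj, map_zero, Finsupp.zero_apply]
    · intro q
      refine (congrArg _ (T.act_cokerπ_freeOnMap s d hD hD' h _ _ _)).trans ?_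
      have hq := T.toBasis_apply ⟨(q.1.2.1, q.1.2.2, q.1.1.1.2), q.2.choose,
          q.2.choose_spec.choose, q.1.1.2.choose, _, q.2.choose_spec.choose_spec.1,
          q.2.choose_spec.choose_spec.2, q.1.1.2.choose_spec.2⟩
      rw [freeOnCoeff_apply, coordLin_incl rfl, ← hq, Module.Basis.repr_self, Finsupp.single_eq_same]
  span_eq_top := by
    rw [eq_top_iff]
    rintro v -
    refine T.freeOn_mem s d hD hD' h (fun j i t u hu hu' x hx h' hh y hy hm hm' => ?_) v
    have hul := (h1 _ hu).resolve_right hu'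
    refine Submodule.subset_span ⟨⟨(j, y), u, hul, hy⟩, i, t, x, hx, h', ?_, ?_⟩
    -- The vertex attached to the generator `y` was chosen; as `y ≠ 0`, it can only be `u`.
    · have hc := (show ∃ u : T.S, T.wt u = l ∧ y ∈ T.Y u (s j) from
        ⟨u, hul, hy⟩).choose_spec.2
      have h0 : y ≠ 0 := fun h0 => mul_ne_zero_of_mem hx hh hy (by rw [h0, mul_zero])
      have := Subtype.ext (eq_of_one_mul h0 (one_mul_Y hc) (one_mul_Y hy))
      exact (congrArg (fun z => h' ∈ T.H t z) this).mpr hh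
    · exact (T.act_cokerπ_freeOnMap s d hD hD' h _ _ _).symm

end filtration

end TriangularBasis

namespace TriangularBasis

open GrModule Abelian

variable {k : Type u} [Field k] {I : Type v} {A : GrAlgebra k I} {L : Type w} [PartialOrder L]
  {T : TriangularBasis A L} {l m : L}

/-! ### Support conditions and vanishing truncations -/

theorem Supp.mono {V : GrModule A} (h : T.Supp l V) (hml : m ≤ l) : T.Supp m V :=
  fun s hs => h s fun hl => hs (hml.trans hl)

theorem extVanish_of_isZero {V W : GrModule A} (h : IsZero V) : ExtVanish V W :=
  .of_projective h.projective

/-- If `m ≤ l`, then `m` is not above `l`, so the idempotents of weight `m` kill `V`. Otherwise `V`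
is generated by vectors of weight `l`, which is not above `m`, so the support condition forces `V =
0`. -/
theorem isXFree_truncAt_isZero {V : GrModule A} (hV : T.IsXFree l V) (hlm : l ≠ m)
    (hm : T.Supp m V) : IsZero (T.truncAt m V hm) := by
  by_cases hml : m ≤ l
  · exact truncAt_isZero hm fun s hs => hV.supp s fun h => hlm (le_antisymm (hs ▸ h) hml)
  · have h0 : ∀ v : V.carrier, v = 0 := by
      intro v
      induction v using hV.induction with
      | h0 => rfl
      | hadd x y hx hy => rw [hx, hy, add_zero]
      | h i t x v ht hx hv =>
        rw [← hv, hm t (by rwa [ht]), LinearMap.zero_apply, map_zero]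
    exact isZero_of_forall_eq_zero fun v => truncVal_injective hm (by rw [h0 (truncVal hm v), map_zero])

/-- A special idempotent that kills the outer terms of a short exact sequence kills the middle
term. -/
theorem act_one_middle {S : ShortComplex (GrModule A)} (hS : S.ShortExact) {i : I}
    (h1 : S.X₁.act (A.one i) = 0) (h3 : S.X₃.act (A.one i) = 0) : S.X₂.act (A.one i) = 0 := by
  obtain ⟨-, -, i3⟩ := (shortExact_iff S).1 hS
  refine LinearMap.ext fun v => ?_
  obtain ⟨w, hw⟩ := i3 (S.X₂.act (A.one i) v) (by rw [lin_act, h3]; rfl)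
  rw [← act_one_act (A.one_mul_one i), ← hw, ← lin_act, h1]
  simp

/-! ### Extensions between free and costandard modules -/

/-- Retractions onto costandard modules from their universal property. -/
theorem exists_retraction_of_le {N : GrModule (T.cartan m)} {V E : GrModule A}
    (hV : T.Supp m V) (hN : Subsingleton (Ext (T.truncAt m V hV) N 1))
    (f : T.costd m N ⟶ E) (g : E ⟶ V) (w : f ≫ g = 0) (h : (ShortComplex.mk f g w).ShortExact) :
    ∃ r : E ⟶ T.costd m N, f ≫ r = 𝟙 _ := by
  -- The support condition passes to extensions, so the whole sequence consists of modules over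
  -- `A_{≥m}` and can be truncated exactly.
  have hE : T.Supp m E := Supp.middle h (costd_supp N) hV
  obtain ⟨i1, i2, i3⟩ := (shortExact_iff _).1 h
  let f' : (T.ebar m).jStar N ⟶ E.deflate (T.notGeq_mem m) hE.act_eq_zero := deflateHom f
  let g' : E.deflate (T.notGeq_mem m) hE.act_eq_zero ⟶ V.deflate (T.notGeq_mem m) hV.act_eq_zero :=
    deflateMap g _ _
  have h' : (ShortComplex.mk f' g' (by ext v; exact lin_comp_zero (ShortComplex.mk f g w) v)).ShortExact :=
    (shortExact_iff _).2 ⟨i1, i2, i3⟩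
  have h'' := GrAlgebra.Idem.shortExact_trunc (e := T.ebar m) h'
  -- Vanishing of the first extension group over `A_m` extends the evaluation `e_m j_* N → N` to
  -- `e_m E`.
  obtain ⟨φ, hφ⟩ := exists_extension h'' hN (GrAlgebra.Idem.evalUnit N)
  have hr := GrAlgebra.Idem.coind_eq_of_evalUnit f' φ hφ
  refine ⟨inflateHom (h := hE.act_eq_zero) (GrAlgebra.Idem.coind
    (V := E.deflate (T.notGeq_mem m) hE.act_eq_zero) φ), ?_⟩
  ext v
  exact LinearMap.congr_fun (congrArg lin hr) v

/-- Retractions from sections of free modules. -/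
theorem exists_retraction_of_isXFree {V E W : GrModule A} (hV : T.IsXFree l V)
    (hW : ∀ s : T.S, T.wt s ≤ l → W.act (A.one s) = 0)
    (f : W ⟶ E) (g : E ⟶ V) (w : f ≫ g = 0) (h : (ShortComplex.mk f g w).ShortExact) :
    ∃ r : E ⟶ W, f ≫ r = 𝟙 _ := by
  obtain ⟨i1, i2, i3⟩ := (shortExact_iff _).1 h
  have hE : ∀ s : T.S, T.wt s < l → E.act (A.one s) = 0 := fun s hs =>
    act_one_middle h (hW s hs.le) (hV.supp.lt s hs)
  obtain ⟨σ, hσ⟩ := (lin g).exists_rightInverse_of_surjective (LinearMap.range_eq_top.2 i2)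
  have hσ : ∀ v, lin g (σ v) = v := fun v => LinearMap.congr_fun hσ v
  have hWe : W.act (T.e l).val = 0 := by
    rw [e_eq_sum, map_sum]
    exact Finset.sum_eq_zero fun s hs => hW s (le_of_eq (by simpa using hs))
  -- Since `e_l W = 0`, the map `g` is injective on `e_l E`.
  have huniq : ∀ x y, E.act (T.e l).val x = x → E.act (T.e l).val y = y → lin g x = lin g y →
      x = y := by
    intro x y hx hy hxy
    obtain ⟨z, hz⟩ := i3 (x - y) (by
      change lin g (x - y) = 0
      rw [map_sub, hxy, sub_self])
    rw [← sub_eq_zero, ← hx, ← hy, ← map_sub, ← hz]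
    refine (lin_act f _ z).symm.trans ?_
    rw [hWe, LinearMap.zero_apply, map_zero]
  have he : ∀ x, E.act (T.e l).val (E.act (T.e l).val x) = E.act (T.e l).val x := fun x => by
    rw [← E.act_mul, (T.e l).idem]
  have hev : ∀ (t : T.S) v, T.wt t = l → V.act (A.one t) v = v → V.act (T.e l).val v = v := by
    intro t v ht hv
    rw [← hv, ← V.act_mul, e_mul_one ht]
  have hgf : ∀ (t : T.S) v, T.wt t = l → V.act (A.one t) v = v →
      lin g (E.act (T.e l).val (σ v)) = v := by
    intro t v ht hv
    rw [lin_act, hσ, hev t v ht hv]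
  -- Composing a linear section with `e_l` gives the inverse of `e_l E → e_l V`. Injectivity of `g`
  -- on `e_l E` makes it compatible with the action and the grading, and X-freeness extends it to
  -- all of `V`.
  obtain ⟨F, hF⟩ := hV.exists_hom hE (E.act (T.e l).val ∘ₗ σ)
    (fun s t a v hs ht ha ha' hv => by
      refine huniq _ _ (he _) ?_ ?_
      · rw [← E.act_mul, ← ha, ← mul_assoc, e_mul_one hs]
      · rw [LinearMap.comp_apply, LinearMap.comp_apply, hgf s _ hs (act_one_act ha v), lin_act,
          hgf t v ht hv])
    (fun t n v ht hv hv' => by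
      have h1 : homComp E.internal n (E.act (T.e l).val (σ v)) = E.act (T.e l).val (σ v) := by
        refine huniq _ _ ?_ (he _) ?_
        · rw [homComp_act (T.e l).mem, he]
        · rw [← lin_homComp, hgf t v ht hv', homComp_same _ hv]
      rw [LinearMap.comp_apply, ← h1]
      exact homComp_mem _ _ _)
  have hFg : F ≫ g = 𝟙 V := by
    ext v
    rw [lin_comp, LinearMap.comp_apply, lin_id, LinearMap.id_apply]
    induction v using hV.induction with
    | h0 => simp
    | hadd x y hx hy => rw [map_add, map_add, hx, hy]
    | h i t x v ht hx hv =>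
      rw [lin_act, lin_act, hF t v ht hv, LinearMap.comp_apply, hgf t v ht hv]
  have := h.mono_f
  exact ⟨_, (ShortComplex.Splitting.ofExactOfSection _ h.exact F hFg this).f_r⟩

/-! ### Dimension shifting for X-free modules -/

variable (T) in
/-- The free modules whose relevant extension groups with `N` vanish. -/
def Good (l m : L) (V : GrModule A) (N : GrModule (T.cartan m)) : Prop :=
  T.IsXFree l V ∧ ∀ hV : T.Supp m V, ExtVanish (T.truncAt m V hV) N

/-- Every extension splits, for one of two reasons. If `m ≤ l`, the universal property of the
costandard module applies. Otherwise no weight `≤ l` is above `m`, so the costandard module is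
invisible to the weights that determine maps out of `V`. -/
theorem ext_one_subsingleton {V : GrModule A} {N : GrModule (T.cartan m)} (hV : T.Good l m V N) :
    Subsingleton (Ext V (T.costd m N) 1) := by
  refine ext_one_subsingleton_of_split
    (S := ShortComplex.mk (kerι (Projective.π V)) (Projective.π V) (kerι_comp _))
    (shortExact_ker _ (surjective_of_epi _)) ?_
  rintro ⟨f, g, w⟩ h e e'
  dsimp at e e'
  subst e e'
  simp only [eqToHom_refl]
  by_cases hml : m ≤ l
  · have hV' := hV.1.supp.mono hml
    exact exists_retraction_of_le hV' (hV.2 hV' 0) f g w h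
  · exact exists_retraction_of_isXFree hV.1
      (fun s hs => costd_supp N s fun hm => hml (hm.trans hs)) f g w h

section filtration

variable {ι : Type u} {s : ι → T.S} {d : ι → ℤ}

theorem freeOn_shortExact {D D' : Set L} (hD : IsLowerSet D) (hD' : IsLowerSet D') (h : D ⊆ D') :
    (ShortComplex.mk (T.freeOnMap s d hD hD' h) (cokerπ _) (comp_cokerπ _)).ShortExact :=
  shortExact_coker _ (freeMap_injective _ _ _)

/-- Such a subquotient is a layer, hence X-free; its truncation is projective at its own weight and
zero at any other weight where it is defined. -/
theorem freeOn_coker_good {D D' : Set L} (hD : IsLowerSet D) (hD' : IsLowerSet D') (h : D ⊆ D')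
    (h1 : ∀ m ∈ D', m = l ∨ m ∈ D) (h2 : l ∈ D') (h3 : l ∉ D) (N : GrModule (T.cartan m)) :
    T.Good l m (GrModule.coker (T.freeOnMap s d hD hD' h)) N := by
  have B := freeOnLayer (T := T) (s := s) (d := d) hD hD' h h1 h2 h3
  refine ⟨B.isXFree, fun hV => ?_⟩
  by_cases hlm : l = m
  · subst hlm
    exact .of_projective (B.truncAt_projective hV)
  · exact extVanish_of_isZero (isXFree_truncAt_isZero B.isXFree hlm hV)

/-- Removing the weights of `D` one at a time filters the module by good subquotients. A maximal
weight is removed so that the remaining set is still a lower set. -/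
theorem ext_freeOn_subsingleton (N : GrModule (T.cartan m)) (n : ℕ)
    (ih : ∀ l V, T.Good l m V N → Subsingleton (Ext V (T.costd m N) n))
    {D : Set L} (hD : IsLowerSet D) (hfin : D.Finite) :
    Subsingleton (Ext (T.freeOn s d D hD) (T.costd m N) n) := by
  induction hc : D.ncard generalizing D with
  | zero =>
    have hD0 := (Set.ncard_eq_zero hfin).1 hc
    have hz : IsZero (T.freeOn s d D hD) := isZero_of_forall_eq_zero fun v => by
      induction v using free_induction with
      | h0 => rfl
      | hadd x y hx hy => rw [hx, hy, add_zero]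
      | h j a ha ha' =>
        have h0 : a = 0 := by
          have : T.spanOf D = ⊥ := by
            rw [spanOf, Submodule.span_eq_bot]
            rintro _ ⟨i, s, t, j, ht, -⟩
            rw [hD0] at ht
            exact ht.elim
          rwa [this] at ha
        rw [incl_congr h0 (hb := zero_mem _) (hb' := zero_mul _), incl_zero]
    exact subsingleton_of_forall_eq 0 fun x => by
      rw [← Ext.mk₀_id_comp x, hz.eq_of_src (𝟙 _) 0, Ext.mk₀_zero, Ext.zero_comp]
  | succ c ihc =>
    have hne : D.Nonempty := by
      rw [Set.nonempty_iff_ne_empty]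
      rintro rfl
      simp at hc
    obtain ⟨l, hl⟩ := hfin.exists_maximal hne
    have hD0 : IsLowerSet (D \ {l}) := fun a b hba ha =>
      ⟨hD hba ha.1, fun hb => ha.2 (le_antisymm (hl.2 ha.1 (hb ▸ hba)) (hb ▸ hba))⟩
    have h := freeOn_shortExact (s := s) (d := d) hD0 hD Set.sdiff_subset
    refine ext_subsingleton_middle h n (ihc hD0 (hfin.sdiff) ?_) (ih l _ (freeOn_coker_good hD0 hD
      Set.sdiff_subset (fun m hm => ?_) hl.1 (fun h => h.2 rfl) N))
    · have := Set.ncard_sdiff_singleton_add_one hl.1 hfin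
      omega
    · by_cases hml : m = l
      · exact Or.inl hml
      · exact Or.inr ⟨hm, hml⟩

end filtration

/-- A free module is a quotient of a layer with projective truncations. -/
theorem exists_presentation {V : GrModule A} (hV : T.IsXFree l V) :
    ∃ (ι : Type u) (s : ι → T.S) (d : ι → ℤ) (g : GrModule.coker (T.freeOnMap s d
      (isLowerSet_Iio l) (isLowerSet_Iic l) Set.Iio_subset_Iic_self) ⟶ V),
      (∀ j, T.wt (s j) = l) ∧ Function.Surjective (lin g) := by
  -- There is one generator for each homogeneous vector in each `1_t V` with `t` of weight `l`.
  let ι := {v : V.carrier // ∃ (t : T.S) (n : ℤ), T.wt t = l ∧ v ∈ V.deg n ∧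
    V.act (A.one t) v = v}
  choose s d hs hd hv using fun j : ι => j.2
  let q : T.freeOn s d (Set.Iic l) (isLowerSet_Iic l) ⟶ V := freeLift (fun j : ι => j.1) hd
  refine ⟨ι, s, d, cokerDesc _ q ?_, hs, cokerDesc_surjective _ _ _ ?_⟩
  · intro v
    induction v using free_induction with
    | h0 => simp
    | hadd x y hx hy => rw [map_add, map_add, hx, hy, add_zero]
    | h j a ha ha' =>
      refine (freeLift_incl (E := V) (s := fun j => (s j : I)) (hJ := T.spanOf_isGradedLeftIdeal (isLowerSet_Iic l)) _ hd j a
        (spanOf_mono Set.Iio_subset_Iic_self ha) ha').trans ?_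
      -- The element `a` is a combination of products through idempotents of weight `< l`, all of
      -- which annihilate an X-free module of type `l`.
      have : V.act a = 0 := by
        clear ha'
        induction ha using Submodule.span_induction with
        | mem a ha =>
          obtain ⟨i, s, t, j, ht, x, hx, h, hh, y, hy, rfl⟩ := ha
          ext v
          rw [mul_assoc, ← one_mul_Y hy, ← mul_assoc h, H_mul_one hh, V.act_mul, ← H_mul_one hh,
            mul_assoc, V.act_mul, V.act_mul, hV.supp.lt t ht]
          simp
        | zero => simp
        | add a b _ _ ha hb => rw [map_add, ha, hb, add_zero]
        | smul c a _ ha => rw [map_smul, ha, smul_zero]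
      rw [this, LinearMap.zero_apply]
  · rw [← LinearMap.range_eq_top, eq_top_iff]
    rintro v -
    induction v using hV.induction with
    | h0 => exact zero_mem _
    | hadd x y hx hy => exact add_mem hx hy
    | h i t x v ht hx hv' =>
      obtain ⟨σ, hσ⟩ := exists_sum_homComp V.internal v
      rw [hσ, map_sum]
      refine Submodule.sum_mem _ fun n _ => ?_
      have h1 : V.act (A.one t) (homComp V.internal n v) = homComp V.internal n v := by
        have := homComp_act (A.one_mem t) n v
        rw [hv', sub_zero] at this
        exact this.symm
      let j : ι := ⟨homComp V.internal n v, t, n, ht, homComp_mem _ _ _, h1⟩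
      have hm : x * A.one (s j) ∈ T.spanOf (Set.Iic l) :=
        mul_mem_spanOf_left (isLowerSet_Iic l) x
          (one_mem_spanOf (isLowerSet_Iic l) (hs j).le)
      refine ⟨incl j _ hm (by rw [mul_assoc, A.one_mul_one]),
        (freeLift_incl (E := V) (s := fun j => (s j : I))
          (hJ := T.spanOf_isGradedLeftIdeal (isLowerSet_Iic l)) _ hd j _ hm _).trans ?_⟩
      rw [V.act_mul, hv j]

/-- Let `0 → K → P → V → 0` be the presentation and `P = F/F'` with `F` projective. The next degree
for `V` needs the current degree for `K` and the next one for `P`; the latter needs only the current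
degree for `F'`, which is filtered by good subquotients. It remains to see that `K` is good. -/
theorem Good.ext_subsingleton {N : GrModule (T.cartan m)} (n : ℕ) : ∀ (l : L) (V : GrModule A),
    T.Good l m V N → Subsingleton (Ext V (T.costd m N) (n + 1)) := by
  induction n with
  | zero => exact fun l V => ext_one_subsingleton
  | succ n ih =>
    intro l V hV
    obtain ⟨ι, s, d, g, hs, hg⟩ := exists_presentation hV.1
    have hP := freeOn_coker_good (s := s) (d := d) (isLowerSet_Iio l) (isLowerSet_Iic l)
      Set.Iio_subset_Iic_self (fun m hm => (le_iff_eq_or_lt.1 hm)) le_rfl (lt_irrefl l) N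
    have hPP := freeOn_shortExact (s := s) (d := d) (isLowerSet_Iio l) (isLowerSet_Iic l)
      Set.Iio_subset_Iic_self
    have hproj : Projective (T.freeOn s d (Set.Iic l) (isLowerSet_Iic l)) :=
      free_projective fun j => one_mem_spanOf (isLowerSet_Iic l) (hs j).le
    have hK := shortExact_ker g hg
    have hKX := IsXFree.of_shortExact hK hP.1 hV.1
    refine ext_subsingleton_right hK (n + 1) (ih l _ ⟨hKX, fun hm => ?_⟩)
      (ext_subsingleton_right hPP (n + 1)
        (ext_freeOn_subsingleton N (n + 1) ih (isLowerSet_Iio l)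
          ((T.lower_finite l).subset Set.Iio_subset_Iic_self))
        (ExtVanish.of_projective hproj (n + 1)))
    by_cases hlm : l = m
    -- At the critical weight, truncate the presentation: vanishing for `e_l K` in degree `n + 1`
    -- uses degree `n + 1` for `e_l P` and degree `n + 2` for `e_l V`. This is why `Good` demands
    -- vanishing in all positive degrees.
    · subst hlm
      obtain ⟨S, hS, e1, e2, e3⟩ := truncAt_shortExact hK hm hP.1.supp hV.1.supp
      intro n
      rw [← e1]
      refine ext_subsingleton_left hS (n + 1) ?_ ?_
      · rw [e2]
        exact hP.2 _ n
      · rw [e3]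
        exact hV.2 _ (n + 1)
    · exact extVanish_of_isZero (isXFree_truncAt_isZero hKX hlm hm)

/-- Vanishing of extensions between standard and costandard modules of different types. -/
theorem extVanish_std_costd_of_ne (hlm : l ≠ m) (M : GrModule (T.cartan l))
    (N : GrModule (T.cartan m)) : ExtVanish (T.std l M) (T.costd m N) := fun n =>
  Good.ext_subsingleton n l _ ⟨std_isXFree M, fun hV =>
    extVanish_of_isZero (isXFree_truncAt_isZero (std_isXFree M) hlm hV)⟩

/-- Vanishing of extensions between standard and costandard modules of the same type. -/
theorem extVanish_std_costd {M N : GrModule (T.cartan l)} (h : ExtVanish M N) :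
    ExtVanish (T.std l M) (T.costd l N) := fun n =>
  Good.ext_subsingleton n l _ ⟨std_isXFree M, fun hV =>
    h.of_iso_left (nonempty_truncAt_std M hV).some⟩

end TriangularBasis

/-! ### Flags -/

section Flags

open GrModule Abelian ZeroObject

variable {k : Type u} [Field k] {I : Type v} {A : GrAlgebra k I} {B : Type w}

theorem shortExact_cokernel {C : Type*} [Category* C] [Abelian C] {X Y : C} (f : X ⟶ Y) [Mono f] :
    (ShortComplex.mk f (cokernel.π f) (cokernel.condition f)).ShortExact :=
  ShortComplex.ShortExact.mk' (ShortComplex.exact_cokernel f) inferInstance inferInstance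

/-- Induction up the filtration: each term is an extension of a layer by the preceding term. -/
theorem HasAscFlag.extVanish {layer : B → GrModule A → Prop} {V W : GrModule A}
    (hV : HasAscFlag layer V) (h : ∀ b V, layer b V → ExtVanish V W) : ExtVanish V W := by
  obtain ⟨n, F, b, -, h0, h1, hF⟩ := hV
  have key : ∀ r, ExtVanish (F r : GrModule A) W := by
    intro r
    induction r using Fin.induction with
    | zero =>
      rw [h0]
      exact .of_projective ((isZero_zero _).of_iso Subobject.botCoeIsoZero).projective
    | succ r ih =>
      exact fun n => ext_subsingleton_middle (shortExact_cokernel (Subobject.ofLE (F r.castSucc)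
        (F r.succ) (F.monotone r.castSucc_le_succ))) (n + 1) (ih n) (h _ _ (hF r) n)
  have := key (Fin.last n)
  rw [h1] at this
  exact this.of_iso_left (asIso (⊤ : Subobject V).arrow)

/-- The filtration descends to zero, so the induction starts at its last index; shifting is exact
and carries the filtration to one of `W.shift d`. -/
theorem HasDescFlag.extVanish {layer : B → GrModule A → Prop} {V W : GrModule A}
    (hW : HasDescFlag layer W) (d : ℤ) (h : ∀ b W, layer b W → ExtVanish V (W.shift d)) :
    ExtVanish V (W.shift d) := by
  obtain ⟨n, F, b, -, h0, h1, hF⟩ := hW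
  have key : ∀ r, ExtVanish V (((OrderDual.ofDual (F r) : Subobject W) : GrModule A).shift d) := by
    intro r
    induction r using Fin.reverseInduction with
    | last =>
      rw [h1]
      obtain ⟨e⟩ := nonempty_shiftIso (Subobject.botCoeIsoZero (B := W)) d
      have hz : Injective (0 : GrModule A) := (isZero_zero _).injective
      exact ExtVanish.of_iso_right (.of_injective (shift_injective hz d)) e.symm
    | cast r ih =>
      have hle : (OrderDual.ofDual (F r.succ) : Subobject W) ≤ OrderDual.ofDual (F r.castSucc) :=
        F.monotone r.castSucc_le_succ
      exact fun n => ext_subsingleton_middle' (shortExact_shift (shortExact_cokernel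
        (Subobject.ofLE _ _ hle)) d) (n + 1) (ih n) (h _ _ (hF r) n)
  have := key 0
  rw [h0] at this
  obtain ⟨e⟩ := nonempty_shiftIso (asIso (⊤ : Subobject W).arrow) d
  exact this.of_iso_right e

end Flags

/-! ### Layers -/

namespace TriangularBasis

open GrModule

variable {k : Type u} [Field k] {I : Type v} {A : GrAlgebra k I} {L : Type w} [PartialOrder L]
  {T : TriangularBasis A L} {l m : L}

theorem nonempty_costdShift (N : GrModule (T.cartan m)) (d : ℤ) :
    Nonempty (T.costd m (N.shift d) ≅ (T.costd m N).shift d) := by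
  obtain ⟨e⟩ := GrAlgebra.Idem.nonempty_jStarShift (e := T.ebar m) N d
  exact ⟨inflateIso e⟩

/-- For equal types, projectivity of the module being standardized supplies the vanishing over
`A_l`; for different types none is needed. -/
theorem IsDeltaLayer.extVanish {V W : GrModule A} (hV : T.IsDeltaLayer l V)
    (hW : T.IsProperNablaLayer m W) (d : ℤ) : ExtVanish V (W.shift d) := by
  obtain ⟨M, hM, -, -, ⟨e⟩⟩ := hV
  obtain ⟨N, -, -, ⟨e'⟩⟩ := hW
  obtain ⟨e₁⟩ := nonempty_shiftIso e' d
  obtain ⟨e₂⟩ := nonempty_costdShift N d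
  refine ExtVanish.of_iso_right (.of_iso_left ?_ e.symm) (e₂ ≪≫ e₁.symm)
  by_cases hlm : l = m
  · subst hlm
    exact extVanish_std_costd (.of_projective hM)
  · exact extVanish_std_costd_of_ne hlm M _

/-- Here the vanishing over `A_l` comes from injectivity on the costandard side, which survives the
shift. -/
theorem IsProperDeltaLayer.extVanish {V W : GrModule A} (hV : T.IsProperDeltaLayer l V)
    (hW : T.IsNablaLayer m W) (d : ℤ) : ExtVanish V (W.shift d) := by
  obtain ⟨M, -, -, ⟨e⟩⟩ := hV
  obtain ⟨N, hN, -, -, ⟨e'⟩⟩ := hW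
  obtain ⟨e₁⟩ := nonempty_shiftIso e' d
  obtain ⟨e₂⟩ := nonempty_costdShift N d
  refine ExtVanish.of_iso_right (.of_iso_left ?_ e.symm) (e₂ ≪≫ e₁.symm)
  by_cases hlm : l = m
  · subst hlm
    exact extVanish_std_costd (.of_injective (shift_injective hN d))
  · exact extVanish_std_costd_of_ne hlm M _

/-- The passage from the inner algebras to `A`. The predicates `P` and `P'` stand for the two
notions of layer over the algebras `A_l`, so that both situations of the theorem are covered. Only
layers over the same `A_l` have to be compared through `h`. -/
theorem extVanish_std_costd_of_reindex {B : L → Type w'} [∀ l, PartialOrder (B l)]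
    (Q : ∀ l, BasedAffineQuasiHereditary (T.cartan l) (B l)) {b b' : Σ l, B l}
    {P P' : ∀ b : Σ l, B l, GrModule ((T.cartan b.1).reindex (Q b.1).idem) → Prop}
    (h : ∀ l (c c' : B l) V W d, P ⟨l, c⟩ V → P' ⟨l, c'⟩ W → ExtVanish V (W.shift d))
    {V W : GrModule A} {V' : GrModule (T.cartan b.1)} {W' : GrModule (T.cartan b'.1)}
    (hV' : P b (V'.toReindex (Q b.1).idem)) (hW' : P' b' (W'.toReindex (Q b'.1).idem))
    (hV : Nonempty (V ≅ T.std b.1 V')) (hW : Nonempty (W ≅ T.costd b'.1 W')) (d : ℤ) :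
    ExtVanish V (W.shift d) := by
  obtain ⟨e⟩ := hV
  obtain ⟨e'⟩ := hW
  obtain ⟨e₁⟩ := nonempty_shiftIso e' d
  obtain ⟨e₂⟩ := nonempty_costdShift W' d
  refine ExtVanish.of_iso_right (.of_iso_left ?_ e.symm) (e₂ ≪≫ e₁.symm)
  obtain ⟨l, c⟩ := b
  obtain ⟨l', c'⟩ := b'
  by_cases hlm : l = l'
  · subst hlm
    exact extVanish_std_costd
      (extVanish_of_toReindex (Q l).idem (h l c c' _ _ d hV' hW'))
  -- Shifting and reindexing commute definitionally, so `h` applies to the shifted module as it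
  -- stands.
  · exact extVanish_std_costd_of_ne hlm V' _

end TriangularBasis

end

end GradedTriangular

/-- Both flags are unwound to single layers. The layer vanishing theorems, applied to the triangular
basis of each `A_l` given by `Q l`, provide the comparison over `A_l` that is then carried to `A`.
-/
theorem mainTheorem11 {k : Type*} [Field k] [IsAlgClosed k] {I : Type*}
    (A : GradedTriangular.GrAlgebra k I)
    (hfin : A.IsLocallyFiniteDimensional) (hbdd : A.IsBoundedBelow)
    {L : Type*} [PartialOrder L] (T : GradedTriangular.TriangularBasis A L)
    {B : L → Type*} [∀ l, PartialOrder (B l)]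
    (Q : ∀ l, GradedTriangular.BasedAffineQuasiHereditary (T.cartan l) (B l))
    (V W : GradedTriangular.GrModule A) :
    (GradedTriangular.HasAscFlag (T.IsPureDeltaLayer Q) V →
      GradedTriangular.HasDescFlag (T.IsPureProperNablaLayer Q) W →
      ∀ n : ℕ, 1 ≤ n → ∀ d : ℤ,
        Subsingleton (CategoryTheory.Abelian.Ext V (W.shift d) n)) ∧
    (GradedTriangular.HasAscFlag (T.IsPureProperDeltaLayer Q) V →
      GradedTriangular.HasDescFlag (T.IsPureNablaLayer Q) W →
      ∀ n : ℕ, 1 ≤ n → ∀ d : ℤ,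
        Subsingleton (CategoryTheory.Abelian.Ext V (W.shift d) n)) := by
  constructor
  · intro hV hW n hn d
    obtain ⟨n, rfl⟩ := Nat.exists_eq_add_of_le' hn
    refine hV.extVanish (fun b V ⟨V', hV', hV⟩ => hW.extVanish d fun b' W ⟨W', hW', hW⟩ => ?_) n
    exact GradedTriangular.TriangularBasis.extVanish_std_costd_of_reindex Q
      (P := fun b => (Q b.1).basis.IsDeltaLayer b.2)
      (P' := fun b => (Q b.1).basis.IsProperNablaLayer b.2)
      (fun _ _ _ _ _ d hV hW => hV.extVanish hW d) hV' hW' hV hW d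
  · intro hV hW n hn d
    obtain ⟨n, rfl⟩ := Nat.exists_eq_add_of_le' hn
    refine hV.extVanish (fun b V ⟨V', hV', hV⟩ => hW.extVanish d fun b' W ⟨W', hW', hW⟩ => ?_) n
    exact GradedTriangular.TriangularBasis.extVanish_std_costd_of_reindex Q
      (P := fun b => (Q b.1).basis.IsProperDeltaLayer b.2)
      (P' := fun b => (Q b.1).basis.IsNablaLayer b.2)
      (fun _ _ _ _ _ d hV hW => hV.extVanish hW d) hV' hW' hV hW d
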